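/- Let $p>5$, let $\sigma\in\{+1,-1\}$, and write $-\Box=\partial_t^2-\Delta$ on $\mathbb R^{1+3}$, $r=|x|$, $\omega=x/|x|$, $\langle x\rangle=(1+|x|^2)^{1/2}$, $\|\cdot\|=\|\cdot\|_{L^2(\mathbb R^3)}$. There exists $\epsilon_0=\epsilon_0(p,\sigma)>0$ such that for every $0<\epsilon<\epsilon_0$ the following holds. Let $u_0,u_1:\mathbb R^3\to\mathbb R$ be functions with weak derivatives up to order $6$ and $5$ respectively such that for $k=0,1,2$ $$\sum_{|I|\le 6-k,\ |J|=k}\|\langle x\rangle^{|I|}\nabla^I\nabla^J u_0\|+\sum_{|I|\le 5-\max\{k-1,0\},\ |J|=\max\{k-1,0\}}\|\langle x\rangle^{|I|+\max\{1-k,0\}}\nabla^I\nabla^{J}u_1\|\le \epsilon^{k-1}$$ (sums over multi-indices $I,J\in\mathbb N^3$). Let $h_0\in C^6(\mathbb R^3)$ and $h_1\in C^5(\mathbb R^3)$ be real-valued, supported in $\{1\le |x|\le 2\}$, with $\sum_{|I|\le 6}|\nabla^I h_0(x)|+\sum_{|J|\le 5}|\nabla^J h_1(x)|\le 1$ for all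 $x$. Write $h_i(\rho,\omega)=h_i(\rho\omega)$ in polar coordinates, put $h_i(\rho,\omega)=0$ for $\rho\le 0$, and set $$w_0=\epsilon^{1/2}h_0\big(\tfrac{1-r}{\epsilon},\omega\big),\qquad w_1=\epsilon^{-1/2}h_1\big(\tfrac{1-r}{\epsilon},\omega\big),$$ and suppose that $|w_1+\partial_r w_0|\le \epsilon^{1/2}$ everywhere. Then the problem $-\Box\psi=\sigma|\psi|^{p-1}\psi$, $(\psi,\partial_t\psi)|_{t=1}=(u_0,u_1)$ has a classical ($C^2$) solution $\psi$ on $[1,\infty)\times\mathbb R^3$ (the data being attained almost everywhere), and for every such solution $\psi$ there is a real-valued function $\phi$ that is a classical ($C^2$) solution of $$-\Box\phi=\sigma\Big(|\psi+\phi|^{p-1}\phi+\big(|\psi+\phi|^{p-1}-|\psi|^{p-1}\big)\psi\Big)=\sigma\Big(|\psi+\phi|^{p-1}(\psi+\phi)-|\psi|^{p-1}\psi\Big),\qquad (\phi,\partial_t\phi)|_{t=1}=(w_0,w_1),$$ globally in time, on $[1,\infty)\times\mathbb R^3$, and so in particular on the whole interior region $$\mathcal D^{in}=\{(t,x):\ t\ge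 1+2\epsilon,\ 0\le r\le t-4\epsilon\}.$$ -/

import Mathlib

open scoped ContDiff InnerProductSpace
open MeasureTheory Set

namespace ShortPulse

/-- Three-dimensional Euclidean space. -/
abbrev E3 : Type := EuclideanSpace ℝ (Fin 3)

/-- Spatial multi-indices. -/
abbrev MultiIndex : Type := Fin 3 → ℕ

/-- The multi-indices of order exactly `m`. -/
def multiIndicesOfOrder (m : ℕ) : Finset MultiIndex :=
  Finset.piAntidiag Finset.univ m

/-- The multi-indices of order at most `n`. -/
def multiIndicesUpTo (n : ℕ) : Finset MultiIndex :=
  (Finset.range (n + 1)).biUnion multiIndicesOfOrder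

/-- The order `|I|` of a multi-index. -/
def order (I : MultiIndex) : ℕ := ∑ a, I a

noncomputable section

/-- The partial derivative `∂_a f`. -/
def partialDeriv (a : Fin 3) (f : E3 → ℝ) : E3 → ℝ :=
  fun x => fderiv ℝ f x (EuclideanSpace.single a 1)

/-- The iterated partial derivative `∇^I f = ∂_1^{I_1} ∂_2^{I_2} ∂_3^{I_3} f`. -/
def multiDeriv (I : MultiIndex) (f : E3 → ℝ) : E3 → ℝ :=
  (partialDeriv 0)^[I 0] ((partialDeriv 1)^[I 1] ((partialDeriv 2)^[I 2] f))

/-- `g` is the weak (distributional) derivative `∇^I f`. -/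
def IsWeakDeriv (I : MultiIndex) (f g : E3 → ℝ) : Prop :=
  LocallyIntegrable f ∧ LocallyIntegrable g ∧
    ∀ η : E3 → ℝ, ContDiff ℝ ∞ η → HasCompactSupport η →
      ∫ x, f x * multiDeriv I η x = (-1) ^ order I * ∫ x, g x * η x

/-- The weighted norm `‖⟨x⟩^m f‖` in `L²(ℝ³)`, where `⟨x⟩ = (1 + |x|²)^{1/2}`
(with value `∞` when the function is not square integrable). -/
def weightedL2 (m : ℕ) (f : E3 → ℝ) : ENNReal :=
  eLpNorm (fun x => Real.sqrt (1 + ‖x‖ ^ 2) ^ m * f x) 2 volume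

/-- Dispersed data: `u₀` and `u₁` have weak derivatives up to orders six and five, and for
`k = 0, 1, 2`
`∑_{|I| ≤ 6-k, |J| = k} ‖⟨x⟩^{|I|} ∇^I ∇^J u₀‖
  + ∑_{|I| ≤ 5-max(k-1,0), |J| = max(k-1,0)} ‖⟨x⟩^{|I|+max(1-k,0)} ∇^I ∇^J u₁‖ ≤ ε^{k-1}`.
The subtractions `k - 1` and `1 - k` of natural numbers are truncated, which is the maximum
with `0`. -/
def IsDispersedData (ε : ℝ) (u₀ u₁ : E3 → ℝ) : Prop :=
  ∃ D₀ D₁ : MultiIndex → E3 → ℝ,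
    (∀ I, order I ≤ 6 → IsWeakDeriv I u₀ (D₀ I)) ∧
    (∀ I, order I ≤ 5 → IsWeakDeriv I u₁ (D₁ I)) ∧
    ∀ k : ℕ, k ≤ 2 →
      (∑ J ∈ multiIndicesOfOrder k, ∑ I ∈ multiIndicesUpTo (6 - k),
          weightedL2 (order I) (D₀ (I + J)))
        + (∑ J ∈ multiIndicesOfOrder (k - 1), ∑ I ∈ multiIndicesUpTo (5 - (k - 1)),
          weightedL2 (order I + (1 - k)) (D₁ (I + J)))
      ≤ ENNReal.ofReal (ε ^ ((k : ℤ) - 1))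

/-- The function `x = r ω ↦ h((1 - r)/ε, ω)`, where `h` on `ℝ³` is read in polar coordinates
`h(ρ, ω) = h(ρ ω)`, `ρ > 0`. For `r ≥ 1` the radial argument is not positive, hence outside the
support of the profile, and the value is `0`. -/
def pulse (ε : ℝ) (h : E3 → ℝ) : E3 → ℝ :=
  fun x => if ‖x‖ < 1 then h (((1 - ‖x‖) / ε) • (‖x‖⁻¹ • x)) else 0

/-- `w₀ = ε^{1/2} h₀((1 - r)/ε, ω)`. -/
def pulseData₀ (ε : ℝ) (h₀ : E3 → ℝ) : E3 → ℝ :=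
  fun x => ε ^ (1 / 2 : ℝ) * pulse ε h₀ x

/-- `w₁ = ε^{-1/2} h₁((1 - r)/ε, ω)`. -/
def pulseData₁ (ε : ℝ) (h₁ : E3 → ℝ) : E3 → ℝ :=
  fun x => ε ^ (-(1 / 2) : ℝ) * pulse ε h₁ x

/-- The radial derivative `∂_r f`. -/
def radialDeriv (f : E3 → ℝ) : E3 → ℝ :=
  fun x => fderiv ℝ f x (‖x‖⁻¹ • x)

/-- Admissible short-pulse profiles `h₀, h₁`. -/
structure IsPulseProfile (ε : ℝ) (h₀ h₁ : E3 → ℝ) : Prop where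
  contDiff₀ : ContDiff ℝ 6 h₀
  contDiff₁ : ContDiff ℝ 5 h₁
  support₀ : ∀ x, h₀ x ≠ 0 → 1 ≤ ‖x‖ ∧ ‖x‖ ≤ 2
  support₁ : ∀ x, h₁ x ≠ 0 → 1 ≤ ‖x‖ ∧ ‖x‖ ≤ 2
  bound : ∀ x, (∑ I ∈ multiIndicesUpTo 6, |multiDeriv I h₀ x|)
    + (∑ J ∈ multiIndicesUpTo 5, |multiDeriv J h₁ x|) ≤ 1
  outgoing : ∀ x, |pulseData₁ ε h₁ x + radialDeriv (pulseData₀ ε h₀) x| ≤ ε ^ (1 / 2 : ℝ)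

/-- `-□ φ (t, x) = (∂_t² φ - Δ φ)(t, x)`. -/
def negBox (φ : ℝ → E3 → ℝ) (t : ℝ) (x : E3) : ℝ :=
  deriv (deriv fun s => φ s x) t - Laplacian.laplacian (φ t) x

/-- `φ` is a classical solution of `-□ φ = G(t, x, φ)` on the space-time set `U`: it is of class
`C²` on `U`, and the equation holds at every interior point of `U`. -/
def IsClassicalSolutionOn (U : Set (ℝ × E3)) (G : ℝ → E3 → ℝ → ℝ) (φ : ℝ → E3 → ℝ) : Prop :=
  ContDiffOn ℝ 2 (fun z : ℝ × E3 => φ z.1 z.2) U ∧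
    ∀ t x, (t, x) ∈ interior U → negBox φ t x = G t x (φ t x)

/-- The set `{t ≥ 1}` on which the Cauchy problems with data at `t₀ = 1` are posed. -/
def future : Set (ℝ × E3) := {z | 1 ≤ z.1}

/-- The interior region `{t ≥ 1 + 2ε, r ≤ t - 4ε}`. -/
def interiorRegion (ε : ℝ) : Set (ℝ × E3) :=
  {z | 1 + 2 * ε ≤ z.1 ∧ ‖z.2‖ ≤ z.1 - 4 * ε}

/-- `φ = f` and `∂_t φ = g` at the initial time `t₀ = 1` and the point `x`. -/
def HasInitialDataAt (φ : ℝ → E3 → ℝ) (f g : E3 → ℝ) (x : E3) : Prop :=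
  φ 1 x = f x ∧ HasDerivWithinAt (fun t => φ t x) (g x) (Ici 1) 1

/-- `ψ` is a global solution of `-□ ψ = σ |ψ|^{p-1} ψ`, `(ψ, ∂_t ψ)(1) = (u₀, u₁)`. The data are
Sobolev functions, so they are attained almost everywhere. -/
def IsDispersedSolution (p σ : ℝ) (u₀ u₁ : E3 → ℝ) (ψ : ℝ → E3 → ℝ) : Prop :=
  IsClassicalSolutionOn future (fun _ _ v => σ * (|v| ^ (p - 1) * v)) ψ ∧
    ∀ᵐ x : E3, HasInitialDataAt ψ u₀ u₁ x

/-- `σ 𝒩` with `𝒩 = |ψ+φ|^{p-1} φ + (|ψ+φ|^{p-1} - |ψ|^{p-1}) ψ`, as a function of `(t, x)` and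
of the value `v` of `φ`. -/
def perturbationSource (p σ : ℝ) (ψ : ℝ → E3 → ℝ) (t : ℝ) (x : E3) (v : ℝ) : ℝ :=
  σ * (|ψ t x + v| ^ (p - 1) * v + (|ψ t x + v| ^ (p - 1) - |ψ t x| ^ (p - 1)) * ψ t x)

end

end ShortPulse

open Filter Topology
open scoped Pointwise
set_option linter.unusedSectionVars false
set_option maxSynthPendingDepth 3

namespace ShortPulse

/-! ### The uniform measure on the unit sphere, polar coordinates, and invariance under isometries.
-/

noncomputable section

/-! If `Ψ` solves the power equation with the combined data `(u₀ + w₀, u₁ + w₁)`, then for every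
solution `ψ` with data `(u₀, u₁)` the difference `Ψ - ψ` solves the perturbation equation with data
`(w₀, w₁)`. So it suffices to solve the power equation globally for the dispersed data alone and for
the combined data. Neither uniqueness nor energy conservation is used, and the sign `σ` plays no
role.

Global solvability is a contraction in a supremum norm with the weight `W = (1 + ε²|x|²)^{-1/4}`.
This weight is superharmonic with `-ΔW ≥ (ε²/4) W⁵`. With `M_s` the mean over the sphere of radius
`s`, the Darboux equation gives `∫₀ᵗ s M_s(-ΔW) ds ≤ W`; hence a source of size `A W⁵` has a Duhamel
integral of size at most `4 A ε⁻² W`, for all times (`norm_duhamel_le`). If the free evolution is at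
most `C ε^{1/2} W`, the map has a Lipschitz constant of order `ε⁻² (ε^{1/2})^{p-1} = ε^{(p-5)/2}`,
which is small. To obtain a `C²` solution, the contraction acts on rescaled jets `(u, δ∇u, δ²∇²u)`;
since `δ` may depend on the data, only `u` itself has to be small (`exists_jet_solution`,
`exists_global_solution`).

It remains to bound the two free evolutions by `ε^{1/2} W`. For dispersed data, Kirchhoff's formula
involves spherical means of `u`, `t∇u` and `tv`. Cauchy-Schwarz against the weight `W²`, which is
still superharmonic, reduces them to means of `q f²` with `q = W⁻²`. These are controlled by
weighted energies through a trace inequality and Hardy's inequality, and the scaling of the data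
makes the resulting bound `O(ε)` (`abs_freeWave_le`, `exists_dispersed_family`). The Sobolev data
are first replaced by continuous representatives, obtained by mollification.

For the pulse, the dangerous term is the radial derivative, of size `ε^{-1/2}`. In Kirchhoff's
integrand it appears in the combination `w₁ + ∂_r w₀`, small by hypothesis, and in a remainder
carrying the factor `t (1 - cos) ≤ |x|²`. A sphere of radius `t` about `x` meets the shell
supporting the pulse in a fraction at most `ε / (t|x|)` of its area, by Archimedes' theorem on
spherical zones, and this compensates the remainder (`abs_pulse_integrand_le`, `sph_shell_le`,
`abs_freeWave_pulse_le`). -/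

/-- The area of the unit sphere. -/
def sphArea : ENNReal := (volume : Measure E3).toSphere univ

/-- The uniform probability measure on the unit sphere, as a measure on `E3`. -/
def sph : Measure E3 :=
  sphArea⁻¹ • ((volume : Measure E3).toSphere.map Subtype.val)

lemma sphArea_ne_zero : sphArea ≠ 0 := by
  rw [sphArea, Ne, Measure.measure_univ_eq_zero]
  exact Measure.toSphere_ne_zero _

lemma sphArea_ne_top : sphArea ≠ ⊤ := measure_ne_top _ _

instance : IsProbabilityMeasure sph := ⟨by
  rw [sph, Measure.smul_apply, Measure.map_apply measurable_subtype_coe MeasurableSet.univ]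
  exact ENNReal.inv_mul_cancel sphArea_ne_zero sphArea_ne_top⟩

lemma sph_compl_sphere : sph (Metric.sphere (0 : E3) 1)ᶜ = 0 := by
  rw [sph, Measure.smul_apply, Measure.map_apply measurable_subtype_coe
    Metric.isClosed_sphere.measurableSet.compl]
  simp

lemma ae_sph_norm : ∀ᵐ θ ∂sph, ‖θ‖ = 1 := by
  rw [ae_iff]
  convert sph_compl_sphere using 2
  ext; simp

lemma lintegral_sph {f : E3 → ENNReal} (hf : Measurable f) :
    ∫⁻ θ, f θ ∂sph = sphArea⁻¹ * ∫⁻ θ, f (θ : E3) ∂(volume : Measure E3).toSphere := by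
  rw [sph, lintegral_smul_measure, lintegral_map hf measurable_subtype_coe, smul_eq_mul]

/-- Polar coordinates around the point `x`. -/
lemma lintegral_polar {f : E3 → ENNReal} (hf : Measurable f) (x : E3) :
    ∫⁻ y, f y = sphArea * ∫⁻ ρ in Ioi (0 : ℝ),
      ENNReal.ofReal (ρ ^ 2) * ∫⁻ θ, f (x + ρ • θ) ∂sph := by
  have hx : ∫⁻ y, f y = ∫⁻ y, f (x + y) := (lintegral_add_left_eq_self f x).symm
  have hg : Measurable (fun y => f (x + y)) := hf.comp (measurable_const_add x)
  have key := (Measure.measurePreserving_homeomorphUnitSphereProd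
    (volume : Measure E3)).symm (e := (homeomorphUnitSphereProd E3).toMeasurableEquiv)
  have h1 : ∫⁻ y, f (x + y) = ∫⁻ y : ({0}ᶜ : Set E3), f (x + y) ∂(Measure.comap Subtype.val volume) := by
    rw [lintegral_subtype_comap (MeasurableSet.singleton _).compl (fun y => f (x + y)),
      restrict_compl_singleton]
  rw [hx, h1, ← key.lintegral_comp (f := fun y => f (x + (y : E3)))
    (hg.comp measurable_subtype_coe), lintegral_prod_symm]
  swap
  · exact ((hg.comp measurable_subtype_coe).comp
      (homeomorphUnitSphereProd E3).symm.measurable).aemeasurable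
  have hm : Measurable fun p : ℝ × E3 => f (x + p.1 • p.2) := hf.comp (by fun_prop)
  have h2 : ∀ ρ : ℝ, ∫⁻ θ, f (x + ρ • (θ : E3)) ∂(volume : Measure E3).toSphere
      = sphArea * ∫⁻ θ, f (x + ρ • θ) ∂sph := by
    intro ρ
    rw [lintegral_sph (f := fun θ => f (x + ρ • θ)) (hf.comp (by fun_prop)), ← mul_assoc,
      ENNReal.mul_inv_cancel sphArea_ne_zero sphArea_ne_top, one_mul]
  have hm2 : Measurable fun ρ : ℝ => ∫⁻ θ, f (x + ρ • (θ : E3)) ∂(volume : Measure E3).toSphere := by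
    refine Measurable.lintegral_prod_right' (f := fun p : ℝ × Metric.sphere (0:E3) 1 =>
      f (x + p.1 • (p.2 : E3))) (hf.comp (by fun_prop))
  have h3 : (Module.finrank ℝ E3 - 1) = 2 := by simp
  rw [h3, Measure.volumeIoiPow, lintegral_withDensity_eq_lintegral_mul]
  rotate_left
  · fun_prop
  · exact hm2.comp measurable_subtype_coe
  have h4 : ∀ ρ : Ioi (0:ℝ), ((fun r : Ioi (0:ℝ) => ENNReal.ofReal (r.1 ^ 2)) * fun y : Ioi (0:ℝ) =>
      ∫⁻ θ, f (x + (((homeomorphUnitSphereProd E3).toMeasurableEquiv.symm (θ, y) :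
        ({0}ᶜ : Set E3)) : E3)) ∂(volume : Measure E3).toSphere) ρ =
      (fun ρ : ℝ => ENNReal.ofReal (ρ ^ 2) * (sphArea * ∫⁻ θ, f (x + ρ • θ) ∂sph)) ρ := by
    intro ρ
    simp only [Pi.mul_apply, ← h2]
    rfl
  erw [lintegral_congr h4]
  rw [lintegral_subtype_comap measurableSet_Ioi
    (fun ρ : ℝ => ENNReal.ofReal (ρ ^ 2) * (sphArea * ∫⁻ θ, f (x + ρ • θ) ∂sph)),
    ← lintegral_const_mul' _ _ sphArea_ne_top]
  congr 1; ext ρ; ring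

/-- The measure `sph` is invariant under linear isometries. -/
lemma map_sph (R : E3 ≃ₗᵢ[ℝ] E3) : sph.map R = sph := by
  have hc : ∀ s : Set E3, MeasurableSet s → sph s =
      sphArea⁻¹ * (3 * volume (Ioo (0 : ℝ) 1 • (s ∩ Metric.sphere (0 : E3) 1))) := by
    intro s hs
    rw [sph, Measure.smul_apply, Measure.map_apply measurable_subtype_coe hs,
      Measure.toSphere_apply' _ (measurable_subtype_coe hs), Subtype.image_preimage_coe]
    simp [inter_comm]
  ext s hs
  rw [Measure.map_apply R.continuous.measurable hs, hc _ (R.continuous.measurable hs), hc _ hs]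
  have : Ioo (0 : ℝ) 1 • (R ⁻¹' s ∩ Metric.sphere (0 : E3) 1)
      = R ⁻¹' (Ioo (0 : ℝ) 1 • (s ∩ Metric.sphere (0 : E3) 1)) := by
    ext y
    simp only [Set.mem_smul, mem_inter_iff, mem_preimage, mem_sphere_iff_norm, sub_zero]
    constructor
    · rintro ⟨a, ha, z, ⟨hz, hz1⟩, rfl⟩
      exact ⟨a, ha, R z, ⟨hz, by simpa using hz1⟩, by simp⟩
    · rintro ⟨a, ha, z, ⟨hz, hz1⟩, h⟩
      refine ⟨a, ha, R.symm z, ⟨by simpa using hz, by simpa using hz1⟩, ?_⟩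
      apply R.injective
      simp [h]
  have h := (R.measurePreserving).measure_preimage_emb R.toHomeomorph.measurableEmbedding
    (Ioo (0 : ℝ) 1 • (s ∩ Metric.sphere (0 : E3) 1))
  rw [this, h]

lemma integral_sph_comp {V : Type*} [NormedAddCommGroup V] [NormedSpace ℝ V]
    (R : E3 ≃ₗᵢ[ℝ] E3) (f : E3 → V) : ∫ θ, f (R θ) ∂sph = ∫ θ, f θ ∂sph := by
  conv_rhs => rw [← map_sph R]
  exact (integral_map_equiv R.toMeasurableEquiv f).symm

lemma integral_sph_neg {V : Type*} [NormedAddCommGroup V] [NormedSpace ℝ V] (f : E3 → V) :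
    ∫ θ, f (-θ) ∂sph = ∫ θ, f θ ∂sph :=
  integral_sph_comp (LinearIsometryEquiv.neg ℝ) f

/-! ### Parameter integrals against finite measures carried by a compact set. -/

section Parametric

variable {X Y V : Type*} [NormedAddCommGroup V] [NormedSpace ℝ V]
  [TopologicalSpace Y] [MeasurableSpace Y] [OpensMeasurableSpace Y]
  [SecondCountableTopology Y] {μ : Measure Y} [IsFiniteMeasure μ] {K : Set Y}

lemma continuous_integral_of_compact [TopologicalSpace X] [FirstCountableTopology X]
    [LocallyCompactSpace X] (hK : IsCompact K) (hμ : μ Kᶜ = 0) {f : X → Y → V}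
    (hf : Continuous (Function.uncurry f)) : Continuous fun x => ∫ y, f x y ∂μ := by
  have h : μ.restrict K = μ := Measure.restrict_eq_self_of_ae_mem (by rwa [ae_iff])
  have := continuous_parametric_integral_of_continuous (μ := μ) hf hK
  rwa [h] at this

lemma integrable_of_compact {V : Type*} [NormedAddCommGroup V] (hK : IsCompact K) (hμ : μ Kᶜ = 0) {f : Y → V}
    (hf : Continuous f) : Integrable f μ := by
  obtain ⟨C, hC⟩ := hK.exists_bound_of_continuousOn hf.continuousOn
  refine Integrable.of_bound (C := C) hf.aestronglyMeasurable ?_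
  have : ∀ᵐ y ∂μ, y ∈ K := by rwa [ae_iff]
  filter_upwards [this] with y hy using hC y hy

variable {H : Type*} [NormedAddCommGroup H] [NormedSpace ℝ H] [LocallyCompactSpace H]

/-- Continuity bounds the derivative on the product of `K` with a compact neighbourhood of `x`, so a
constant dominates. The form with a carrier `K` serves both the sphere in `E3` and intervals in `ℝ`.
-/
lemma hasFDerivAt_integral_of_compact (hK : IsCompact K) (hμ : μ Kᶜ = 0) {f : H → Y → V}
    {f' : H → Y → H →L[ℝ] V} (hf : Continuous (Function.uncurry f))
    (hf' : Continuous (Function.uncurry f')) (h : ∀ x y, HasFDerivAt (f · y) (f' x y) x) (x : H) :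
    HasFDerivAt (fun x => ∫ y, f x y ∂μ) (∫ y, f' x y ∂μ) x := by
  obtain ⟨U, hU, hUx⟩ := exists_compact_mem_nhds x
  obtain ⟨C, hC⟩ := (hU.prod hK).exists_bound_of_continuousOn hf'.continuousOn
  have hae : ∀ᵐ y ∂μ, y ∈ K := by rwa [ae_iff]
  have hc : ∀ x, Continuous (f x) := fun x => hf.comp (Continuous.prodMk_right x)
  have hc' : ∀ x, Continuous (f' x) := fun x => hf'.comp (Continuous.prodMk_right x)
  refine hasFDerivAt_integral_of_dominated_of_fderiv_le (bound := fun _ => C) hUx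
    (Eventually.of_forall fun x => (hc x).aestronglyMeasurable)
    (integrable_of_compact hK hμ (hc x)) (hc' x).aestronglyMeasurable ?_
    (integrable_const _) (Eventually.of_forall fun y x _ => h x y)
  filter_upwards [hae] with y hy x hx using hC (x, y) ⟨hx, hy⟩

lemma hasDerivAt_integral_of_compact (hK : IsCompact K) (hμ : μ Kᶜ = 0) {f f' : ℝ → Y → V}
    (hf : Continuous (Function.uncurry f))
    (hf' : Continuous (Function.uncurry f')) (h : ∀ x y, HasDerivAt (f · y) (f' x y) x) (x : ℝ) :
    HasDerivAt (fun x => ∫ y, f x y ∂μ) (∫ y, f' x y ∂μ) x := by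
  obtain ⟨U, hU, hUx⟩ := exists_compact_mem_nhds x
  obtain ⟨C, hC⟩ := (hU.prod hK).exists_bound_of_continuousOn hf'.continuousOn
  have hae : ∀ᵐ y ∂μ, y ∈ K := by rwa [ae_iff]
  have hc : ∀ x, Continuous (f x) := fun x => hf.comp (Continuous.prodMk_right x)
  have hc' : ∀ x, Continuous (f' x) := fun x => hf'.comp (Continuous.prodMk_right x)
  refine (hasDerivAt_integral_of_dominated_loc_of_deriv_le (bound := fun _ => C) hUx
    (Eventually.of_forall fun x => (hc x).aestronglyMeasurable)
    (integrable_of_compact hK hμ (hc x)) (hc' x).aestronglyMeasurable ?_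
    (integrable_const _) (Eventually.of_forall fun y x _ => h x y)).2
  filter_upwards [hae] with y hy x hx using hC (x, y) ⟨hx, hy⟩

end Parametric

/-! ### Rotations and the spherical Laplacian. -/

section Sphere

variable {V : Type*} [NormedAddCommGroup V] [NormedSpace ℝ V]

lemma isCompact_unitSphere : IsCompact (Metric.sphere (0 : E3) 1) := isCompact_sphere _ _

lemma integrable_sph {V : Type*} [NormedAddCommGroup V] {f : E3 → V} (hf : Continuous f) : Integrable f sph :=
  integrable_of_compact isCompact_unitSphere sph_compl_sphere hf

lemma continuous_integral_sph {X : Type*} [TopologicalSpace X] [FirstCountableTopology X]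
    [LocallyCompactSpace X] {f : X → E3 → V} (hf : Continuous (Function.uncurry f)) :
    Continuous fun x => ∫ θ, f x θ ∂sph :=
  continuous_integral_of_compact isCompact_unitSphere sph_compl_sphere hf

/-- The standard basis vectors. -/
abbrev basisVec (i : Fin 3) : E3 := EuclideanSpace.single i 1

/-- The infinitesimal rotation in the `(i, j)`-plane. -/
def rotGen (i j : Fin 3) (y : E3) : E3 := y i • basisVec j - y j • basisVec i

/-- The rotation by the angle `φ` in the `(i, j)`-plane. -/
def rotFun (i j : Fin 3) (φ : ℝ) (y : E3) : E3 :=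
  y + (Real.cos φ - 1) • (y i • basisVec i + y j • basisVec j) + Real.sin φ • rotGen i j y

lemma norm_rotFun {i j : Fin 3} (hij : i ≠ j) (φ : ℝ) (y : E3) : ‖rotFun i j φ y‖ = ‖y‖ := by
  have h : ‖rotFun i j φ y‖ ^ 2 = ‖y‖ ^ 2 := by
    rw [EuclideanSpace.real_norm_sq_eq, EuclideanSpace.real_norm_sq_eq]
    have hs := Real.sin_sq_add_cos_sq φ
    fin_cases i <;> fin_cases j <;> first | exact absurd rfl hij | skip
    all_goals
      simp [rotFun, rotGen, Fin.sum_univ_three]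
    · linear_combination (y 0 ^ 2 + y 1 ^ 2) * hs
    · linear_combination (y 0 ^ 2 + y 2 ^ 2) * hs
    · linear_combination (y 0 ^ 2 + y 1 ^ 2) * hs
    · linear_combination (y 1 ^ 2 + y 2 ^ 2) * hs
    · linear_combination (y 0 ^ 2 + y 2 ^ 2) * hs
    · linear_combination (y 1 ^ 2 + y 2 ^ 2) * hs
  exact (pow_left_inj₀ (norm_nonneg _) (norm_nonneg _) two_ne_zero).1 h

/-- The rotation by the angle `φ` in the `(i, j)`-plane, as a linear isometry. -/
def rot {i j : Fin 3} (hij : i ≠ j) (φ : ℝ) : E3 ≃ₗᵢ[ℝ] E3 :=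
  LinearIsometry.toLinearIsometryEquiv
    { toFun := rotFun i j φ
      map_add' := fun x y => by simp only [rotFun, rotGen, PiLp.add_apply]; module
      map_smul' := fun c x => by
        simp only [rotFun, rotGen, PiLp.smul_apply, smul_eq_mul, RingHom.id_apply]; module
      norm_map' := norm_rotFun hij φ } rfl

/-- By rotation invariance the mean of `f` composed with the rotation by `φ` does not depend on `φ`;
this is its derivative at `φ = 0`. -/
lemma integral_sph_rotGen {i j : Fin 3} (hij : i ≠ j) {f : E3 → V} {f' : E3 → E3 →L[ℝ] V}
    (hf : ∀ y, HasFDerivAt f (f' y) y) (hf' : Continuous f') :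
    ∫ θ, f' θ (rotGen i j θ) ∂sph = 0 := by
  have hfc : Continuous f := continuous_iff_continuousAt.2 fun y => (hf y).continuousAt
  have hrot : Continuous fun p : ℝ × E3 => rotFun i j p.1 p.2 := by
    unfold rotFun rotGen; fun_prop
  let r' : ℝ → E3 → E3 := fun φ y =>
    (-Real.sin φ) • (y i • basisVec i + y j • basisVec j) + Real.cos φ • rotGen i j y
  have hr' : Continuous fun p : ℝ × E3 => r' p.1 p.2 := by
    simp only [r', rotGen]; fun_prop
  have hd : ∀ φ y, HasDerivAt (fun φ => rotFun i j φ y) (r' φ y) φ := by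
    intro φ y
    have h1 := ((Real.hasDerivAt_cos φ).sub_const 1).smul_const
      (y i • basisVec i + y j • basisVec j)
    have h2 := (Real.hasDerivAt_sin φ).smul_const (rotGen i j y)
    exact (h1.const_add y).add h2
  have h := hasDerivAt_integral_of_compact (μ := sph) isCompact_unitSphere sph_compl_sphere
    (f := fun φ y => f (rotFun i j φ y)) (f' := fun φ y => f' (rotFun i j φ y) (r' φ y))
    (hfc.comp hrot) ((hf'.comp hrot).clm_apply hr')
    (fun φ y => (hf _).comp_hasDerivAt φ (hd φ y)) 0
  have hconst : (fun φ : ℝ => ∫ θ, f (rotFun i j φ θ) ∂sph) = fun _ => ∫ θ, f θ ∂sph := by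
    ext φ
    exact integral_sph_comp (rot hij φ) f
  rw [hconst] at h
  have h0 := h.unique (hasDerivAt_const _ _)
  simpa [r', rotFun, rotGen] using h0

/-- The trace `∑ₐ B(eₐ, eₐ)` of a bilinear form. -/
def traceBil (B : E3 →L[ℝ] E3 →L[ℝ] V) : V := ∑ a : Fin 3, B (basisVec a) (basisVec a)

lemma eq_sum_basisVec (y : E3) : y = ∑ a : Fin 3, y a • basisVec a := by
  ext i
  simp [Finset.sum_apply, Pi.single_apply]

/-- The squares of the three infinitesimal rotations add up to `-2` times the identity. This
supplies the first-order part of the spherical Laplacian. -/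
lemma rotGen_comp_sum (ℓ : E3 →L[ℝ] V) (y : E3) :
    ℓ (rotGen 0 1 (rotGen 0 1 y)) + ℓ (rotGen 0 2 (rotGen 0 2 y))
      + ℓ (rotGen 1 2 (rotGen 1 2 y)) = -(2 : ℝ) • ℓ y := by
  have : rotGen 0 1 (rotGen 0 1 y) + rotGen 0 2 (rotGen 0 2 y) + rotGen 1 2 (rotGen 1 2 y)
      = -(2 : ℝ) • y := by
    ext i
    fin_cases i <;> simp [rotGen] <;> ring
  rw [← map_add, ← map_add, this, map_smul]

/-- Lagrange's identity for bilinear forms: on the unit sphere the rotation fields compute the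
tangential trace, the full trace minus the radial entry. -/
lemma bilin_rotGen_sum (B : E3 →L[ℝ] E3 →L[ℝ] V) (y : E3) :
    B (rotGen 0 1 y) (rotGen 0 1 y) + B (rotGen 0 2 y) (rotGen 0 2 y)
      + B (rotGen 1 2 y) (rotGen 1 2 y) = ‖y‖ ^ 2 • traceBil B - B y y := by
  have hy : B y y = ∑ a : Fin 3, ∑ b : Fin 3, (y a * y b) • B (basisVec a) (basisVec b) := by
    conv_lhs => rw [eq_sum_basisVec y]
    simp only [map_sum, map_smul, sum_apply, smul_apply,
      Finset.smul_sum, smul_smul]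
    rw [Finset.sum_comm]
    simp only [mul_comm]
  rw [hy, EuclideanSpace.real_norm_sq_eq]
  simp only [traceBil, rotGen, Fin.sum_univ_three, map_sub, map_smul,
    sub_apply, smul_apply]
  module

end Sphere

/-! ### Kirchhoff's formula and the Darboux equation. -/

section Kirchhoff

variable {V : Type*} [NormedAddCommGroup V] [NormedSpace ℝ V]

/-- The mean of `g` over the sphere of radius `|t|` around `x`. -/
def sphMean (g : E3 → V) (t : ℝ) (x : E3) : V := ∫ θ, g (x + t • θ) ∂sph

/-- Kirchhoff's solution `t M_t g` of the wave equation with data `(0, g)`. -/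
def kir (g : E3 → V) (t : ℝ) (x : E3) : V := t • sphMean g t x

/-- The time derivative `M_t g + t ∂_t M_t g` of Kirchhoff's solution, for `g` with derivative
`g'`. -/
def kirD (g : E3 → V) (g' : E3 → E3 →L[ℝ] V) (t : ℝ) (x : E3) : V :=
  sphMean g t x + t • ∫ θ, g' (x + t • θ) θ ∂sph

variable {g : E3 → V} {g' : E3 → E3 →L[ℝ] V} {g'' : E3 → E3 →L[ℝ] E3 →L[ℝ] V}

lemma continuous_sphMean_param {Z : Type*} [TopologicalSpace Z] [FirstCountableTopology Z]
    [LocallyCompactSpace Z] {G : Z → E3 → V} (hG : Continuous (Function.uncurry G))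
    {τ : Z → ℝ} (hτ : Continuous τ) {ξ : Z → E3} (hξ : Continuous ξ) :
    Continuous fun z => sphMean (G z) (τ z) (ξ z) :=
  continuous_integral_sph (f := fun z θ => G z (ξ z + τ z • θ))
    (hG.comp (f := fun p : Z × E3 => (p.1, ξ p.1 + τ p.1 • p.2)) (by fun_prop))

lemma continuous_kir_param {Z : Type*} [TopologicalSpace Z] [FirstCountableTopology Z]
    [LocallyCompactSpace Z] {G : Z → E3 → V} (hG : Continuous (Function.uncurry G))
    {τ : Z → ℝ} (hτ : Continuous τ) {ξ : Z → E3} (hξ : Continuous ξ) :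
    Continuous fun z => kir (G z) (τ z) (ξ z) :=
  hτ.smul (continuous_sphMean_param hG hτ hξ)

lemma continuous_kirD_param {Z : Type*} [TopologicalSpace Z] [FirstCountableTopology Z]
    [LocallyCompactSpace Z] {G : Z → E3 → V} {G' : Z → E3 → E3 →L[ℝ] V}
    (hG : Continuous (Function.uncurry G)) (hG' : Continuous (Function.uncurry G'))
    {τ : Z → ℝ} (hτ : Continuous τ) {ξ : Z → E3} (hξ : Continuous ξ) :
    Continuous fun z => kirD (G z) (G' z) (τ z) (ξ z) := by
  refine (continuous_sphMean_param hG hτ hξ).add (hτ.smul ?_)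
  refine continuous_integral_sph (f := fun z θ => G' z (ξ z + τ z • θ) θ) ?_
  exact (hG'.comp (f := fun p : Z × E3 => (p.1, ξ p.1 + τ p.1 • p.2)) (by fun_prop)).clm_apply
    continuous_snd

lemma sphMean_neg (g : E3 → V) (t : ℝ) (x : E3) : sphMean g (-t) x = sphMean g t x := by
  rw [sphMean, ← integral_sph_neg]
  simp [sphMean]

lemma sphMean_zero (g : E3 → V) (x : E3) [CompleteSpace V] : sphMean g 0 x = g x := by
  simp [sphMean]

lemma kir_zero (g : E3 → V) (x : E3) : kir g 0 x = 0 := by simp [kir]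

lemma kirD_zero [CompleteSpace V] (g : E3 → V) (g' : E3 → E3 →L[ℝ] V) (x : E3) :
    kirD g g' 0 x = g x := by
  simp [kirD, sphMean_zero]

lemma continuous_of_hasFDerivAt {E F : Type*} [NormedAddCommGroup E] [NormedSpace ℝ E]
    [NormedAddCommGroup F] [NormedSpace ℝ F] {f : E → F} {f' : E → E →L[ℝ] F}
    (h : ∀ y, HasFDerivAt f (f' y) y) : Continuous f :=
  continuous_iff_continuousAt.2 fun y => (h y).continuousAt

lemma hasFDerivAt_sphMean (hg : ∀ y, HasFDerivAt g (g' y) y) (hg' : Continuous g') (t : ℝ) (x : E3) :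
    HasFDerivAt (sphMean g t) (sphMean g' t x) x := by
  have hgc := continuous_of_hasFDerivAt hg
  refine hasFDerivAt_integral_of_compact (μ := sph) isCompact_unitSphere sph_compl_sphere
    (f := fun x θ => g (x + t • θ)) (f' := fun x θ => g' (x + t • θ))
    (by fun_prop) (by fun_prop) (fun x θ => ?_) x
  exact (hg (x + t • θ)).comp x ((hasFDerivAt_id x).add_const (t • θ))

lemma hasFDerivAt_kir (hg : ∀ y, HasFDerivAt g (g' y) y) (hg' : Continuous g') (t : ℝ) (x : E3) :
    HasFDerivAt (kir g t) (kir g' t x) x :=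
  (hasFDerivAt_sphMean hg hg' t x).const_smul t

lemma hasDerivAt_sphMean (hg : ∀ y, HasFDerivAt g (g' y) y) (hg' : Continuous g') (t : ℝ) (x : E3) :
    HasDerivAt (fun t => sphMean g t x) (∫ θ, g' (x + t • θ) θ ∂sph) t := by
  have hgc := continuous_of_hasFDerivAt hg
  refine hasDerivAt_integral_of_compact (μ := sph) isCompact_unitSphere sph_compl_sphere
    (f := fun t θ => g (x + t • θ)) (f' := fun t θ => g' (x + t • θ) θ)
    (by fun_prop) (by fun_prop)
    (fun t θ => ?_) t
  have h1 : HasDerivAt (fun t : ℝ => x + t • θ) θ t := by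
    simpa using ((hasDerivAt_id t).smul_const θ).const_add x
  exact (hg (x + t • θ)).comp_hasDerivAt t h1

lemma hasDerivAt_kir (hg : ∀ y, HasFDerivAt g (g' y) y) (hg' : Continuous g') (t : ℝ) (x : E3) :
    HasDerivAt (fun t => kir g t x) (kirD g g' t x) t := by
  have := (hasDerivAt_id' t).fun_smul (hasDerivAt_sphMean hg hg' t x)
  simpa [kir, kirD, add_comm] using this

lemma hasFDerivAt_kirD (hg : ∀ y, HasFDerivAt g (g' y) y)
    (hg2 : ∀ y, HasFDerivAt g' (g'' y) y)
    (hg'' : Continuous g'') (t : ℝ) (x : E3) :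
    HasFDerivAt (kirD g g' t) (kirD g' g'' t x) x := by
  have hg' := continuous_of_hasFDerivAt hg2
  have h1 := hasFDerivAt_integral_of_compact (μ := sph) isCompact_unitSphere sph_compl_sphere
    (f := fun x θ => g' (x + t • θ) θ) (f' := fun x θ => g'' (x + t • θ) θ)
    (by fun_prop) (by fun_prop) (fun x θ => by
      have h : HasFDerivAt (fun x => g' (x + t • θ)) (g'' (x + t • θ)) x :=
        (hg2 (x + t • θ)).comp x ((hasFDerivAt_id x).add_const (t • θ))
      have h' := h.clm_apply (hasFDerivAt_const θ x)
      -- Symmetry of the second derivative exchanges the fixed direction `θ` with the direction of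
      -- differentiation. Therefore differentiating `kirD` in space yields `kirD` of the derivative.
      have e : g'' (x + t • θ) θ = (g' (x + t • θ)).comp (0 : E3 →L[ℝ] E3)
          + (g'' (x + t • θ)).flip θ := by
        ext v
        simp [second_derivative_symmetric hg (hg2 (x + t • θ)) θ v]
      rw [e]
      exact h') x
  exact (hasFDerivAt_sphMean hg hg' t x).add (h1.const_smul t)

/-- The integral over the unit sphere of the spherical Laplacian of a function with gradient `A`
vanishes. -/
lemma integral_sph_traceBil {A : E3 → E3 →L[ℝ] V} {B : E3 → E3 →L[ℝ] E3 →L[ℝ] V}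
    (hA : ∀ y, HasFDerivAt A (B y) y) (hB : Continuous B) :
    ∫ θ, traceBil (B θ) ∂sph = ∫ θ, B θ θ θ ∂sph + (2 : ℝ) • ∫ θ, A θ θ ∂sph := by
  have hAc := continuous_of_hasFDerivAt hA
  have hcR : ∀ i j, Continuous (rotGen i j) := fun i j => by unfold rotGen; fun_prop
  have hrot : ∀ i j : Fin 3, i ≠ j →
      ∫ θ, (B θ (rotGen i j θ) (rotGen i j θ) + A θ (rotGen i j (rotGen i j θ))) ∂sph = 0 := by
    intro i j hij
    let R : E3 →L[ℝ] E3 := LinearMap.toContinuousLinearMap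
      { toFun := rotGen i j
        map_add' := fun a b => by simp only [rotGen, PiLp.add_apply]; module
        map_smul' := fun c a => by
          simp only [rotGen, PiLp.smul_apply, smul_eq_mul, RingHom.id_apply]; module }
    have hR : ∀ y, R y = rotGen i j y := fun _ => rfl
    have hd : ∀ θ, HasFDerivAt (fun θ => A θ (R θ)) ((A θ).comp R + (B θ).flip (R θ)) θ :=
      fun θ => (hA θ).clm_apply R.hasFDerivAt
    have hc : Continuous fun θ => ((A θ).comp R + (B θ).flip (R θ)) := by
      refine (hAc.clm_comp continuous_const).add ?_
      refine Continuous.clm_apply ?_ R.continuous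
      exact (ContinuousLinearMap.flipₗᵢ ℝ E3 E3 V).continuous.comp hB
    -- The function being rotated is `θ ↦ A θ (R θ)`; its derivative along `R θ` has one term from
    -- `B` and one from applying `R` twice.
    rw [← integral_sph_rotGen hij hd hc]
    congr 1; ext θ
    simp [hR, add_comm]
  have hi : ∀ i j, Integrable (fun θ => B θ (rotGen i j θ) (rotGen i j θ)
        + A θ (rotGen i j (rotGen i j θ))) sph := fun i j =>
    integrable_sph (((hB.clm_apply (hcR i j)).clm_apply (hcR i j)).add
      (hAc.clm_apply ((hcR i j).comp (hcR i j))))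
  have hsum := congrArg₂ (· + ·) (congrArg₂ (· + ·) (hrot 0 1 (by decide)) (hrot 0 2 (by decide)))
    (hrot 1 2 (by decide))
  simp only [add_zero] at hsum
  have hi' : Integrable (fun θ => (B θ (rotGen 0 1 θ) (rotGen 0 1 θ)
      + A θ (rotGen 0 1 (rotGen 0 1 θ))) + (B θ (rotGen 0 2 θ) (rotGen 0 2 θ)
      + A θ (rotGen 0 2 (rotGen 0 2 θ)))) sph := (hi 0 1).add (hi 0 2)
  rw [← integral_add (hi 0 1) (hi 0 2), ← integral_add hi' (hi 1 2)] at hsum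
  have hcT : Continuous fun θ : E3 => traceBil (B θ) := by
    unfold traceBil
    exact continuous_finsetSum _ fun a _ => (hB.clm_apply continuous_const).clm_apply
      continuous_const
  have hcI : Continuous fun θ : E3 => A θ θ := hAc.clm_apply continuous_id
  have hcII : Continuous fun θ : E3 => B θ θ θ :=
    (hB.clm_apply continuous_id).clm_apply continuous_id
  have hsumT : ∫ θ, ((traceBil (B θ) - B θ θ θ) - (2 : ℝ) • A θ θ) ∂sph = 0 := by
    rw [← hsum]
    refine integral_congr_ae ?_
    filter_upwards [ae_sph_norm] with θ hθ
    have e1 := rotGen_comp_sum (A θ) θ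
    have e2 := bilin_rotGen_sum (B θ) θ
    rw [hθ, one_pow, one_smul] at e2
    rw [← e2, sub_eq_add_neg, ← neg_smul, ← e1]
    module
  rw [integral_sub (integrable_sph (hcT.fun_sub hcII))
    (integrable_sph (hcI.fun_const_smul (2 : ℝ))),
    integral_smul, integral_sub (integrable_sph hcT) (integrable_sph hcII), sub_sub,
    sub_eq_zero] at hsumT
  exact hsumT

/-- The Darboux equation: the second time derivative of Kirchhoff's solution `t M_t g` is
`t M_t Δg`. -/
lemma hasDerivAt_kirD (hg : ∀ y, HasFDerivAt g (g' y) y) (hg2 : ∀ y, HasFDerivAt g' (g'' y) y)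
    (hg'' : Continuous g'') (t : ℝ) (x : E3) :
    HasDerivAt (fun t => kirD g g' t x) (kir (fun y => traceBil (g'' y)) t x) t := by
  have hg' := continuous_of_hasFDerivAt hg2
  have hline : ∀ (θ : E3) (t : ℝ), HasDerivAt (fun t : ℝ => x + t • θ) θ t := fun θ t => by
    simpa using ((hasDerivAt_id t).smul_const θ).const_add x
  have hd : ∀ t θ, HasDerivAt (fun t : ℝ => g' (x + t • θ) θ) (g'' (x + t • θ) θ θ) t := by
    intro t θ
    have h0 : HasDerivAt (fun t : ℝ => g' (x + t • θ)) (g'' (x + t • θ) θ) t :=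
      (hg2 (x + t • θ)).comp_hasDerivAt t (hline θ t)
    exact (ContinuousLinearMap.apply ℝ V θ).hasFDerivAt.comp_hasDerivAt t h0
  have hc1 : Continuous (Function.uncurry fun (t : ℝ) (θ : E3) => g' (x + t • θ) θ) := by
    fun_prop
  have hc2 : Continuous (Function.uncurry fun (t : ℝ) (θ : E3) => g'' (x + t • θ) θ θ) :=
    ((hg''.comp (f := fun p : ℝ × E3 => x + p.1 • p.2) (by fun_prop)).clm_apply
      continuous_snd).clm_apply continuous_snd
  have h1 := hasDerivAt_integral_of_compact (μ := sph) isCompact_unitSphere sph_compl_sphere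
    (f := fun t θ => g' (x + t • θ) θ) (f' := fun t θ => g'' (x + t • θ) θ θ)
    hc1 hc2 hd t
  have h2 := (hasDerivAt_sphMean hg hg' t x).fun_add ((hasDerivAt_id' t).fun_smul h1)
  -- The radial second derivative and the two first-order terms from the time derivative are what
  -- this identity converts into the trace. The factor `t` in `B` is the inner derivative of `θ ↦ x
  -- + t • θ`.
  have key := integral_sph_traceBil (A := fun θ => g' (x + t • θ))
    (B := fun θ => t • g'' (x + t • θ)) (fun θ => by
      have h := (hg2 (x + t • θ)).comp θ (((hasFDerivAt_id θ).const_smul t).const_add x)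
      have e : t • g'' (x + t • θ) = (g'' (x + t • θ)).comp (t • ContinuousLinearMap.id ℝ E3) := by
        ext; simp
      rw [e]
      exact h) ((hg''.comp (f := fun θ : E3 => x + t • θ) (by fun_prop)).const_smul t)
  refine h2.congr_deriv ?_
  have e1 : ∀ θ, traceBil (t • g'' (x + t • θ)) = t • traceBil (g'' (x + t • θ)) := fun θ => by
    simp [traceBil, Finset.smul_sum]
  simp only [e1, smul_apply, integral_smul] at key
  unfold kir sphMean
  rw [key]
  module

section CLM

variable [CompleteSpace V] {U : Type*} [NormedAddCommGroup U] [NormedSpace ℝ U] [CompleteSpace U]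

lemma sphMean_clm (T : V →L[ℝ] U) (hg : Continuous g) (t : ℝ) (x : E3) :
    T (sphMean g t x) = sphMean (fun y => T (g y)) t x :=
  (T.integral_comp_comm (φ := fun θ => g (x + t • θ)) (integrable_sph (by fun_prop))).symm

lemma kir_clm (T : V →L[ℝ] U) (hg : Continuous g) (t : ℝ) (x : E3) :
    T (kir g t x) = kir (fun y => T (g y)) t x := by
  rw [kir, kir, map_smul, sphMean_clm T hg]

lemma kirD_clm (T : V →L[ℝ] U) (hg : Continuous g) (hg' : Continuous g') (t : ℝ) (x : E3) :
    T (kirD g g' t x) = kirD (fun y => T (g y)) (fun y => T.comp (g' y)) t x := by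
  rw [kirD, kirD, map_add, map_smul, sphMean_clm T hg,
    ← T.integral_comp_comm (φ := fun θ => g' (x + t • θ) θ) (integrable_sph (by fun_prop))]
  rfl

end CLM

end Kirchhoff

/-! ### Leibniz' rule for interval integrals. -/

section Interval

variable {V : Type*} [NormedAddCommGroup V] [NormedSpace ℝ V]

lemma isFiniteMeasure_uIoc (a b : ℝ) : IsFiniteMeasure (volume.restrict (uIoc a b)) :=
  ⟨by rw [Measure.restrict_apply_univ, uIoc]; exact measure_Ioc_lt_top⟩

lemma restrict_uIoc_compl (a b : ℝ) : volume.restrict (uIoc a b) (uIcc a b)ᶜ = 0 := by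
  rw [Measure.restrict_apply measurableSet_uIcc.compl]
  convert measure_empty (μ := (volume : Measure ℝ))
  ext x
  simp only [mem_inter_iff, mem_compl_iff, mem_empty_iff_false, iff_false, not_and]
  intro h h'
  exact h (uIoc_subset_uIcc h')

lemma hasFDerivAt_intervalIntegral {H : Type*} [NormedAddCommGroup H] [NormedSpace ℝ H]
    [LocallyCompactSpace H] {f : H → ℝ → V} {f' : H → ℝ → H →L[ℝ] V}
    (hf : Continuous (Function.uncurry f)) (hf' : Continuous (Function.uncurry f'))
    (h : ∀ x y, HasFDerivAt (f · y) (f' x y) x) (a b : ℝ) (x : H) :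
    HasFDerivAt (fun x => ∫ y in a..b, f x y) (∫ y in a..b, f' x y) x := by
  have := isFiniteMeasure_uIoc a b
  simp only [intervalIntegral.intervalIntegral_eq_integral_uIoc]
  exact (hasFDerivAt_integral_of_compact isCompact_uIcc (restrict_uIoc_compl a b)
    hf hf' h x).const_smul _

lemma hasDerivAt_intervalIntegral {f f' : ℝ → ℝ → V}
    (hf : Continuous (Function.uncurry f)) (hf' : Continuous (Function.uncurry f'))
    (h : ∀ x y, HasDerivAt (f · y) (f' x y) x) (a b : ℝ) (x : ℝ) :
    HasDerivAt (fun x => ∫ y in a..b, f x y) (∫ y in a..b, f' x y) x := by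
  have := isFiniteMeasure_uIoc a b
  simp only [intervalIntegral.intervalIntegral_eq_integral_uIoc]
  exact (hasDerivAt_integral_of_compact isCompact_uIcc (restrict_uIoc_compl a b)
    hf hf' h x).const_smul _

/-- Differentiation of an integral whose upper limit and integrand depend on the parameter. -/
lemma hasDerivAt_integral_upper [CompleteSpace V] {k k' : ℝ → ℝ → V}
    (hk : Continuous (Function.uncurry k))
    (hk' : Continuous (Function.uncurry k')) (h : ∀ t s, HasDerivAt (k · s) (k' t s) t) (t : ℝ) :
    HasDerivAt (fun t => ∫ s in (0 : ℝ)..t, k t s) (k t t + ∫ s in (0 : ℝ)..t, k' t s) t := by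
  have hcont : ∀ b, Continuous (k b) := fun b => hk.comp (Continuous.prodMk_right b)
  -- The upper limit `a` and the parameter `b` are treated as independent variables; continuous
  -- partial derivatives give joint differentiability, and the claim is the chain rule along the
  -- diagonal.
  have key := hasStrictFDerivAt_uncurry_coprod (𝕜 := ℝ) (u := ((t, t) : ℝ × ℝ))
    (f := fun a b => ∫ s in (0 : ℝ)..a, k b s)
    (f₁ := fun a b => ContinuousLinearMap.toSpanSingleton ℝ (k b a))
    (f₂ := fun a b => ContinuousLinearMap.toSpanSingleton ℝ (∫ s in (0 : ℝ)..a, k' b s))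
    (Eventually.of_forall fun v => by
      exact ((hcont v.2).integral_hasStrictDerivAt 0 v.1).hasDerivAt.hasFDerivAt)
    (Eventually.of_forall fun v => by
      exact (hasDerivAt_intervalIntegral hk hk' h 0 v.1 v.2).hasFDerivAt)
    (by
      have hc : Continuous fun v : ℝ × ℝ => ContinuousLinearMap.toSpanSingleton ℝ (k v.2 v.1) :=
        (ContinuousLinearMap.toSpanSingletonCLE (𝕜 := ℝ) (E := V)).continuous.comp
          (hk.comp (f := fun v : ℝ × ℝ => (v.2, v.1)) (by fun_prop))
      exact hc.continuousAt)
    (by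
      have hc : Continuous fun v : ℝ × ℝ =>
          ContinuousLinearMap.toSpanSingleton ℝ (∫ s in (0 : ℝ)..v.1, k' v.2 s) := by
        refine (ContinuousLinearMap.toSpanSingletonCLE (𝕜 := ℝ) (E := V)).continuous.comp ?_
        exact intervalIntegral.continuous_parametric_intervalIntegral_of_continuous
          (f := fun (v : ℝ × ℝ) s => k' v.2 s)
          (hk'.comp (f := fun p : (ℝ × ℝ) × ℝ => (p.1.2, p.2)) (by fun_prop)) continuous_fst
      exact hc.continuousAt)
  have h2 : HasDerivAt (fun t : ℝ => (t, t)) ((1, 1) : ℝ × ℝ) t :=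
    (hasDerivAt_id t).prodMk (hasDerivAt_id t)
  have h3 := HasFDerivAt.comp_hasDerivAt (f := fun t : ℝ => (t, t)) t key.hasFDerivAt h2
  refine h3.congr_deriv ?_
  simp [Function.HasUncurry.uncurry]

end Interval

/-! ### Joint regularity from continuous partial derivatives in time and space. -/

section Partials

variable {V : Type*} [NormedAddCommGroup V] [NormedSpace ℝ V]
  {f ft : ℝ → E3 → V} {fx : ℝ → E3 → E3 →L[ℝ] V}

/-- The total derivative assembled from the partial derivatives in time and space. -/
def totalDeriv (a : V) (b : E3 →L[ℝ] V) : ℝ × E3 →L[ℝ] V :=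
  (ContinuousLinearMap.toSpanSingleton ℝ a).comp (ContinuousLinearMap.fst ℝ ℝ E3)
    + b.comp (ContinuousLinearMap.snd ℝ ℝ E3)

lemma hasFDerivAt_of_partials (ht : ∀ t x, HasDerivAt (f · x) (ft t x) t)
    (hx : ∀ t x, HasFDerivAt (f t) (fx t x) x) (hft : Continuous (Function.uncurry ft))
    (hfx : Continuous (Function.uncurry fx)) (z : ℝ × E3) :
    HasFDerivAt (fun z : ℝ × E3 => f z.1 z.2) (totalDeriv (ft z.1 z.2) (fx z.1 z.2)) z := by
  have key := hasStrictFDerivAt_uncurry_coprod (𝕜 := ℝ) (u := z) (f := f)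
    (f₁ := fun t x => ContinuousLinearMap.toSpanSingleton ℝ (ft t x)) (f₂ := fx)
    (Eventually.of_forall fun v => (ht v.1 v.2).hasFDerivAt)
    (Eventually.of_forall fun v => hx v.1 v.2)
    (((ContinuousLinearMap.toSpanSingletonCLE (𝕜 := ℝ) (E := V)).continuous.comp
      hft).continuousAt) hfx.continuousAt
  refine key.hasFDerivAt.congr_fderiv ?_
  ext <;> simp [totalDeriv, Function.HasUncurry.uncurry]

lemma contDiff_totalDeriv {n : WithTop ℕ∞} (hft : ContDiff ℝ n fun z : ℝ × E3 => ft z.1 z.2)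
    (hfx : ContDiff ℝ n fun z : ℝ × E3 => fx z.1 z.2) :
    ContDiff ℝ n fun z : ℝ × E3 => totalDeriv (ft z.1 z.2) (fx z.1 z.2) := by
  unfold totalDeriv
  refine ContDiff.add ?_ (hfx.clm_comp contDiff_const)
  exact ((ContinuousLinearMap.toSpanSingletonCLE (𝕜 := ℝ) (E := V)).contDiff.comp hft).clm_comp
    contDiff_const

lemma contDiff_one_of_partials (ht : ∀ t x, HasDerivAt (f · x) (ft t x) t)
    (hx : ∀ t x, HasFDerivAt (f t) (fx t x) x) (hft : Continuous (Function.uncurry ft))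
    (hfx : Continuous (Function.uncurry fx)) : ContDiff ℝ 1 fun z : ℝ × E3 => f z.1 z.2 := by
  refine contDiff_one_iff_hasFDerivAt.2 ⟨_, ?_, hasFDerivAt_of_partials ht hx hft hfx⟩
  exact (contDiff_totalDeriv (n := 0) (contDiff_zero.2 hft) (contDiff_zero.2 hfx)).continuous

lemma contDiff_two_of_partials (ht : ∀ t x, HasDerivAt (f · x) (ft t x) t)
    (hx : ∀ t x, HasFDerivAt (f t) (fx t x) x)
    (hft : ContDiff ℝ 1 fun z : ℝ × E3 => ft z.1 z.2)
    (hfx : ContDiff ℝ 1 fun z : ℝ × E3 => fx z.1 z.2) :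
    ContDiff ℝ 2 fun z : ℝ × E3 => f z.1 z.2 := by
  have h : (2 : WithTop ℕ∞) = ((1 : ℕ) : WithTop ℕ∞) + 1 := by norm_num
  rw [h, contDiff_succ_iff_hasFDerivAt]
  refine ⟨_, contDiff_totalDeriv hft hfx, hasFDerivAt_of_partials ht hx hft.continuous
    hfx.continuous⟩

end Partials

/-! ### The Duhamel integral and its derivatives. -/

section Duhamel

variable {V : Type*} [NormedAddCommGroup V] [NormedSpace ℝ V] [CompleteSpace V]
  {G : ℝ → E3 → V} {G' : ℝ → E3 → E3 →L[ℝ] V} {G'' : ℝ → E3 → E3 →L[ℝ] E3 →L[ℝ] V}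

/-- The Duhamel integral: the solution of `-□ v = G` with vanishing data at `t = 0`. -/
def duhamel {V : Type*} [NormedAddCommGroup V] [NormedSpace ℝ V]
    (G : ℝ → E3 → V) (t : ℝ) (x : E3) : V := ∫ s in (0 : ℝ)..t, kir (G s) (t - s) x

/-- The time derivative of the Duhamel integral. -/
def duhamelD {V : Type*} [NormedAddCommGroup V] [NormedSpace ℝ V]
    (G : ℝ → E3 → V) (G' : ℝ → E3 → E3 →L[ℝ] V) (t : ℝ) (x : E3) : V :=
  ∫ s in (0 : ℝ)..t, kirD (G s) (G' s) (t - s) x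

lemma continuous_slice {W X Y : Type*} [TopologicalSpace W] [TopologicalSpace X]
    [TopologicalSpace Y] {F : X → Y → W} (hF : Continuous (Function.uncurry F)) (s : X) :
    Continuous (F s) := hF.comp (Continuous.prodMk_right s)

lemma continuous_duhamel (hG : Continuous (Function.uncurry G)) :
    Continuous (Function.uncurry (duhamel G)) := by
  refine intervalIntegral.continuous_parametric_intervalIntegral_of_continuous
    (f := fun (z : ℝ × E3) s => kir (G s) (z.1 - s) z.2) ?_ continuous_fst
  exact continuous_kir_param (Z := (ℝ × E3) × ℝ) (G := fun p => G p.2)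
    (hG.comp (f := fun p : ((ℝ × E3) × ℝ) × E3 => (p.1.2, p.2)) (by fun_prop))
    (τ := fun p => p.1.1 - p.2) (by fun_prop) (ξ := fun p => p.1.2) (by fun_prop)

lemma continuous_duhamelD (hG : Continuous (Function.uncurry G))
    (hG' : Continuous (Function.uncurry G')) :
    Continuous (Function.uncurry (duhamelD G G')) := by
  refine intervalIntegral.continuous_parametric_intervalIntegral_of_continuous
    (f := fun (z : ℝ × E3) s => kirD (G s) (G' s) (z.1 - s) z.2) ?_ continuous_fst
  exact continuous_kirD_param (Z := (ℝ × E3) × ℝ) (G := fun p => G p.2) (G' := fun p => G' p.2)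
    (hG.comp (f := fun p : ((ℝ × E3) × ℝ) × E3 => (p.1.2, p.2)) (by fun_prop))
    (hG'.comp (f := fun p : ((ℝ × E3) × ℝ) × E3 => (p.1.2, p.2)) (by fun_prop))
    (τ := fun p => p.1.1 - p.2) (by fun_prop) (ξ := fun p => p.1.2) (by fun_prop)

lemma hasFDerivAt_duhamel (hd : ∀ s y, HasFDerivAt (G s) (G' s y) y)
    (hG : Continuous (Function.uncurry G)) (hG' : Continuous (Function.uncurry G'))
    (t : ℝ) (x : E3) : HasFDerivAt (duhamel G t) (duhamel G' t x) x := by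
  refine hasFDerivAt_intervalIntegral (f := fun x s => kir (G s) (t - s) x)
    (f' := fun x s => kir (G' s) (t - s) x) ?_ ?_
    (fun x s => hasFDerivAt_kir (hd s) (continuous_slice hG' s) (t - s) x) 0 t x
  · exact continuous_kir_param (Z := E3 × ℝ) (G := fun p => G p.2)
      (hG.comp (f := fun p : (E3 × ℝ) × E3 => (p.1.2, p.2)) (by fun_prop))
      (τ := fun p => t - p.2) (by fun_prop) (ξ := fun p => p.1) (by fun_prop)
  · exact continuous_kir_param (Z := E3 × ℝ) (G := fun p => G' p.2)
      (hG'.comp (f := fun p : (E3 × ℝ) × E3 => (p.1.2, p.2)) (by fun_prop))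
      (τ := fun p => t - p.2) (by fun_prop) (ξ := fun p => p.1) (by fun_prop)

lemma continuous_kir_sub {V : Type*} [NormedAddCommGroup V] [NormedSpace ℝ V] {G : ℝ → E3 → V}
    (hG : Continuous (Function.uncurry G)) (x : E3) :
    Continuous (Function.uncurry fun t s : ℝ => kir (G s) (t - s) x) :=
  continuous_kir_param (Z := ℝ × ℝ) (G := fun p => G p.2)
    (hG.comp (f := fun p : (ℝ × ℝ) × E3 => (p.1.2, p.2)) (by fun_prop))
    (τ := fun p => p.1 - p.2) (by fun_prop) (ξ := fun _ => x) (by fun_prop)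

lemma continuous_kirD_sub {V : Type*} [NormedAddCommGroup V] [NormedSpace ℝ V] {G : ℝ → E3 → V}
    {G' : ℝ → E3 → E3 →L[ℝ] V} (hG : Continuous (Function.uncurry G))
    (hG' : Continuous (Function.uncurry G')) (x : E3) :
    Continuous (Function.uncurry fun t s : ℝ => kirD (G s) (G' s) (t - s) x) :=
  continuous_kirD_param (Z := ℝ × ℝ) (G := fun p => G p.2) (G' := fun p => G' p.2)
    (hG.comp (f := fun p : (ℝ × ℝ) × E3 => (p.1.2, p.2)) (by fun_prop))
    (hG'.comp (f := fun p : (ℝ × ℝ) × E3 => (p.1.2, p.2)) (by fun_prop))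
    (τ := fun p => p.1 - p.2) (by fun_prop) (ξ := fun _ => x) (by fun_prop)

lemma hasDerivAt_duhamel (hd : ∀ s y, HasFDerivAt (G s) (G' s y) y)
    (hG : Continuous (Function.uncurry G)) (hG' : Continuous (Function.uncurry G'))
    (t : ℝ) (x : E3) : HasDerivAt (fun t => duhamel G t x) (duhamelD G G' t x) t := by
  have := hasDerivAt_integral_upper (k := fun t s => kir (G s) (t - s) x)
    (k' := fun t s => kirD (G s) (G' s) (t - s) x) (continuous_kir_sub hG x)
    (continuous_kirD_sub hG hG' x) (fun t s =>
      (hasDerivAt_kir (hd s) (continuous_slice hG' s) (t - s) x).comp_sub_const t s) t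
  refine this.congr_deriv ?_
  -- The boundary term at `s = t` vanishes, because Kirchhoff's solution has zero initial value.
  simp [kir_zero, duhamelD]

lemma continuous_traceBil {V : Type*} [NormedAddCommGroup V] [NormedSpace ℝ V] {X : Type*}
    [TopologicalSpace X] {B : X → E3 →L[ℝ] E3 →L[ℝ] V}
    (hB : Continuous B) : Continuous fun y => traceBil (B y) := by
  unfold traceBil
  exact continuous_finsetSum _ fun a _ => (hB.clm_apply continuous_const).clm_apply
    continuous_const

lemma hasDerivAt_duhamelD (hd : ∀ s y, HasFDerivAt (G s) (G' s y) y)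
    (hd' : ∀ s y, HasFDerivAt (G' s) (G'' s y) y)
    (hG : Continuous (Function.uncurry G)) (hG' : Continuous (Function.uncurry G'))
    (hG'' : Continuous (Function.uncurry G'')) (t : ℝ) (x : E3) :
    HasDerivAt (fun t => duhamelD G G' t x)
      (G t x + duhamel (fun s y => traceBil (G'' s y)) t x) t := by
  have := hasDerivAt_integral_upper (k := fun t s => kirD (G s) (G' s) (t - s) x)
    (k' := fun t s => kir (fun y => traceBil (G'' s y)) (t - s) x) (continuous_kirD_sub hG hG' x)
    (continuous_kir_sub (G := fun s y => traceBil (G'' s y)) (continuous_traceBil hG'') x)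
    (fun t s => (hasDerivAt_kirD (hd s) (hd' s) (continuous_slice hG'' s)
      (t - s) x).comp_sub_const t s) t
  refine this.congr_deriv ?_
  -- Here the boundary term is the initial velocity of Kirchhoff's solution; this is how the source
  -- enters the equation.
  simp [kirD_zero, duhamel]

lemma hasFDerivAt_duhamelD (hd : ∀ s y, HasFDerivAt (G s) (G' s y) y)
    (hd' : ∀ s y, HasFDerivAt (G' s) (G'' s y) y)
    (hG : Continuous (Function.uncurry G)) (hG' : Continuous (Function.uncurry G'))
    (hG'' : Continuous (Function.uncurry G'')) (t : ℝ) (x : E3) :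
    HasFDerivAt (duhamelD G G' t) (duhamelD G' G'' t x) x := by
  refine hasFDerivAt_intervalIntegral (f := fun x s => kirD (G s) (G' s) (t - s) x)
    (f' := fun x s => kirD (G' s) (G'' s) (t - s) x) ?_ ?_
    (fun x s => hasFDerivAt_kirD (hd s) (hd' s) (continuous_slice hG'' s) (t - s) x) 0 t x
  · exact continuous_kirD_param (Z := E3 × ℝ) (G := fun p => G p.2) (G' := fun p => G' p.2)
      (hG.comp (f := fun p : (E3 × ℝ) × E3 => (p.1.2, p.2)) (by fun_prop))
      (hG'.comp (f := fun p : (E3 × ℝ) × E3 => (p.1.2, p.2)) (by fun_prop))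
      (τ := fun p => t - p.2) (by fun_prop) (ξ := fun p => p.1) (by fun_prop)
  · exact continuous_kirD_param (Z := E3 × ℝ) (G := fun p => G' p.2) (G' := fun p => G'' p.2)
      (hG'.comp (f := fun p : (E3 × ℝ) × E3 => (p.1.2, p.2)) (by fun_prop))
      (hG''.comp (f := fun p : (E3 × ℝ) × E3 => (p.1.2, p.2)) (by fun_prop))
      (τ := fun p => t - p.2) (by fun_prop) (ξ := fun p => p.1) (by fun_prop)

/-- The Duhamel integral of a source with two continuous spatial derivatives is of class `C²`. -/
lemma contDiff_duhamel (hd : ∀ s y, HasFDerivAt (G s) (G' s y) y)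
    (hd' : ∀ s y, HasFDerivAt (G' s) (G'' s y) y)
    (hG : Continuous (Function.uncurry G)) (hG' : Continuous (Function.uncurry G'))
    (hG'' : Continuous (Function.uncurry G'')) :
    ContDiff ℝ 2 fun z : ℝ × E3 => duhamel G z.1 z.2 := by
  refine contDiff_two_of_partials (hasDerivAt_duhamel hd hG hG') (hasFDerivAt_duhamel hd hG hG')
    ?_ ?_
  · refine contDiff_one_of_partials (hasDerivAt_duhamelD hd hd' hG hG' hG'')
      (hasFDerivAt_duhamelD hd hd' hG hG' hG'') ?_ (continuous_duhamelD hG' hG'')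
    exact hG.add (continuous_duhamel (continuous_traceBil hG''))
  · exact contDiff_one_of_partials (hasDerivAt_duhamel hd' hG' hG'')
      (hasFDerivAt_duhamel hd' hG' hG'') (continuous_duhamelD hG' hG'') (continuous_duhamel hG'')

lemma duhamel_clm {U : Type*} [NormedAddCommGroup U] [NormedSpace ℝ U] [CompleteSpace U]
    (T : V →L[ℝ] U) (hG : Continuous (Function.uncurry G)) (t : ℝ) (x : E3) :
    T (duhamel G t x) = duhamel (fun s y => T (G s y)) t x := by
  have hc : Continuous fun s => kir (G s) (t - s) x :=
    continuous_slice (continuous_kir_sub hG x) t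
  rw [duhamel, ← T.intervalIntegral_comp_comm (hc.intervalIntegrable _ _), duhamel]
  congr 1; ext s
  exact kir_clm T (continuous_slice hG s) _ _

lemma traceBil_duhamel (hG'' : Continuous (Function.uncurry G'')) (t : ℝ) (x : E3) :
    traceBil (duhamel G'' t x) = duhamel (fun s y => traceBil (G'' s y)) t x := by
  let T : (E3 →L[ℝ] E3 →L[ℝ] V) →L[ℝ] V := ∑ a : Fin 3,
    (ContinuousLinearMap.apply ℝ V (basisVec a)).comp
      (ContinuousLinearMap.apply ℝ (E3 →L[ℝ] V) (basisVec a))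
  have hT : ∀ B, T B = traceBil B := fun B => by simp [T, traceBil]
  simp only [← hT]
  exact duhamel_clm (V := E3 →L[ℝ] E3 →L[ℝ] V) T hG'' t x

end Duhamel

/-! ### The wave equation for the Duhamel integral. -/

section Laplacian

lemma laplacian_eq_traceBil {f : E3 → ℝ} {f' : E3 → E3 →L[ℝ] ℝ} {f'' : E3 → E3 →L[ℝ] E3 →L[ℝ] ℝ}
    (h : ∀ y, HasFDerivAt f (f' y) y) (h' : ∀ y, HasFDerivAt f' (f'' y) y) (x : E3) :
    Laplacian.laplacian f x = traceBil (f'' x) := by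
  have e1 : fderiv ℝ f = f' := funext fun y => (h y).fderiv
  rw [InnerProductSpace.laplacian_eq_iteratedFDeriv_orthonormalBasis f
    (EuclideanSpace.basisFun (Fin 3) ℝ)]
  simp [iteratedFDeriv_two_apply, e1, (h' x).fderiv, traceBil]

/-- Two time derivatives give `G` plus the Duhamel integral of `ΔG`, and the second summand is the
Laplacian of the Duhamel integral, since spatial derivatives and the trace pass inside. -/
lemma negBox_duhamel {G : ℝ → E3 → ℝ} {G' : ℝ → E3 → E3 →L[ℝ] ℝ}
    {G'' : ℝ → E3 → E3 →L[ℝ] E3 →L[ℝ] ℝ} (hd : ∀ s y, HasFDerivAt (G s) (G' s y) y)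
    (hd' : ∀ s y, HasFDerivAt (G' s) (G'' s y) y)
    (hG : Continuous (Function.uncurry G)) (hG' : Continuous (Function.uncurry G'))
    (hG'' : Continuous (Function.uncurry G'')) (t : ℝ) (x : E3) :
    negBox (duhamel G) t x = G t x := by
  have e1 : (deriv fun s => duhamel G s x) = fun s => duhamelD G G' s x :=
    funext fun s => (hasDerivAt_duhamel hd hG hG' s x).deriv
  rw [negBox, e1, (hasDerivAt_duhamelD hd hd' hG hG' hG'' t x).deriv,
    laplacian_eq_traceBil (hasFDerivAt_duhamel hd hG hG' t) (hasFDerivAt_duhamel hd' hG' hG'' t),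
    traceBil_duhamel hG'']
  ring

end Laplacian

/-! ### Free waves with general Cauchy data. -/

section FreeWave

variable {V : Type*} [NormedAddCommGroup V] [NormedSpace ℝ V] [CompleteSpace V]

/-- The free wave with data `(u, v)` at time `0`, where `u'` is the derivative of `u`. -/
def freeWave {V : Type*} [NormedAddCommGroup V] [NormedSpace ℝ V] (u : E3 → V)
    (u' : E3 → E3 →L[ℝ] V) (v : E3 → V) (t : ℝ) (x : E3) : V := kirD u u' t x + kir v t x

/-- The trace of a bilinear form as a continuous linear map. -/
def traceCLM (V : Type*) [NormedAddCommGroup V] [NormedSpace ℝ V] :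
    (E3 →L[ℝ] E3 →L[ℝ] V) →L[ℝ] V := ∑ a : Fin 3,
  (ContinuousLinearMap.apply ℝ V (basisVec a)).comp
    (ContinuousLinearMap.apply ℝ (E3 →L[ℝ] V) (basisVec a))

lemma traceCLM_apply (B : E3 →L[ℝ] E3 →L[ℝ] V) : traceCLM V B = traceBil B := by
  simp [traceCLM, traceBil]

variable {u : E3 → V} {u' : E3 → E3 →L[ℝ] V} {u'' : E3 → E3 →L[ℝ] E3 →L[ℝ] V}
  {u''' : E3 → E3 →L[ℝ] E3 →L[ℝ] E3 →L[ℝ] V}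
  {v : E3 → V} {v' : E3 → E3 →L[ℝ] V} {v'' : E3 → E3 →L[ℝ] E3 →L[ℝ] V}

lemma freeWave_zero (u : E3 → V) (u' : E3 → E3 →L[ℝ] V) (v : E3 → V) (x : E3) :
    freeWave u u' v 0 x = u x := by
  simp [freeWave, kirD_zero, kir_zero]

lemma continuous_freeWave (hu : Continuous u) (hu' : Continuous u') (hv : Continuous v) :
    Continuous (Function.uncurry (freeWave u u' v)) := by
  refine Continuous.add ?_ ?_
  · exact continuous_kirD_param (Z := ℝ × E3) (G := fun _ => u) (G' := fun _ => u')
      (hu.comp continuous_snd) (hu'.comp continuous_snd) continuous_fst continuous_snd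
  · exact continuous_kir_param (Z := ℝ × E3) (G := fun _ => v)
      (hv.comp continuous_snd) continuous_fst continuous_snd

lemma hasFDerivAt_freeWave (hu : ∀ y, HasFDerivAt u (u' y) y) (hu2 : ∀ y, HasFDerivAt u' (u'' y) y)
    (hu'' : Continuous u'') (hv : ∀ y, HasFDerivAt v (v' y) y) (hv' : Continuous v')
    (t : ℝ) (x : E3) : HasFDerivAt (freeWave u u' v t) (freeWave u' u'' v' t x) x :=
  (hasFDerivAt_kirD hu hu2 hu'' t x).add (hasFDerivAt_kir hv hv' t x)

/-- Differentiating in time replaces the data `(u, v)` by `(v, Δu)`. The class of free waves is thus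
closed under all first derivatives, and the wave equation and the regularity follow by applying the
first-order statements twice. -/
lemma hasDerivAt_freeWave (hu : ∀ y, HasFDerivAt u (u' y) y) (hu2 : ∀ y, HasFDerivAt u' (u'' y) y)
    (hu'' : Continuous u'') (hv : ∀ y, HasFDerivAt v (v' y) y) (hv' : Continuous v')
    (t : ℝ) (x : E3) : HasDerivAt (fun t => freeWave u u' v t x)
      (freeWave v v' (fun y => traceBil (u'' y)) t x) t :=
  ((hasDerivAt_kirD hu hu2 hu'' t x).add (hasDerivAt_kir hv hv' t x)).congr_deriv
    (add_comm _ _)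

lemma contDiff_one_freeWave (hu : ∀ y, HasFDerivAt u (u' y) y)
    (hu2 : ∀ y, HasFDerivAt u' (u'' y) y)
    (hu'' : Continuous u'') (hv : ∀ y, HasFDerivAt v (v' y) y) (hv' : Continuous v') :
    ContDiff ℝ 1 fun z : ℝ × E3 => freeWave u u' v z.1 z.2 :=
  contDiff_one_of_partials (hasDerivAt_freeWave hu hu2 hu'' hv hv')
    (hasFDerivAt_freeWave hu hu2 hu'' hv hv')
    (continuous_freeWave (continuous_of_hasFDerivAt hv) hv' (continuous_traceBil hu''))
    (continuous_freeWave (continuous_of_hasFDerivAt hu2) hu'' hv')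

lemma hasFDerivAt_traceBil (hu3 : ∀ y, HasFDerivAt u'' (u''' y) y) (y : E3) :
    HasFDerivAt (fun y => traceBil (u'' y)) ((traceCLM V).comp (u''' y)) y := by
  simp only [← traceCLM_apply]
  exact (traceCLM V).hasFDerivAt.comp y (hu3 y)

lemma contDiff_two_freeWave (hu : ∀ y, HasFDerivAt u (u' y) y)
    (hu2 : ∀ y, HasFDerivAt u' (u'' y) y) (hu3 : ∀ y, HasFDerivAt u'' (u''' y) y)
    (hu''' : Continuous u''') (hv : ∀ y, HasFDerivAt v (v' y) y)
    (hv2 : ∀ y, HasFDerivAt v' (v'' y) y) (hv'' : Continuous v'') :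
    ContDiff ℝ 2 fun z : ℝ × E3 => freeWave u u' v z.1 z.2 := by
  have hu'' := continuous_of_hasFDerivAt hu3
  have hv' := continuous_of_hasFDerivAt hv2
  refine contDiff_two_of_partials (hasDerivAt_freeWave hu hu2 hu'' hv hv')
    (hasFDerivAt_freeWave hu hu2 hu'' hv hv') ?_ ?_
  · exact contDiff_one_freeWave hv hv2 hv'' (hasFDerivAt_traceBil hu3)
      (continuous_const.clm_comp hu''')
  · exact contDiff_one_freeWave hu2 hu3 hu''' hv2 hv''

lemma freeWave_clm {U : Type*} [NormedAddCommGroup U] [NormedSpace ℝ U] [CompleteSpace U]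
    (T : V →L[ℝ] U) (hu : Continuous u) (hu' : Continuous u') (hv : Continuous v)
    (t : ℝ) (x : E3) : T (freeWave u u' v t x) =
      freeWave (fun y => T (u y)) (fun y => T.comp (u' y)) (fun y => T (v y)) t x := by
  rw [freeWave, map_add, kirD_clm T hu hu', kir_clm T hv, freeWave]

lemma negBox_freeWave {u : E3 → ℝ} {u' : E3 → E3 →L[ℝ] ℝ} {u'' : E3 → E3 →L[ℝ] E3 →L[ℝ] ℝ}
    {u''' : E3 → E3 →L[ℝ] E3 →L[ℝ] E3 →L[ℝ] ℝ}
    {v : E3 → ℝ} {v' : E3 → E3 →L[ℝ] ℝ} {v'' : E3 → E3 →L[ℝ] E3 →L[ℝ] ℝ}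
    (hu : ∀ y, HasFDerivAt u (u' y) y)
    (hu2 : ∀ y, HasFDerivAt u' (u'' y) y) (hu3 : ∀ y, HasFDerivAt u'' (u''' y) y)
    (hu''' : Continuous u''') (hv : ∀ y, HasFDerivAt v (v' y) y)
    (hv2 : ∀ y, HasFDerivAt v' (v'' y) y) (hv'' : Continuous v'') (t : ℝ) (x : E3) :
    negBox (freeWave u u' v) t x = 0 := by
  have hu'' := continuous_of_hasFDerivAt hu3
  have hv' := continuous_of_hasFDerivAt hv2
  have e1 : (deriv fun s => freeWave u u' v s x) =
      fun s => freeWave v v' (fun y => traceBil (u'' y)) s x :=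
    funext fun s => (hasDerivAt_freeWave hu hu2 hu'' hv hv' s x).deriv
  rw [negBox, e1, (hasDerivAt_freeWave hv hv2 hv'' (hasFDerivAt_traceBil hu3)
    (continuous_const.clm_comp hu''') t x).deriv,
    laplacian_eq_traceBil (hasFDerivAt_freeWave hu hu2 hu'' hv hv' t)
      (hasFDerivAt_freeWave hu2 hu3 hu''' hv2 hv'' t), ← traceCLM_apply,
    freeWave_clm (V := E3 →L[ℝ] E3 →L[ℝ] ℝ) (traceCLM ℝ) hu'' hu''' hv'']
  simp only [traceCLM_apply, sub_self]

end FreeWave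

/-! ### Superharmonic functions bound spherical means and Duhamel integrals. -/

section Superharmonic

variable {w : E3 → ℝ} {w' : E3 → E3 →L[ℝ] ℝ} {w'' : E3 → E3 →L[ℝ] E3 →L[ℝ] ℝ}

lemma sphMean_mono {f g : E3 → ℝ} (hf : Continuous f) (hg : Continuous g) (h : ∀ y, f y ≤ g y)
    (t : ℝ) (x : E3) : sphMean f t x ≤ sphMean g t x :=
  integral_mono (integrable_sph (by fun_prop)) (integrable_sph (by fun_prop)) fun θ => h _

lemma sphMean_nonneg {f : E3 → ℝ} (h : ∀ y, 0 ≤ f y) (t : ℝ) (x : E3) : 0 ≤ sphMean f t x :=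
  integral_nonneg fun _ => h _

lemma sphMean_nonpos {f : E3 → ℝ} (h : ∀ y, f y ≤ 0) (t : ℝ) (x : E3) : sphMean f t x ≤ 0 :=
  integral_nonpos fun _ => h _

/-- By the Darboux equation the time derivative is `t M_t Δw`, which is nonpositive for `t ≥ 0`. -/
lemma antitoneOn_kirD (hw : ∀ y, HasFDerivAt w (w' y) y) (hw2 : ∀ y, HasFDerivAt w' (w'' y) y)
    (hw'' : Continuous w'') (hneg : ∀ y, traceBil (w'' y) ≤ 0) (x : E3) :
    AntitoneOn (fun t => kirD w w' t x) (Ici 0) := by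
  have hd := fun t => hasDerivAt_kirD hw hw2 hw'' t x
  refine antitoneOn_of_deriv_nonpos (convex_Ici 0)
    (fun t _ => (hd t).continuousAt.continuousWithinAt)
    (fun t _ => (hd t).differentiableAt.differentiableWithinAt) fun t ht => ?_
  rw [(hd t).deriv, kir, smul_eq_mul]
  rw [interior_Ici, mem_Ioi] at ht
  exact mul_nonpos_of_nonneg_of_nonpos ht.le (sphMean_nonpos hneg t x)

/-- The spherical means of a superharmonic function do not exceed its value at the centre. -/
lemma sphMean_le_of_superharmonic (hw : ∀ y, HasFDerivAt w (w' y) y)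
    (hw2 : ∀ y, HasFDerivAt w' (w'' y) y)
    (hw'' : Continuous w'') (hneg : ∀ y, traceBil (w'' y) ≤ 0) {t : ℝ} (ht : 0 ≤ t) (x : E3) :
    sphMean w t x ≤ w x := by
  rcases ht.eq_or_lt with rfl | ht
  · rw [sphMean_zero]
  have hanti := antitoneOn_kirD hw hw2 hw'' hneg x
  have hd := fun t => ((hasDerivAt_kir hw (continuous_of_hasFDerivAt hw2) t x).sub
    ((hasDerivAt_id t).mul_const (w x)))
  -- The derivative of `t M_t w - t w(x)` is `kirD` at time `t` minus its value at time `0`, so it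
  -- has a sign.
  have h := antitoneOn_of_deriv_nonpos (f := (fun t => kir w t x) - fun t => id t * w x)
    (convex_Ici (0 : ℝ)) (fun t _ => (hd t).continuousAt.continuousWithinAt)
    (fun t _ => (hd t).differentiableAt.differentiableWithinAt) (fun s hs => by
      rw [(hd s).deriv]
      rw [interior_Ici, mem_Ioi] at hs
      have := hanti (mem_Ici.2 le_rfl) (mem_Ici.2 hs.le) hs.le
      simp only [kirD_zero] at this
      linarith) (mem_Ici.2 le_rfl) (mem_Ici.2 ht.le) ht.le
  simp only [Pi.sub_apply, kir, smul_eq_mul, id, zero_mul, sub_zero] at h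
  have : t * sphMean w t x ≤ t * w x := by linarith
  exact le_of_mul_le_mul_left this ht

/-- A negative value `c` at time `t` would persist by monotonicity, so `s M_s w` would decrease at
least linearly and become negative, contradicting `w ≥ 0`. -/
lemma kirD_nonneg_of_superharmonic (hw : ∀ y, HasFDerivAt w (w' y) y)
    (hw2 : ∀ y, HasFDerivAt w' (w'' y) y) (hw'' : Continuous w'')
    (hneg : ∀ y, traceBil (w'' y) ≤ 0) (hpos : ∀ y, 0 ≤ w y) {t : ℝ} (ht : 0 ≤ t) (x : E3) :
    0 ≤ kirD w w' t x := by
  by_contra! hlt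
  have hanti := antitoneOn_kirD hw hw2 hw'' hneg x
  set c := kirD w w' t x with hc
  have hd := fun s => ((hasDerivAt_kir hw (continuous_of_hasFDerivAt hw2) s x).sub
    ((hasDerivAt_id s).mul_const c))
  have h := antitoneOn_of_deriv_nonpos (f := (fun s => kir w s x) - fun s => id s * c)
    (convex_Ici t) (fun s _ => (hd s).continuousAt.continuousWithinAt)
    (fun s _ => (hd s).differentiableAt.differentiableWithinAt) (fun s hs => by
      rw [(hd s).deriv]
      rw [interior_Ici, mem_Ioi] at hs
      have := hanti (mem_Ici.2 ht) (mem_Ici.2 (ht.trans hs.le)) hs.le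
      simp only [← hc] at this
      linarith)
  -- At this time the linear bound with slope `c` has come down to `-1`.
  obtain ⟨T, hTdef⟩ : ∃ T, T = t + (kir w t x + 1) / (-c) := ⟨_, rfl⟩
  have hk : 0 ≤ kir w t x := mul_nonneg ht (sphMean_nonneg hpos t x)
  have hT : t ≤ T := by
    have : 0 ≤ (kir w t x + 1) / (-c) := div_nonneg (by linarith) (by linarith)
    linarith
  have h2 := h (mem_Ici.2 le_rfl) (mem_Ici.2 hT) hT
  have h3 : 0 ≤ kir w T x := mul_nonneg (ht.trans hT) (sphMean_nonneg hpos T x)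
  simp only [Pi.sub_apply, id] at h2
  have h4 : (T - t) * c = -(kir w t x + 1) := by
    rw [hTdef, add_sub_cancel_left, div_neg, neg_mul, div_mul_cancel₀ _ hlt.ne]
  nlinarith

/-- The Newtonian bound: `∫₀ᵗ s M_s(-Δw) ds ≤ w` for positive superharmonic `w`. -/
lemma integral_kir_le_of_superharmonic (hw : ∀ y, HasFDerivAt w (w' y) y)
    (hw2 : ∀ y, HasFDerivAt w' (w'' y) y) (hw'' : Continuous w'')
    (hneg : ∀ y, traceBil (w'' y) ≤ 0) (hpos : ∀ y, 0 ≤ w y) {t : ℝ} (ht : 0 ≤ t) (x : E3) :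
    ∫ s in (0 : ℝ)..t, kir (fun y => -traceBil (w'' y)) s x ≤ w x := by
  have hc : Continuous fun s => kir (fun y => traceBil (w'' y)) s x :=
    continuous_kir_param (Z := ℝ) (G := fun _ y => traceBil (w'' y))
      ((continuous_traceBil hw'').comp continuous_snd) continuous_id continuous_const
  -- The integral of `s M_s(-Δw)` telescopes to `w(x)` minus the value of `kirD` at `t`, and the
  -- latter is nonnegative.
  have h := intervalIntegral.integral_eq_sub_of_hasDerivAt (a := 0) (b := t)
    (fun s _ => hasDerivAt_kirD hw hw2 hw'' s x) (hc.intervalIntegrable _ _)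
  have e : ∀ s, kir (fun y => -traceBil (w'' y)) s x = -kir (fun y => traceBil (w'' y)) s x := by
    intro s
    simp [kir, sphMean, integral_neg]
  simp only [e, intervalIntegral.integral_neg, h, kirD_zero]
  linarith [kirD_nonneg_of_superharmonic hw hw2 hw'' hneg hpos ht x]

lemma norm_sphMean_le {V : Type*} [NormedAddCommGroup V] [NormedSpace ℝ V] {g : E3 → V}
    {f : E3 → ℝ} (hf : Continuous f) (h : ∀ y, ‖g y‖ ≤ f y) (t : ℝ) (x : E3) :
    ‖sphMean g t x‖ ≤ sphMean f t x :=
  norm_integral_le_of_norm_le (integrable_sph (by fun_prop)) (Eventually.of_forall fun θ => h _)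

/-- The majorant of the source does not depend on time, so the substitution `s ↦ t - s` turns the
Duhamel integral into the truncated Newtonian potential of `-Δw`. -/
lemma norm_duhamel_le_of_superharmonic {V : Type*} [NormedAddCommGroup V] [NormedSpace ℝ V]
    (hw : ∀ y, HasFDerivAt w (w' y) y)
    (hw2 : ∀ y, HasFDerivAt w' (w'' y) y) (hw'' : Continuous w'')
    (hneg : ∀ y, traceBil (w'' y) ≤ 0) (hpos : ∀ y, 0 ≤ w y) {G : ℝ → E3 → V} {A : ℝ}
    (hA : 0 ≤ A) (hG : ∀ s y, ‖G s y‖ ≤ A * -traceBil (w'' y)) {t : ℝ} (ht : 0 ≤ t) (x : E3) :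
    ‖duhamel G t x‖ ≤ A * w x := by
  have hcont : Continuous fun y => -traceBil (w'' y) := (continuous_traceBil hw'').neg
  have hc : Continuous fun s => kir (fun y => -traceBil (w'' y)) (t - s) x :=
    continuous_kir_param (Z := ℝ) (G := fun _ y => -traceBil (w'' y))
      (hcont.comp continuous_snd) (by fun_prop) continuous_const
  have hb : ∀ s ∈ Ioc 0 t, ‖kir (G s) (t - s) x‖ ≤
      A * kir (fun y => -traceBil (w'' y)) (t - s) x := by
    intro s hs
    have hts : 0 ≤ t - s := by linarith [hs.2]
    rw [kir, norm_smul, Real.norm_of_nonneg hts, kir, smul_eq_mul, ← mul_assoc, mul_comm A,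
      mul_assoc]
    refine mul_le_mul_of_nonneg_left ?_ hts
    refine (norm_sphMean_le (f := fun y => A * -traceBil (w'' y)) (by fun_prop) (hG s)
      _ _).trans_eq ?_
    simp only [sphMean]
    rw [integral_const_mul]
  refine (intervalIntegral.norm_integral_le_of_norm_le ht (Eventually.of_forall hb)
    ((hc.const_mul A).intervalIntegrable _ _)).trans ?_
  rw [intervalIntegral.integral_const_mul,
    intervalIntegral.integral_comp_sub_left (fun s => kir (fun y => -traceBil (w'' y)) s x) t]
  simp only [sub_self, sub_zero]
  exact mul_le_mul_of_nonneg_left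
    (integral_kir_le_of_superharmonic hw hw2 hw'' hneg hpos ht x) hA

end Superharmonic

/-! ### The weights `(1 + ε²|x|²)^{-b}` and their Laplacians. -/

section Weights

/-- The Euclidean inner product as a bilinear form. -/
def ipL : E3 →L[ℝ] E3 →L[ℝ] ℝ :=
  ∑ a : Fin 3, (EuclideanSpace.proj a : E3 →L[ℝ] ℝ).smulRight (EuclideanSpace.proj a : E3 →L[ℝ] ℝ)

lemma ipL_apply (x y : E3) : ipL x y = ∑ a, x a * y a := by simp [ipL]

lemma hasFDerivAt_norm_sq_ipL (x : E3) :
    HasFDerivAt (fun y : E3 => ‖y‖ ^ 2) ((2 : ℝ) • ipL x) x := by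
  refine (hasStrictFDerivAt_norm_sq x).hasFDerivAt.congr_fderiv ?_
  ext y
  simp [ipL_apply, PiLp.inner_apply, mul_comm]

/-- The weight `(1 + ε²|x|²)^{-b}`. -/
def wt (b ε : ℝ) (x : E3) : ℝ := (1 + ε ^ 2 * ‖x‖ ^ 2) ^ (-b)

/-- The derivative of `wt b ε`. -/
def wt' (b ε : ℝ) (x : E3) : E3 →L[ℝ] ℝ := (-2 * b * ε ^ 2 * wt (b + 1) ε x) • ipL x

/-- The second derivative of `wt b ε`. -/
def wt'' (b ε : ℝ) (x : E3) : E3 →L[ℝ] E3 →L[ℝ] ℝ :=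
  (-2 * b * ε ^ 2 * wt (b + 1) ε x) • ipL
    + ((-2 * b * ε ^ 2) • wt' (b + 1) ε x).smulRight (ipL x)

lemma one_le_base (ε : ℝ) (x : E3) : 1 ≤ 1 + ε ^ 2 * ‖x‖ ^ 2 := by
  have : 0 ≤ ε ^ 2 * ‖x‖ ^ 2 := by positivity
  linarith

lemma wt_pos (b ε : ℝ) (x : E3) : 0 < wt b ε x := Real.rpow_pos_of_pos (by positivity) _

lemma hasFDerivAt_wt (b ε : ℝ) (x : E3) : HasFDerivAt (wt b ε) (wt' b ε x) x := by
  have h1 : HasFDerivAt (fun y : E3 => 1 + ε ^ 2 * ‖y‖ ^ 2) (ε ^ 2 • (2 : ℝ) • ipL x) x :=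
    ((hasFDerivAt_norm_sq_ipL x).const_mul (ε ^ 2)).const_add 1
  have h2 := h1.rpow_const (p := -b) (Or.inl (by positivity))
  refine h2.congr_fderiv ?_
  rw [wt', smul_smul, smul_smul, wt, show -b - 1 = -(b + 1) by ring]
  congr 1
  ring

lemma hasFDerivAt_wt' (b ε : ℝ) (x : E3) : HasFDerivAt (wt' b ε) (wt'' b ε x) x :=
  ((hasFDerivAt_wt (b + 1) ε x).const_mul (-2 * b * ε ^ 2)).smul ipL.hasFDerivAt

lemma continuous_wt (b ε : ℝ) : Continuous (wt b ε) := continuous_of_hasFDerivAt (hasFDerivAt_wt b ε)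

lemma continuous_wt' (b ε : ℝ) : Continuous (wt' b ε) :=
  continuous_of_hasFDerivAt (hasFDerivAt_wt' b ε)

lemma continuous_wt'' (b ε : ℝ) : Continuous (wt'' b ε) := by
  have h1 := continuous_wt (b + 1) ε
  have h2 := continuous_wt' (b + 1) ε
  unfold wt''
  refine Continuous.add (by fun_prop) ?_
  have h3 : Continuous fun x => (-2 * b * ε ^ 2) • wt' (b + 1) ε x := h2.fun_const_smul _
  exact (ContinuousLinearMap.smulRightL ℝ E3 (E3 →L[ℝ] ℝ)).continuous₂.comp
    (h3.prodMk ipL.continuous)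

lemma wt_add (b c ε : ℝ) (x : E3) : wt (b + c) ε x = wt b ε x * wt c ε x := by
  rw [wt, neg_add, Real.rpow_add (by positivity), wt, wt]

lemma wt_neg_one (ε : ℝ) (x : E3) : wt (-1) ε x = 1 + ε ^ 2 * ‖x‖ ^ 2 := by
  rw [wt, neg_neg, Real.rpow_one]

/-- The coefficient `1 - 2b` shows why `b = 1/2` is the largest exponent at which the weight is
superharmonic on all of space. -/
lemma traceBil_wt'' (b ε : ℝ) (x : E3) :
    traceBil (wt'' b ε x) =
      -(2 * b * ε ^ 2 * wt (b + 2) ε x * (3 + (1 - 2 * b) * (ε ^ 2 * ‖x‖ ^ 2))) := by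
  have h1 : wt (b + 1) ε x = wt (b + 2) ε x * (1 + ε ^ 2 * ‖x‖ ^ 2) := by
    rw [← wt_neg_one, ← wt_add]; ring_nf
  have hn : ‖x‖ ^ 2 = x 0 ^ 2 + x 1 ^ 2 + x 2 ^ 2 := by
    rw [EuclideanSpace.real_norm_sq_eq, Fin.sum_univ_three]
  have h2 : traceBil (wt'' b ε x) = 3 * (-2 * b * ε ^ 2 * wt (b + 1) ε x)
      + (-2 * b * ε ^ 2) * (-2 * (b + 1) * ε ^ 2 * wt (b + 1 + 1) ε x) * ‖x‖ ^ 2 := by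
    rw [hn]
    simp [traceBil, wt'', wt', ipL_apply, Fin.sum_univ_three]
    ring
  rw [h2, h1, show b + 1 + 1 = b + 2 by ring]
  ring

lemma traceBil_wt''_nonpos {b : ℝ} (hb : 0 ≤ b) (hb' : b ≤ 1 / 2) (ε : ℝ) (x : E3) :
    traceBil (wt'' b ε x) ≤ 0 := by
  rw [traceBil_wt'', neg_nonpos]
  have := (wt_pos (b + 2) ε x).le
  have h2 : 0 ≤ (1 - 2 * b) * (ε ^ 2 * ‖x‖ ^ 2) := mul_nonneg (by linarith) (by positivity)
  positivity

/-- For `b = 1/4` the last factor is `3 + (1/2) ε²|x|²`, which exceeds half of `1 + ε²|x|²`; that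
restores one power of the base. The exponent `5/4` is the fifth power of the weight with exponent
`1/4`, matching the critical power `p = 5`. -/
lemma wt_five_le (ε : ℝ) (x : E3) :
    ε ^ 2 / 4 * wt (5 / 4) ε x ≤ -traceBil (wt'' (1 / 4) ε x) := by
  rw [traceBil_wt'', neg_neg]
  have h1 : wt (5 / 4) ε x = wt (1 / 4 + 2) ε x * (1 + ε ^ 2 * ‖x‖ ^ 2) := by
    rw [← wt_neg_one, ← wt_add]; norm_num
  have h2 := (wt_pos (1 / 4 + 2) ε x).le
  rw [h1]
  have h3 : 0 ≤ ε ^ 2 * wt (1 / 4 + 2) ε x := by positivity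
  have h4 : 0 ≤ ε ^ 2 * ‖x‖ ^ 2 := by positivity
  nlinarith

lemma sphMean_wt_le {b : ℝ} (hb : 0 ≤ b) (hb' : b ≤ 1 / 2) (ε : ℝ) {t : ℝ} (ht : 0 ≤ t) (x : E3) :
    sphMean (wt b ε) t x ≤ wt b ε x :=
  sphMean_le_of_superharmonic (hasFDerivAt_wt b ε) (hasFDerivAt_wt' b ε) (continuous_wt'' b ε)
    (traceBil_wt''_nonpos hb hb' ε) ht x

/-- The Duhamel integral of a source dominated by `(1 + ε²|x|²)^{-5/4}` is dominated by
`(1 + ε²|x|²)^{-1/4}`, uniformly in time. -/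
lemma norm_duhamel_le {V : Type*} [NormedAddCommGroup V] [NormedSpace ℝ V] {ε : ℝ} (hε : 0 < ε)
    {G : ℝ → E3 → V} {A : ℝ} (hA : 0 ≤ A) (hG : ∀ s y, ‖G s y‖ ≤ A * wt (5 / 4) ε y)
    {t : ℝ} (ht : 0 ≤ t) (x : E3) : ‖duhamel G t x‖ ≤ A * 4 / ε ^ 2 * wt (1 / 4) ε x := by
  refine norm_duhamel_le_of_superharmonic (hasFDerivAt_wt _ ε) (hasFDerivAt_wt' _ ε)
    (continuous_wt'' _ ε) (traceBil_wt''_nonpos (by norm_num) (by norm_num) ε)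
    (fun y => (wt_pos _ ε y).le) (by positivity) (fun s y => (hG s y).trans ?_) ht x
  calc A * wt (5 / 4) ε y = A * 4 / ε ^ 2 * (ε ^ 2 / 4 * wt (5 / 4) ε y) := by field_simp
    _ ≤ _ := mul_le_mul_of_nonneg_left (wt_five_le ε y) (by positivity)

end Weights

/-! ### Integrals over space as radial integrals of spherical means. -/

section Radial

lemma sphArea_toReal_pos : 0 < sphArea.toReal :=
  ENNReal.toReal_pos sphArea_ne_zero sphArea_ne_top

lemma continuous_sphMean_radius {V : Type*} [NormedAddCommGroup V] [NormedSpace ℝ V] {f : E3 → V}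
    (hf : Continuous f) (x : E3) : Continuous fun ρ => sphMean f ρ x :=
  continuous_sphMean_param (Z := ℝ) (G := fun _ => f) (hf.comp continuous_snd) continuous_id
    continuous_const

lemma lintegral_radial {f : E3 → ℝ} (hf : Continuous f) (h0 : ∀ y, 0 ≤ f y) (x : E3) :
    ∫⁻ y, ENNReal.ofReal (f y) =
      sphArea * ∫⁻ ρ in Ioi (0 : ℝ), ENNReal.ofReal (ρ ^ 2 * sphMean f ρ x) := by
  rw [lintegral_polar (hf.measurable.ennreal_ofReal) x]
  congr 1
  refine lintegral_congr fun ρ => ?_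
  rw [ENNReal.ofReal_mul (sq_nonneg _), sphMean,
    ofReal_integral_eq_lintegral_ofReal (integrable_sph (by fun_prop))
      (Eventually.of_forall fun θ => h0 _)]

lemma integrableOn_radial {f : E3 → ℝ} (hf : Continuous f) (h0 : ∀ y, 0 ≤ f y)
    (hi : Integrable f) (x : E3) : IntegrableOn (fun ρ => ρ ^ 2 * sphMean f ρ x) (Ioi 0) := by
  have hc := continuous_sphMean_radius hf x
  refine ⟨(by fun_prop : Continuous fun ρ : ℝ => ρ ^ 2 * sphMean f ρ x).aestronglyMeasurable, ?_⟩
  rw [hasFiniteIntegral_iff_ofReal (Eventually.of_forall fun ρ =>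
    mul_nonneg (sq_nonneg _) (sphMean_nonneg h0 _ _))]
  have h1 := (hasFiniteIntegral_iff_ofReal (Eventually.of_forall h0)).1 hi.2
  rw [lintegral_radial hf h0 x] at h1
  exact ENNReal.lt_top_of_mul_ne_top_right h1.ne sphArea_ne_zero

lemma integral_radial_le {f : E3 → ℝ} (hf : Continuous f) (h0 : ∀ y, 0 ≤ f y)
    (hi : Integrable f) (x : E3) {R : ℝ} (hR : 0 ≤ R) :
    ∫ ρ in (0 : ℝ)..R, ρ ^ 2 * sphMean f ρ x ≤ sphArea.toReal⁻¹ * ∫ y, f y := by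
  have hI := integrableOn_radial hf h0 hi x
  have hnn : ∀ ρ : ℝ, 0 ≤ ρ ^ 2 * sphMean f ρ x := fun ρ =>
    mul_nonneg (sq_nonneg _) (sphMean_nonneg h0 _ _)
  have h1 : ∫ y, f y = sphArea.toReal * ∫ ρ in Ioi (0 : ℝ), ρ ^ 2 * sphMean f ρ x := by
    rw [integral_eq_lintegral_of_nonneg_ae (Eventually.of_forall h0) hf.aestronglyMeasurable,
      lintegral_radial hf h0 x, ENNReal.toReal_mul,
      integral_eq_lintegral_of_nonneg_ae (Eventually.of_forall hnn) hI.1]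
  rw [h1, ← mul_assoc, inv_mul_cancel₀ sphArea_toReal_pos.ne', one_mul,
    intervalIntegral.integral_of_le hR]
  exact setIntegral_mono_set hI (Eventually.of_forall hnn) (Eventually.of_forall
    (Ioc_subset_Ioi_self))

/-- Otherwise the radial density of an integrable function would exceed `η` on a half-line. Decay
along some sequence of radii is enough to discard boundary terms at infinity. -/
lemma exists_radius_small {f : E3 → ℝ} (hf : Continuous f) (h0 : ∀ y, 0 ≤ f y)
    (hi : Integrable f) (x : E3) (T : ℝ) {η : ℝ} (hη : 0 < η) :
    ∃ R, T ≤ R ∧ R ^ 2 * sphMean f R x ≤ η := by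
  by_contra! h
  have hI := (integrableOn_radial hf h0 hi x).mono_set
    (Ioi_subset_Ioi (le_max_right T 0) : Ioi (max T 0) ⊆ Ioi 0)
  have hc : IntegrableOn (fun _ : ℝ => η) (Ioi (max T 0)) := by
    refine hI.mono' aestronglyMeasurable_const ?_
    filter_upwards [ae_restrict_mem measurableSet_Ioi] with ρ hρ
    rw [Real.norm_of_nonneg hη.le]
    exact (h ρ ((le_max_left _ _).trans (le_of_lt hρ))).le
  rw [integrableOn_const_iff] at hc
  simp [hη.ne'] at hc

end Radial

/-! ### One-dimensional trace and Hardy inequalities. -/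

section OneDim

variable {a a' k : ℝ → ℝ}

lemma sub_le_integral_of_abs_deriv_le (ha : ∀ ρ, HasDerivAt a (a' ρ) ρ) (ha' : Continuous a')
    (hk : Continuous k) {t R : ℝ} (ht : 0 ≤ t) (hR : t ≤ R) (h : ∀ ρ, 0 ≤ ρ → |a' ρ| ≤ k ρ) :
    a t ≤ a R + ∫ ρ in t..R, k ρ := by
  have h1 := intervalIntegral.integral_eq_sub_of_hasDerivAt (a := t) (b := R)
    (fun s _ => ha s) (ha'.intervalIntegrable _ _)
  have h2 : ∫ ρ in t..R, -a' ρ ≤ ∫ ρ in t..R, k ρ :=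
    intervalIntegral.integral_mono_on hR (ha'.neg.intervalIntegrable _ _)
      (hk.intervalIntegrable _ _) fun s hs =>
        (neg_le_abs _).trans (h s (ht.trans hs.1))
  rw [intervalIntegral.integral_neg, h1] at h2
  linarith

/-- Integrate `a'` from `t` to a radius where `ρ² a` is small, and use `t ≤ ρ` to move the factor
`t²` inside the integral. -/
lemma sq_mul_le_of_abs_deriv_le (ha : ∀ ρ, HasDerivAt a (a' ρ) ρ) (ha' : Continuous a')
    (hk : Continuous k) (h0 : ∀ ρ, 0 ≤ a ρ) (h : ∀ ρ, 0 ≤ ρ → |a' ρ| ≤ k ρ) {B : ℝ}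
    (hB : ∀ R, 0 ≤ R → ∫ ρ in (0 : ℝ)..R, ρ ^ 2 * k ρ ≤ B)
    (hdec : ∀ T η, 0 < η → ∃ R, T ≤ R ∧ R ^ 2 * a R ≤ η) {t : ℝ} (ht : 0 ≤ t) :
    t ^ 2 * a t ≤ B := by
  have hk0 : ∀ ρ, 0 ≤ ρ → 0 ≤ k ρ := fun ρ hρ => (abs_nonneg _).trans (h ρ hρ)
  refine le_of_forall_pos_le_add fun η hη => ?_
  obtain ⟨R, hR, hRη⟩ := hdec t η hη
  have h1 := sub_le_integral_of_abs_deriv_le ha ha' hk ht hR h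
  have hc : Continuous fun ρ : ℝ => ρ ^ 2 * k ρ := by fun_prop
  have h2 : t ^ 2 * ∫ ρ in t..R, k ρ ≤ ∫ ρ in t..R, ρ ^ 2 * k ρ := by
    rw [← intervalIntegral.integral_const_mul]
    refine intervalIntegral.integral_mono_on hR ((hk.const_mul _).intervalIntegrable _ _)
      (hc.intervalIntegrable _ _) fun s hs => ?_
    exact mul_le_mul_of_nonneg_right (pow_le_pow_left₀ ht hs.1 2) (hk0 s (ht.trans hs.1))
  have h3 : ∫ ρ in t..R, ρ ^ 2 * k ρ ≤ ∫ ρ in (0 : ℝ)..R, ρ ^ 2 * k ρ := by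
    refine intervalIntegral.integral_mono_interval ht hR le_rfl ?_ (hc.intervalIntegrable _ _)
    filter_upwards [ae_restrict_mem measurableSet_Ioc] with s hs
    exact mul_nonneg (sq_nonneg _) (hk0 s hs.1.le)
  have h4 : t ^ 2 * a R ≤ R ^ 2 * a R :=
    mul_le_mul_of_nonneg_right (pow_le_pow_left₀ ht hR 2) (h0 R)
  have h5 := mul_le_mul_of_nonneg_left h1 (sq_nonneg t)
  have h6 := hB R (ht.trans hR)
  linarith

/-- Integrate `(ρ a)' = a + ρ a'`. By hypothesis `ρ a'` costs at most half of `a`, which is absorbed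
on the left and produces the factors `2`. -/
lemma integral_le_of_hardy (ha : ∀ ρ, HasDerivAt a (a' ρ) ρ) (ha' : Continuous a')
    (hk : Continuous k) (h : ∀ ρ, 0 ≤ ρ → ρ * |a' ρ| ≤ a ρ / 2 + ρ ^ 2 * k ρ) {B R : ℝ}
    (hR : 0 ≤ R) (hB : ∫ ρ in (0 : ℝ)..R, ρ ^ 2 * k ρ ≤ B) :
    ∫ ρ in (0 : ℝ)..R, a ρ ≤ 2 * (R * a R) + 2 * B := by
  have hac : Continuous a := continuous_iff_continuousAt.2 fun y => (ha y).continuousAt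
  have hd : ∀ ρ, HasDerivAt (fun ρ => ρ * a ρ) (a ρ + ρ * a' ρ) ρ := fun ρ => by
    simpa using (hasDerivAt_id' ρ).fun_mul (ha ρ)
  have h1 := intervalIntegral.integral_eq_sub_of_hasDerivAt (a := 0) (b := R)
    (fun s _ => hd s) ((by fun_prop : Continuous fun ρ => a ρ + ρ * a' ρ).intervalIntegrable _ _)
  have h2 : ∫ ρ in (0 : ℝ)..R, a ρ ≤
      ∫ ρ in (0 : ℝ)..R, (2 * (a ρ + ρ * a' ρ) + 2 * (ρ ^ 2 * k ρ)) := by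
    refine intervalIntegral.integral_mono_on hR (hac.intervalIntegrable _ _)
      ((by fun_prop : Continuous fun ρ => 2 * (a ρ + ρ * a' ρ) + 2 * (ρ ^ 2 * k ρ)).intervalIntegrable
        _ _) fun s hs => ?_
    have := h s hs.1
    have h3 : -(s * |a' s|) ≤ s * a' s := by
      rw [← mul_neg]; exact mul_le_mul_of_nonneg_left (neg_abs_le _) hs.1
    linarith
  rw [intervalIntegral.integral_add
    ((by fun_prop : Continuous fun ρ => 2 * (a ρ + ρ * a' ρ)).intervalIntegrable _ _)
    ((by fun_prop : Continuous fun ρ : ℝ => 2 * (ρ ^ 2 * k ρ)).intervalIntegrable _ _),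
    intervalIntegral.integral_const_mul, intervalIntegral.integral_const_mul, h1] at h2
  linarith

end OneDim

/-! ### Weighted energies control spherical means. -/

section Energy

/-- The linear form with coefficients `v`. -/
def lc (v : Fin 3 → ℝ) : E3 →L[ℝ] ℝ := ∑ a, v a • (EuclideanSpace.proj a : E3 →L[ℝ] ℝ)

lemma lc_apply (v : Fin 3 → ℝ) (θ : E3) : lc v θ = ∑ a, v a * θ a := by simp [lc]

lemma lc_apply_sq_le (v : Fin 3 → ℝ) {θ : E3} (hθ : ‖θ‖ = 1) : lc v θ ^ 2 ≤ ∑ a, v a ^ 2 := by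
  have h := Finset.sum_mul_sq_le_sq_mul_sq Finset.univ v θ
  rw [lc_apply]
  refine h.trans_eq ?_
  rw [← EuclideanSpace.real_norm_sq_eq θ, hθ]
  ring

lemma continuous_lc {X : Type*} [TopologicalSpace X] {v : Fin 3 → X → ℝ}
    (h : ∀ a, Continuous (v a)) : Continuous fun y => lc fun a => v a y := by
  unfold lc
  fun_prop

/-- The scalar function `g` has the continuous partial derivatives `gd`. -/
structure HasPartials (g : E3 → ℝ) (gd : Fin 3 → E3 → ℝ) : Prop where
  hasFDerivAt : ∀ y, HasFDerivAt g (lc fun a => gd a y) y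
  continuous : ∀ a, Continuous (gd a)

lemma HasPartials.cont {g : E3 → ℝ} {gd : Fin 3 → E3 → ℝ} (h : HasPartials g gd) :
    Continuous g := continuous_of_hasFDerivAt h.hasFDerivAt

/-- The weighted energy `λ ∫ g² + λ⁻¹ ∫ (1 + ε²|y|²) |∇g|²`. -/
def wEnergy (ε l : ℝ) (g : E3 → ℝ) (gd : Fin 3 → E3 → ℝ) : ℝ :=
  l * (∫ y, g y ^ 2) + l⁻¹ * ∫ y, wt (-1) ε y * ∑ a, gd a y ^ 2

/-- The weight `q = (1 + ε²|y|²)^{1/2}`. -/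
abbrev qw (ε : ℝ) : E3 → ℝ := wt (-(1 / 2)) ε

lemma qw_sq (ε : ℝ) (y : E3) : qw ε y ^ 2 = wt (-1) ε y := by
  rw [sq, ← wt_add]; norm_num

lemma one_le_qw (ε : ℝ) (y : E3) : 1 ≤ qw ε y := by
  unfold qw wt
  exact Real.one_le_rpow (one_le_base ε y) (by norm_num)

lemma qw_le_sq (ε : ℝ) (y : E3) : qw ε y ≤ wt (-1) ε y := by
  rw [← qw_sq]
  nlinarith [one_le_qw ε y]

lemma mul_norm_le_qw {ε : ℝ} (hε : 0 ≤ ε) (y : E3) : ε * ‖y‖ ≤ qw ε y := by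
  have h : (ε * ‖y‖) ^ 2 ≤ qw ε y ^ 2 := by
    rw [qw_sq, wt_neg_one]; nlinarith
  exact (pow_le_pow_iff_left₀ (by positivity) (wt_pos _ _ _).le two_ne_zero).1 h

lemma qw_le {ε : ℝ} (hε : 0 ≤ ε) (y : E3) : qw ε y ≤ 1 + ε * ‖y‖ := by
  have h : qw ε y ^ 2 ≤ (1 + ε * ‖y‖) ^ 2 := by
    rw [qw_sq, wt_neg_one]; nlinarith [mul_nonneg hε (norm_nonneg y)]
  exact (pow_le_pow_iff_left₀ (wt_pos _ _ _).le (by positivity) two_ne_zero).1 h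

/-- The gradient of `q` is `ε² y / q`, and `ε|y| ≤ q`. Hence differentiating the weight costs only a
factor `ε`, without any growth in `y`. -/
lemma abs_qw'_le {ε : ℝ} (hε : 0 ≤ ε) (y : E3) {θ : E3} (hθ : ‖θ‖ = 1) :
    |wt' (-(1 / 2)) ε y θ| ≤ ε := by
  have h1 : ipL y θ = inner ℝ y θ := by
    simp [ipL_apply, PiLp.inner_apply, mul_comm]
  have h2 : |ipL y θ| ≤ ‖y‖ := by
    rw [h1]; simpa [hθ] using abs_real_inner_le_norm y θ
  have h3 : wt (-(1 / 2) + 1) ε y * qw ε y = 1 := by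
    rw [qw, ← wt_add]; norm_num [wt]
  have h4 := wt_pos (-(1 / 2) + 1) ε y
  have h5 : wt' (-(1 / 2)) ε y θ = ε ^ 2 * wt (-(1 / 2) + 1) ε y * ipL y θ := by
    simp [wt']
  rw [h5, abs_mul, abs_of_nonneg (by positivity)]
  calc ε ^ 2 * wt (-(1 / 2) + 1) ε y * |ipL y θ|
      ≤ ε ^ 2 * wt (-(1 / 2) + 1) ε y * ‖y‖ := by gcongr
    _ = ε * (wt (-(1 / 2) + 1) ε y * (ε * ‖y‖)) := by ring
    _ ≤ ε * (wt (-(1 / 2) + 1) ε y * qw ε y) := by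
        gcongr; exact mul_norm_le_qw hε y
    _ = ε := by rw [h3, mul_one]

variable {g : E3 → ℝ} {gd : Fin 3 → E3 → ℝ} {ε l : ℝ}

/-- The derivative of `q g²`. -/
def qsq' (ε : ℝ) (g : E3 → ℝ) (gd : Fin 3 → E3 → ℝ) (y : E3) : E3 →L[ℝ] ℝ :=
  qw ε y • ((2 * g y) • lc fun a => gd a y) + (g y ^ 2) • wt' (-(1 / 2)) ε y

lemma hasFDerivAt_qsq (h : HasPartials g gd) (ε : ℝ) (y : E3) :
    HasFDerivAt (fun y => qw ε y * g y ^ 2) (qsq' ε g gd y) y := by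
  have h1 := (h.hasFDerivAt y).pow 2
  have h2 := (hasFDerivAt_wt (-(1 / 2)) ε y).mul h1
  refine h2.congr_fderiv ?_
  simp [qsq', qw]

lemma continuous_qsq' (h : HasPartials g gd) (ε : ℝ) : Continuous (qsq' ε g gd) := by
  have h1 := continuous_wt (-(1 / 2)) ε
  have h2 := continuous_wt' (-(1 / 2)) ε
  have h3 := continuous_lc h.continuous
  have h4 := h.cont
  unfold qsq'
  fun_prop

lemma qsq'_apply (y θ : E3) : qsq' ε g gd y θ =
    2 * qw ε y * g y * lc (fun a => gd a y) θ + g y ^ 2 * wt' (-(1 / 2)) ε y θ := by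
  simp [qsq']; ring

lemma abs_deriv_mean_le {κ : E3 → ℝ} (hκ : Continuous κ)
    (hb : ∀ y θ, ‖θ‖ = 1 → |qsq' ε g gd y θ| ≤ κ y) (ρ : ℝ) (x : E3) :
    |∫ θ, qsq' ε g gd (x + ρ • θ) θ ∂sph| ≤ sphMean κ ρ x := by
  rw [← Real.norm_eq_abs]
  refine norm_integral_le_of_norm_le (g := fun θ => κ (x + ρ • θ)) (integrable_sph (by fun_prop)) ?_
  filter_upwards [ae_sph_norm] with θ hθ using hb _ _ hθ

lemma continuous_deriv_mean (h : HasPartials g gd) (ε : ℝ) (x : E3) :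
    Continuous fun ρ : ℝ => ∫ θ, qsq' ε g gd (x + ρ • θ) θ ∂sph := by
  have := continuous_qsq' h ε
  exact continuous_integral_sph (f := fun (ρ : ℝ) θ => qsq' ε g gd (x + ρ • θ) θ) (by fun_prop)

/-- The trace inequality on spheres. -/
lemma sq_mul_sphMean_le (h : HasPartials g gd) (hε : 0 ≤ ε) (hl : 0 < l) (hεl : ε ≤ l)
    (hi : Integrable fun y => wt (-1) ε y * g y ^ 2)
    (hid : ∀ a, Integrable fun y => wt (-1) ε y * gd a y ^ 2) (x : E3) {t : ℝ} (ht : 0 ≤ t) :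
    t ^ 2 * sphMean (fun y => qw ε y * g y ^ 2) t x ≤
      sphArea.toReal⁻¹ * (2 * wEnergy ε l g gd) := by
  have hq := continuous_wt (-(1 / 2)) ε
  have hq1 := continuous_wt (-1) ε
  have hg := h.cont
  have hgd := h.continuous
  have hi0 : Integrable fun y => g y ^ 2 := by
    refine hi.mono' (by fun_prop : Continuous fun y => g y ^ 2).aestronglyMeasurable
      (Eventually.of_forall fun y => ?_)
    rw [Real.norm_of_nonneg (sq_nonneg _)]
    exact le_mul_of_one_le_left (sq_nonneg _) ((one_le_qw ε y).trans (qw_le_sq ε y))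
  have hi1 : Integrable fun y => qw ε y * g y ^ 2 := by
    refine hi.mono' (by fun_prop : Continuous fun y => qw ε y * g y ^ 2).aestronglyMeasurable
      (Eventually.of_forall fun y => ?_)
    rw [Real.norm_of_nonneg (mul_nonneg (wt_pos _ _ _).le (sq_nonneg _))]
    exact mul_le_mul_of_nonneg_right (qw_le_sq ε y) (sq_nonneg _)
  have hid' : Integrable fun y => wt (-1) ε y * ∑ a, gd a y ^ 2 := by
    simp only [Finset.mul_sum]
    exact integrable_finsetSum _ fun a _ => hid a
  -- A majorant for the derivative of `q g²` in unit directions. Young's inequality with parameter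
  -- `l` splits `2 q g ∇g`, and the derivative of `q` adds at most `ε g² ≤ l g²`, hence the factor
  -- `2`.
  let κ : E3 → ℝ := fun y => 2 * l * g y ^ 2 + l⁻¹ * (wt (-1) ε y * ∑ a, gd a y ^ 2)
  have hκ : Continuous κ := by simp only [κ]; fun_prop
  have hκi : Integrable κ := (hi0.const_mul _).add (hid'.const_mul _)
  have hκ0 : ∀ y, 0 ≤ κ y := fun y => by
    have := (wt_pos (-1) ε y).le
    simp only [κ]
    positivity
  have hb : ∀ y θ, ‖θ‖ = 1 → |qsq' ε g gd y θ| ≤ κ y := by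
    intro y θ hθ
    have h1 := abs_qw'_le hε y hθ
    have h2 := lc_apply_sq_le (fun a => gd a y) hθ
    rw [qsq'_apply]
    set d := lc (fun a => gd a y) θ
    have h3 : |2 * qw ε y * g y * d| ≤ l * g y ^ 2 + l⁻¹ * (qw ε y ^ 2 * d ^ 2) := by
      have e1 : l * l⁻¹ = 1 := mul_inv_cancel₀ hl.ne'
      have e2 : 0 < l⁻¹ := inv_pos.2 hl
      rw [abs_le]
      constructor
      · have : 0 ≤ l⁻¹ * (l * g y + qw ε y * d) ^ 2 := by positivity
        have e : l⁻¹ * (l * g y + qw ε y * d) ^ 2 = (l * l⁻¹) * l * g y ^ 2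
          + (l * l⁻¹) * (2 * qw ε y * g y * d) + l⁻¹ * (qw ε y ^ 2 * d ^ 2) := by ring
        rw [e, e1] at this; linarith
      · have : 0 ≤ l⁻¹ * (l * g y - qw ε y * d) ^ 2 := by positivity
        have e : l⁻¹ * (l * g y - qw ε y * d) ^ 2 = (l * l⁻¹) * l * g y ^ 2
          - (l * l⁻¹) * (2 * qw ε y * g y * d) + l⁻¹ * (qw ε y ^ 2 * d ^ 2) := by ring
        rw [e, e1] at this; linarith
    have h4 : |g y ^ 2 * wt' (-(1 / 2)) ε y θ| ≤ l * g y ^ 2 := by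
      rw [abs_mul, abs_of_nonneg (sq_nonneg _), mul_comm]
      exact mul_le_mul_of_nonneg_right (h1.trans hεl) (sq_nonneg _)
    have h5 : l⁻¹ * (qw ε y ^ 2 * d ^ 2) ≤ l⁻¹ * (wt (-1) ε y * ∑ a, gd a y ^ 2) := by
      rw [qw_sq]
      have := (wt_pos (-1) ε y).le
      gcongr
    refine (abs_add_le _ _).trans ?_
    simp only [κ]
    linarith
  have hκint : ∫ y, κ y ≤ 2 * wEnergy ε l g gd := by
    simp only [κ]
    rw [integral_add (hi0.const_mul _) (hid'.const_mul _), integral_const_mul, integral_const_mul,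
      wEnergy]
    have : 0 ≤ l⁻¹ * ∫ y, wt (-1) ε y * ∑ a, gd a y ^ 2 := by
      refine mul_nonneg (by positivity) (integral_nonneg fun y => ?_)
      have := (wt_pos (-1) ε y).le
      simp only [Pi.zero_apply]
      positivity
    linarith
  refine sq_mul_le_of_abs_deriv_le (k := fun ρ => sphMean κ ρ x)
    (fun ρ => hasDerivAt_sphMean (hasFDerivAt_qsq h ε) (continuous_qsq' h ε) ρ x)
    (continuous_deriv_mean h ε x) (continuous_sphMean_radius hκ x)
    (fun ρ => sphMean_nonneg (fun y => mul_nonneg (wt_pos _ _ _).le (sq_nonneg _)) _ _)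
    (fun ρ _ => abs_deriv_mean_le hκ hb ρ x)
    (fun R hR => (integral_radial_le hκ hκ0 hκi x hR).trans ?_)
    (fun T η hη => exists_radius_small (by fun_prop)
      (fun y => mul_nonneg (wt_pos _ _ _).le (sq_nonneg _)) hi1 x T hη) ht
  exact mul_le_mul_of_nonneg_left hκint (inv_pos.2 sphArea_toReal_pos).le

/-- Hardy's inequality for the weighted spherical means. -/
lemma integral_sphMean_le (h : HasPartials g gd) (hε : 0 ≤ ε) (hl : 0 < l) (hεl : ε ≤ l)
    (hi : Integrable fun y => g y ^ 2)
    (hid : ∀ a, Integrable fun y => wt (-1) ε y * gd a y ^ 2) (x : E3) {R : ℝ} (hR : 0 ≤ R) :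
    ∫ ρ in (0 : ℝ)..R, sphMean (fun y => qw ε y * g y ^ 2) ρ x ≤
      2 * (R * sphMean (fun y => qw ε y * g y ^ 2) R x) +
        2 * (sphArea.toReal⁻¹ * (4 * l * wEnergy ε l g gd)) := by
  have hq := continuous_wt (-(1 / 2)) ε
  have hq1 := continuous_wt (-1) ε
  have hg := h.cont
  have hgd := h.continuous
  have hid' : Integrable fun y => wt (-1) ε y * ∑ a, gd a y ^ 2 := by
    simp only [Finset.mul_sum]
    exact integrable_finsetSum _ fun a _ => hid a
  -- Both terms of `ρ |∇(q g²)|` are split so that each leaves `q g² / 4`; together they give the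
  -- half that Hardy's argument can absorb, and `κ` collects the remainders multiplying `ρ²`.
  let κ : E3 → ℝ := fun y => l ^ 2 * g y ^ 2 + 4 * (wt (-1) ε y * ∑ a, gd a y ^ 2)
  have hκ : Continuous κ := by simp only [κ]; fun_prop
  have hκi : Integrable κ := (hi.const_mul _).add (hid'.const_mul _)
  have hκ0 : ∀ y, 0 ≤ κ y := fun y => by
    have := (wt_pos (-1) ε y).le
    simp only [κ]
    positivity
  have hb : ∀ ρ : ℝ, 0 ≤ ρ → ∀ y θ, ‖θ‖ = 1 →
      ρ * |qsq' ε g gd y θ| ≤ (qw ε y * g y ^ 2) / 2 + ρ ^ 2 * κ y := by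
    intro ρ hρ y θ hθ
    have h1 := abs_qw'_le hε y hθ
    have h2 := lc_apply_sq_le (fun a => gd a y) hθ
    have hq0 := one_le_qw ε y
    rw [qsq'_apply]
    set d := lc (fun a => gd a y) θ
    have h3 : |2 * qw ε y * g y * d| * ρ ≤ qw ε y * g y ^ 2 / 4
        + ρ ^ 2 * (4 * (qw ε y * d ^ 2)) := by
      have e : |2 * qw ε y * g y * d| * ρ = qw ε y * (2 * (|g y| / 2) * (2 * ρ * |d|)) := by
        rw [abs_mul, abs_mul, abs_mul, abs_of_nonneg (by linarith : 0 ≤ qw ε y)]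
        simp; ring
      rw [e]
      have e2 : 2 * (|g y| / 2) * (2 * ρ * |d|) ≤ (|g y| / 2) ^ 2 + (2 * ρ * |d|) ^ 2 :=
        two_mul_le_add_sq _ _
      have e3 : (|g y| / 2) ^ 2 + (2 * ρ * |d|) ^ 2 = g y ^ 2 / 4 + 4 * ρ ^ 2 * d ^ 2 := by
        rw [div_pow, mul_pow, sq_abs, sq_abs]; ring
      rw [e3] at e2
      have := mul_le_mul_of_nonneg_left e2 (by linarith : 0 ≤ qw ε y)
      linarith
    have h4 : |g y ^ 2 * wt' (-(1 / 2)) ε y θ| * ρ ≤ qw ε y * g y ^ 2 / 4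
        + ρ ^ 2 * (l ^ 2 * g y ^ 2) := by
      rw [abs_mul, abs_of_nonneg (sq_nonneg _)]
      have e1 : |wt' (-(1 / 2)) ε y θ| * ρ ≤ l * ρ :=
        mul_le_mul_of_nonneg_right (h1.trans hεl) hρ
      have e2 : l * ρ ≤ 1 / 4 + ρ ^ 2 * l ^ 2 := by nlinarith [sq_nonneg (1 / 2 - l * ρ)]
      have e3 := mul_le_mul_of_nonneg_left (e1.trans e2) (sq_nonneg (g y))
      have e4 : g y ^ 2 ≤ qw ε y * g y ^ 2 := le_mul_of_one_le_left (sq_nonneg _) hq0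
      nlinarith
    have h5 : qw ε y * d ^ 2 ≤ wt (-1) ε y * ∑ a, gd a y ^ 2 := by
      have := qw_le_sq ε y
      have := (wt_pos (-1) ε y).le
      gcongr
    have h6 := mul_le_mul_of_nonneg_left h5 (sq_nonneg ρ)
    have h7 := mul_le_mul_of_nonneg_right (abs_add_le (2 * qw ε y * g y * d)
      (g y ^ 2 * wt' (-(1 / 2)) ε y θ)) hρ
    simp only [κ]
    linarith
  have hκint : ∫ y, κ y ≤ 4 * l * wEnergy ε l g gd := by
    simp only [κ]
    rw [integral_add (hi.const_mul _) (hid'.const_mul _), integral_const_mul, integral_const_mul,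
      wEnergy]
    have : 0 ≤ l ^ 2 * ∫ y, g y ^ 2 :=
      mul_nonneg (by positivity) (integral_nonneg fun y => sq_nonneg _)
    have e1 : l * l⁻¹ = 1 := mul_inv_cancel₀ hl.ne'
    have e2 : 4 * l * (l * (∫ y, g y ^ 2) + l⁻¹ * ∫ y, wt (-1) ε y * ∑ a, gd a y ^ 2)
      = 4 * (l ^ 2 * ∫ y, g y ^ 2) + 4 * (l * l⁻¹) * ∫ y, wt (-1) ε y * ∑ a, gd a y ^ 2 := by ring
    rw [e2, e1]
    linarith
  refine integral_le_of_hardy (k := fun ρ => sphMean κ ρ x)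
    (fun ρ => hasDerivAt_sphMean (hasFDerivAt_qsq h ε) (continuous_qsq' h ε) ρ x)
    (continuous_deriv_mean h ε x) (continuous_sphMean_radius hκ x) (fun ρ hρ => ?_) hR
    ((integral_radial_le hκ hκ0 hκi x hR).trans
      (mul_le_mul_of_nonneg_left hκint (inv_pos.2 sphArea_toReal_pos).le))
  have e1 : ρ * |∫ θ, qsq' ε g gd (x + ρ • θ) θ ∂sph| = ‖∫ θ, ρ * qsq' ε g gd (x + ρ • θ) θ ∂sph‖ := by
    rw [integral_const_mul, norm_mul, Real.norm_of_nonneg hρ, Real.norm_eq_abs]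
  have e2 : sphMean (fun y => qw ε y * g y ^ 2) ρ x / 2 + ρ ^ 2 * sphMean κ ρ x
      = ∫ θ, ((qw ε (x + ρ • θ) * g (x + ρ • θ) ^ 2) / 2 + ρ ^ 2 * κ (x + ρ • θ)) ∂sph := by
    rw [integral_add (integrable_sph (by fun_prop)) (integrable_sph (by fun_prop)),
      integral_div, integral_const_mul]
    rfl
  rw [e1, e2]
  refine norm_integral_le_of_norm_le (integrable_sph (by fun_prop)) ?_
  filter_upwards [ae_sph_norm] with θ hθ
  rw [norm_mul, Real.norm_of_nonneg hρ]
  exact hb ρ hρ _ _ hθ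

end Energy

/-! ### Spherical means of `q g²` bounded without a factor `t²`. -/

section Sup

variable {g : E3 → ℝ} {gd : Fin 3 → E3 → ℝ} {gdd : Fin 3 → Fin 3 → E3 → ℝ} {ε l : ℝ}

/-- On a sphere of radius `R ≥ 1` the weight `q` grows at most like `R`. The boundary terms at
radius `R` are therefore controlled by unweighted square integrability, which is all that is assumed
of `g` itself. -/
lemma mul_sphMean_qsq_le {f : E3 → ℝ} (hf : Continuous f) (hε : 0 ≤ ε) (x : E3) {R : ℝ}
    (hR : 1 ≤ R) : R * sphMean (fun y => qw ε y * f y ^ 2) R x ≤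
      (1 + ε * ‖x‖ + ε) * (R ^ 2 * sphMean (fun y => f y ^ 2) R x) := by
  have hq := continuous_wt (-(1 / 2)) ε
  have h1 : sphMean (fun y => qw ε y * f y ^ 2) R x ≤
      ∫ θ, ((1 + ε * ‖x‖ + ε) * R) * f (x + R • θ) ^ 2 ∂sph := by
    refine integral_mono_ae (integrable_sph (by fun_prop)) (integrable_sph (by fun_prop)) ?_
    filter_upwards [ae_sph_norm] with θ hθ
    refine mul_le_mul_of_nonneg_right ((qw_le hε _).trans ?_) (sq_nonneg _)
    have h2 : ‖x + R • θ‖ ≤ ‖x‖ + R := by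
      refine (norm_add_le _ _).trans_eq ?_
      rw [norm_smul, hθ, mul_one, Real.norm_of_nonneg (by linarith)]
    have h3 := mul_le_mul_of_nonneg_left h2 hε
    have h4 : 0 ≤ (1 + ε * ‖x‖) * (R - 1) :=
      mul_nonneg (by positivity) (by linarith)
    nlinarith
  rw [integral_const_mul] at h1
  have h2 := mul_le_mul_of_nonneg_left h1 (by linarith : 0 ≤ R)
  refine h2.trans_eq ?_
  rw [sphMean]
  ring

/-- A weighted Sobolev inequality for spherical means. -/
lemma sphMean_qsq_le (h : HasPartials g gd) (h2 : ∀ a, HasPartials (gd a) (gdd a)) (hε : 0 ≤ ε)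
    (hl : 0 < l) (hεl : ε ≤ l) (hi : Integrable fun y => g y ^ 2)
    (hid : ∀ a, Integrable fun y => wt (-1) ε y * gd a y ^ 2)
    (hidd : ∀ a b, Integrable fun y => wt (-1) ε y * gdd a b y ^ 2) (x : E3) {t : ℝ}
    (ht : 0 ≤ t) :
    sphMean (fun y => qw ε y * g y ^ 2) t x ≤ sphArea.toReal⁻¹ *
      (8 * (2 * l ^ 2 * wEnergy ε l g gd + ∑ a, wEnergy ε l (gd a) (gdd a))) := by
  have hq := continuous_wt (-(1 / 2)) ε
  have hg := h.cont
  have hgd := h.continuous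
  have hi' : ∀ a, Integrable fun y => gd a y ^ 2 := fun a => by
    have := hgd a
    refine (hid a).mono' (by fun_prop : Continuous fun y => gd a y ^ 2).aestronglyMeasurable
      (Eventually.of_forall fun y => ?_)
    rw [Real.norm_of_nonneg (sq_nonneg _)]
    exact le_mul_of_one_le_left (sq_nonneg _) ((one_le_qw ε y).trans (qw_le_sq ε y))
  -- Each summand keeps exactly one factor `q`, so Hardy's inequality applies both to `g` and to
  -- each of its partial derivatives.
  let κ : E3 → ℝ := fun y => 2 * l * (qw ε y * g y ^ 2) + l⁻¹ * ∑ a, qw ε y * gd a y ^ 2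
  have hκ : Continuous κ := by simp only [κ]; fun_prop
  have hκ0 : ∀ y, 0 ≤ κ y := fun y => by
    have := (wt_pos (-(1 / 2)) ε y).le
    have h3 : 0 ≤ ∑ a, qw ε y * gd a y ^ 2 :=
      Finset.sum_nonneg fun a _ => mul_nonneg this (sq_nonneg _)
    simp only [κ]
    positivity
  have hb : ∀ y θ, ‖θ‖ = 1 → |qsq' ε g gd y θ| ≤ κ y := by
    intro y θ hθ
    have h1 := abs_qw'_le hε y hθ
    have h2 := lc_apply_sq_le (fun a => gd a y) hθ
    have hq0 := one_le_qw ε y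
    rw [qsq'_apply]
    set d := lc (fun a => gd a y) θ
    have h3 : |2 * qw ε y * g y * d| ≤ qw ε y * (l * g y ^ 2 + l⁻¹ * d ^ 2) := by
      have e1 : l * l⁻¹ = 1 := mul_inv_cancel₀ hl.ne'
      have e2 : 0 < l⁻¹ := inv_pos.2 hl
      have e0 : |2 * qw ε y * g y * d| = qw ε y * |2 * g y * d| := by
        rw [show 2 * qw ε y * g y * d = qw ε y * (2 * g y * d) by ring, abs_mul,
          abs_of_nonneg (by linarith : 0 ≤ qw ε y)]
      rw [e0]
      refine mul_le_mul_of_nonneg_left ?_ (by linarith)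
      rw [abs_le]
      constructor
      · have : 0 ≤ l⁻¹ * (l * g y + d) ^ 2 := by positivity
        have e : l⁻¹ * (l * g y + d) ^ 2 = (l * l⁻¹) * l * g y ^ 2
          + (l * l⁻¹) * (2 * g y * d) + l⁻¹ * d ^ 2 := by ring
        rw [e, e1] at this; linarith
      · have : 0 ≤ l⁻¹ * (l * g y - d) ^ 2 := by positivity
        have e : l⁻¹ * (l * g y - d) ^ 2 = (l * l⁻¹) * l * g y ^ 2
          - (l * l⁻¹) * (2 * g y * d) + l⁻¹ * d ^ 2 := by ring
        rw [e, e1] at this; linarith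
    have h4 : |g y ^ 2 * wt' (-(1 / 2)) ε y θ| ≤ l * (qw ε y * g y ^ 2) := by
      rw [abs_mul, abs_of_nonneg (sq_nonneg _), mul_comm]
      refine mul_le_mul (h1.trans hεl) ?_ (sq_nonneg _) hl.le
      exact le_mul_of_one_le_left (sq_nonneg _) hq0
    have h5 : qw ε y * (l⁻¹ * d ^ 2) ≤ l⁻¹ * ∑ a, qw ε y * gd a y ^ 2 := by
      rw [← Finset.mul_sum]
      have e2 : 0 ≤ l⁻¹ := (inv_pos.2 hl).le
      calc qw ε y * (l⁻¹ * d ^ 2) = l⁻¹ * (qw ε y * d ^ 2) := by ring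
        _ ≤ _ := by gcongr
    refine (abs_add_le _ _).trans ?_
    simp only [κ]
    linarith
  have hc1 := continuous_sphMean_radius (f := fun y => qw ε y * g y ^ 2) (by fun_prop) x
  have hc2 := fun a => continuous_sphMean_radius (f := fun y => qw ε y * gd a y ^ 2)
    (by have := hgd a; fun_prop) x
  have hκmean : ∀ ρ, sphMean κ ρ x = 2 * l * sphMean (fun y => qw ε y * g y ^ 2) ρ x
      + l⁻¹ * ∑ a, sphMean (fun y => qw ε y * gd a y ^ 2) ρ x := by
    intro ρ
    simp only [sphMean, κ]
    rw [integral_add (integrable_sph (by fun_prop)) (integrable_sph (by fun_prop)),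
      integral_const_mul, integral_const_mul, integral_finsetSum]
    intro a _
    have := hgd a
    exact integrable_sph (by fun_prop)
  set E := wEnergy ε l g gd with hE
  set c := sphArea.toReal⁻¹ with hcdef
  set Cx := 1 + ε * ‖x‖ + ε with hCx
  have hCx1 : 1 ≤ Cx := by
    have : 0 ≤ ε * ‖x‖ := by positivity
    linarith
  have hli : 0 < l⁻¹ := inv_pos.2 hl
  refine le_of_forall_pos_le_add fun η hη => ?_
  have hD : 0 < Cx * (1 + 4 * l + 6 * l⁻¹) := by positivity
  let f : E3 → ℝ := fun y => g y ^ 2 + ∑ a, gd a y ^ 2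
  have hf : Continuous f := by simp only [f]; fun_prop
  have hfi : Integrable f := hi.add (integrable_finsetSum _ fun a _ => hi' a)
  -- The boundary terms number `1` from the value at `R`, `4l` from Hardy's inequality for `g`, and
  -- `6 l⁻¹` for the three partial derivatives. The choice of radius makes their total at most `η`.
  obtain ⟨R, hR, hRη⟩ := exists_radius_small hf (fun y => by simp only [f]; positivity) hfi x
    (max t 1) (η := η / (Cx * (1 + 4 * l + 6 * l⁻¹))) (by positivity)
  have hR1 : 1 ≤ R := (le_max_right _ _).trans hR
  have htR : t ≤ R := (le_max_left _ _).trans hR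
  set η' := η / (Cx * (1 + 4 * l + 6 * l⁻¹)) with hη'
  have hm : ∀ k : E3 → ℝ, Continuous k → (∀ y, k y ^ 2 ≤ f y) →
      R * sphMean (fun y => qw ε y * k y ^ 2) R x ≤ Cx * η' := by
    intro k hk hkf
    refine (mul_sphMean_qsq_le hk hε x hR1).trans ?_
    refine mul_le_mul_of_nonneg_left (le_trans ?_ hRη) (by linarith)
    exact mul_le_mul_of_nonneg_left (sphMean_mono (by fun_prop) hf hkf _ _) (sq_nonneg _)
  have hm0 := hm g hg fun y => by
    have : 0 ≤ ∑ a, gd a y ^ 2 := by positivity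
    simp only [f]; linarith
  have hma := fun a => hm (gd a) (hgd a) fun y => by
    have := Finset.single_le_sum (f := fun a => gd a y ^ 2) (fun _ _ => sq_nonneg _)
      (Finset.mem_univ a)
    simp only [f]
    nlinarith [sq_nonneg (g y)]
  have hk0 : ∀ ρ, 0 ≤ sphMean κ ρ x := fun ρ => sphMean_nonneg hκ0 _ _
  have hkc := continuous_sphMean_radius hκ x
  have key := sub_le_integral_of_abs_deriv_le (k := fun ρ => sphMean κ ρ x)
    (fun ρ => hasDerivAt_sphMean (hasFDerivAt_qsq h ε) (continuous_qsq' h ε) ρ x)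
    (continuous_deriv_mean h ε x) hkc ht htR (fun ρ _ => abs_deriv_mean_le hκ hb ρ x)
  have hmono : ∫ ρ in t..R, sphMean κ ρ x ≤ ∫ ρ in (0 : ℝ)..R, sphMean κ ρ x :=
    intervalIntegral.integral_mono_interval ht htR le_rfl
      (Eventually.of_forall fun ρ => hk0 ρ) (hkc.intervalIntegrable _ _)
  have hsplit : ∫ ρ in (0 : ℝ)..R, sphMean κ ρ x =
      2 * l * (∫ ρ in (0 : ℝ)..R, sphMean (fun y => qw ε y * g y ^ 2) ρ x)
      + l⁻¹ * ∑ a, ∫ ρ in (0 : ℝ)..R, sphMean (fun y => qw ε y * gd a y ^ 2) ρ x := by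
    simp only [hκmean]
    rw [intervalIntegral.integral_add ((hc1.const_mul _).intervalIntegrable _ _)
      ((by fun_prop : Continuous fun ρ => l⁻¹ * ∑ a, sphMean (fun y => qw ε y * gd a y ^ 2) ρ
        x).intervalIntegrable _ _), intervalIntegral.integral_const_mul,
      intervalIntegral.integral_const_mul, intervalIntegral.integral_finsetSum]
    intro a _
    exact (hc2 a).intervalIntegrable _ _
  have hI0 := integral_sphMean_le h hε hl hεl hi hid x (by linarith : 0 ≤ R)
  have hIa := fun a => integral_sphMean_le (h2 a) hε hl hεl (hi' a) (hidd a) x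
    (by linarith : 0 ≤ R)
  have hA0 : ∫ ρ in (0 : ℝ)..R, sphMean (fun y => qw ε y * g y ^ 2) ρ x ≤
      2 * (Cx * η') + 8 * (c * (l * E)) := by
    refine hI0.trans ?_
    nlinarith
  have hAa : ∑ a, ∫ ρ in (0 : ℝ)..R, sphMean (fun y => qw ε y * gd a y ^ 2) ρ x ≤
      6 * (Cx * η') + 8 * (c * (l * ∑ a, wEnergy ε l (gd a) (gdd a))) := by
    have : ∀ a ∈ (Finset.univ : Finset (Fin 3)),
        ∫ ρ in (0 : ℝ)..R, sphMean (fun y => qw ε y * gd a y ^ 2) ρ x ≤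
        2 * (Cx * η') + 8 * (c * (l * wEnergy ε l (gd a) (gdd a))) := by
      intro a _
      refine (hIa a).trans ?_
      have := hma a
      nlinarith
    refine (Finset.sum_le_sum this).trans_eq ?_
    simp only [Fin.sum_univ_three]
    ring
  have haR : sphMean (fun y => qw ε y * g y ^ 2) R x ≤ Cx * η' := by
    refine le_trans ?_ hm0
    exact le_mul_of_one_le_left (sphMean_nonneg (fun y => mul_nonneg (wt_pos _ _ _).le
      (sq_nonneg _)) _ _) hR1
  have hfin : Cx * η' * (1 + 4 * l + 6 * l⁻¹) = η := by
    rw [hη']; field_simp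
  have e1 := mul_le_mul_of_nonneg_left hA0 (by positivity : 0 ≤ 2 * l)
  have e2 := mul_le_mul_of_nonneg_left hAa hli.le
  have e3 : l⁻¹ * (6 * (Cx * η') + 8 * (c * (l * ∑ a, wEnergy ε l (gd a) (gdd a)))) =
      6 * l⁻¹ * (Cx * η') + 8 * (c * ∑ a, wEnergy ε l (gd a) (gdd a)) := by
    field_simp
  rw [e3] at e2
  rw [hsplit] at hmono
  nlinarith

end Sup

/-! ### Pointwise decay of free waves in terms of weighted energies. -/

section Linear

/-- The right-hand side is optimised at `μ = √B / W`. This replaces the Cauchy-Schwarz inequality by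
pointwise Young inequalities. -/
lemma le_mul_sqrt_of_forall {m W B : ℝ} (hW : 0 < W) (hB : 0 < B)
    (h : ∀ μ : ℝ, 0 < μ → 2 * m ≤ μ * W ^ 2 + B / μ) : m ≤ W * Real.sqrt B := by
  have hs := Real.sqrt_pos.2 hB
  have h1 := h (Real.sqrt B / W) (by positivity)
  have e : Real.sqrt B / W * W ^ 2 + B / (Real.sqrt B / W) = 2 * (W * Real.sqrt B) := by
    have : B = Real.sqrt B * Real.sqrt B := (Real.mul_self_sqrt hB.le).symm
    field_simp
    nlinarith
  linarith

/-- Cauchy-Schwarz against the superharmonic weight. -/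
lemma mul_sphMean_abs_le {f : E3 → ℝ} (hf : Continuous f) {ε t s B : ℝ} (ht : 0 ≤ t)
    (x : E3) (hB : 0 < B)
    (h : s ^ 2 * sphMean (fun y => qw ε y * f y ^ 2) t x ≤ B) :
    s * sphMean (fun y => |f y|) t x ≤ wt (1 / 4) ε x * Real.sqrt B := by
  have hq := continuous_wt (-(1 / 2)) ε
  have hq2 := continuous_wt (1 / 2) ε
  refine le_mul_sqrt_of_forall (wt_pos _ _ _) hB fun μ hμ => ?_
  have hW : wt (1 / 4) ε x ^ 2 = wt (1 / 2) ε x := by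
    rw [sq, ← wt_add]; norm_num
  have h1 : 2 * (s * sphMean (fun y => |f y|) t x) ≤
      μ * sphMean (wt (1 / 2) ε) t x + s ^ 2 * sphMean (fun y => qw ε y * f y ^ 2) t x / μ := by
    have e1 : 2 * (s * sphMean (fun y => |f y|) t x) =
        ∫ θ, 2 * s * |f (x + t • θ)| ∂sph := by
      rw [integral_const_mul, sphMean]; ring
    have e2 : μ * sphMean (wt (1 / 2) ε) t x + s ^ 2 * sphMean (fun y => qw ε y * f y ^ 2) t x / μ
        = ∫ θ, (μ * wt (1 / 2) ε (x + t • θ)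
          + s ^ 2 / μ * (qw ε (x + t • θ) * f (x + t • θ) ^ 2)) ∂sph := by
      rw [integral_add (integrable_sph (by fun_prop)) (integrable_sph (by fun_prop)),
        integral_const_mul, integral_const_mul, sphMean, sphMean]
      ring
    rw [e1, e2]
    refine integral_mono (integrable_sph (by fun_prop)) (integrable_sph (by fun_prop)) fun θ => ?_
    dsimp only
    set y := x + t • θ
    have hqq : wt (1 / 2) ε y * qw ε y = 1 := by
      rw [← wt_add]; norm_num [wt]
    have hq0 := wt_pos (-(1 / 2)) ε y
    have hw : wt (1 / 2) ε y = 1 / qw ε y := by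
      rw [eq_div_iff hq0.ne', hqq]
    have hsq : f y ^ 2 = |f y| ^ 2 := (sq_abs _).symm
    rw [hw, hsq]
    -- Expanding the square is Young's inequality with the weights `1/q` and `q`.
    have : 0 ≤ (μ - s * qw ε y * |f y|) ^ 2 / (μ * qw ε y) := by positivity
    have e : (μ - s * qw ε y * |f y|) ^ 2 / (μ * qw ε y) =
        μ * (1 / qw ε y) + s ^ 2 / μ * (qw ε y * |f y| ^ 2) - 2 * s * |f y| := by
      field_simp
      ring
    rw [e] at this
    linarith
  refine h1.trans ?_
  rw [hW]
  -- The mean of `1/q` over a sphere of any radius does not exceed its value at the centre, since `b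
  -- = 1/2` is still admissible; this transfers the decay to the point `x`.
  have h2 := sphMean_wt_le (b := 1 / 2) (by norm_num) le_rfl ε ht x
  gcongr

lemma abs_lc_le (v : Fin 3 → ℝ) {θ : E3} (hθ : ‖θ‖ = 1) : |lc v θ| ≤ ∑ a, |v a| := by
  rw [lc_apply]
  refine (Finset.abs_sum_le_sum_abs _ _).trans (Finset.sum_le_sum fun a _ => ?_)
  rw [abs_mul]
  refine mul_le_of_le_one_right (abs_nonneg _) ?_
  have := PiLp.norm_apply_le θ a
  rwa [hθ, Real.norm_eq_abs] at this

/-- The pointwise bound for free waves by weighted energies of the data. -/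
lemma abs_freeWave_le {u v : E3 → ℝ} {ud vd : Fin 3 → E3 → ℝ} {udd : Fin 3 → Fin 3 → E3 → ℝ}
    {ε B : ℝ} (hε : 0 < ε) (hu : HasPartials u ud) (hu2 : ∀ a, HasPartials (ud a) (udd a))
    (hv : HasPartials v vd) (hiu : Integrable fun y => u y ^ 2)
    (hiud : ∀ a, Integrable fun y => wt (-1) ε y * ud a y ^ 2)
    (hiudd : ∀ a b, Integrable fun y => wt (-1) ε y * udd a b y ^ 2)
    (hiv : Integrable fun y => wt (-1) ε y * v y ^ 2)
    (hivd : ∀ a, Integrable fun y => wt (-1) ε y * vd a y ^ 2) (hB : 0 < B)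
    (h1 : sphArea.toReal⁻¹ * (8 * (2 * ε ^ 2 * wEnergy ε ε u ud
      + ∑ a, wEnergy ε ε (ud a) (udd a))) ≤ B)
    (h2 : ∀ a, sphArea.toReal⁻¹ * (2 * wEnergy ε ε (ud a) (udd a)) ≤ B)
    (h3 : sphArea.toReal⁻¹ * (2 * wEnergy ε ε v vd) ≤ B) {t : ℝ} (ht : 0 ≤ t) (x : E3) :
    |freeWave u (fun y => lc fun a => ud a y) v t x| ≤ 5 * (wt (1 / 4) ε x * Real.sqrt B) := by
  have huc := hu.cont
  have hudc := hu.continuous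
  have hvc := hv.cont
  have b1 : sphMean (fun y => |u y|) t x ≤ wt (1 / 4) ε x * Real.sqrt B := by
    -- The mean of `u` carries no factor `t`, so the stronger bound using two derivatives is needed.
    -- The other two terms carry the factor `t` and are covered by the trace inequality.
    have := mul_sphMean_abs_le huc (ε := ε) (s := 1) ht x hB (by
      rw [one_pow, one_mul]
      exact (sphMean_qsq_le hu hu2 hε.le hε le_rfl hiu hiud hiudd x ht).trans h1)
    rwa [one_mul] at this
  have b2 : ∀ a, t * sphMean (fun y => |ud a y|) t x ≤ wt (1 / 4) ε x * Real.sqrt B := fun a =>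
    mul_sphMean_abs_le (hudc a) ht x hB
      ((sq_mul_sphMean_le (hu2 a) hε.le hε le_rfl (hiud a) (hiudd a) x ht).trans (h2 a))
  have b3 : t * sphMean (fun y => |v y|) t x ≤ wt (1 / 4) ε x * Real.sqrt B :=
    mul_sphMean_abs_le hvc ht x hB
      ((sq_mul_sphMean_le hv hε.le hε le_rfl hiv hivd x ht).trans h3)
  have c1 : |sphMean u t x| ≤ sphMean (fun y => |u y|) t x :=
    norm_sphMean_le (g := u) (f := fun y => |u y|) (by fun_prop) (fun y => le_rfl) t x
  have c3 : |sphMean v t x| ≤ sphMean (fun y => |v y|) t x :=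
    norm_sphMean_le (g := v) (f := fun y => |v y|) (by fun_prop) (fun y => le_rfl) t x
  have c2 : |∫ θ, lc (fun a => ud a (x + t • θ)) θ ∂sph| ≤
      ∑ a, sphMean (fun y => |ud a y|) t x := by
    have e : ∑ a, sphMean (fun y => |ud a y|) t x = ∫ θ, ∑ a, |ud a (x + t • θ)| ∂sph := by
      rw [integral_finsetSum]
      · rfl
      · intro a _
        have := hudc a
        exact integrable_sph (by fun_prop)
    rw [e, ← Real.norm_eq_abs]
    refine norm_integral_le_of_norm_le (integrable_sph (by fun_prop)) ?_
    filter_upwards [ae_sph_norm] with θ hθ using abs_lc_le _ hθ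
  have d : freeWave u (fun y => lc fun a => ud a y) v t x = sphMean u t x
      + t * (∫ θ, lc (fun a => ud a (x + t • θ)) θ ∂sph) + t * sphMean v t x := rfl
  rw [d]
  have e2 : |t * ∫ θ, lc (fun a => ud a (x + t • θ)) θ ∂sph| ≤
      3 * (wt (1 / 4) ε x * Real.sqrt B) := by
    rw [abs_mul, abs_of_nonneg ht]
    refine (mul_le_mul_of_nonneg_left c2 ht).trans ?_
    rw [Finset.mul_sum]
    refine (Finset.sum_le_sum fun a _ => b2 a).trans_eq ?_
    simp
  have e3 : |t * sphMean v t x| ≤ wt (1 / 4) ε x * Real.sqrt B := by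
    rw [abs_mul, abs_of_nonneg ht]
    exact (mul_le_mul_of_nonneg_left c3 ht).trans b3
  refine (abs_add_le _ _).trans ?_
  have e4 := abs_add_le (sphMean u t x) (t * ∫ θ, lc (fun a => ud a (x + t • θ)) θ ∂sph)
  linarith

end Linear

/-! ### The power nonlinearity on jets of order two. -/

section Power

lemma hasDerivAt_abs_rpow_mul {q : ℝ} (hq : 1 < q) (u : ℝ) :
    HasDerivAt (fun u : ℝ => |u| ^ q * u) ((q + 1) * |u| ^ q) u := by
  have h := (hasDerivAt_abs_rpow u hq).fun_mul (hasDerivAt_id' u)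
  refine h.congr_deriv ?_
  rcases eq_or_ne u 0 with rfl | hu
  · simp [Real.zero_rpow (by linarith : q ≠ 0)]
  · have e : |u| ^ q = |u| ^ (q - 2) * (u * u) := by
      rw [← abs_mul_abs_self u, ← sq, ← Real.rpow_natCast, ← Real.rpow_add (abs_pos.2 hu)]
      norm_num
    rw [e]; ring

lemma abs_sub_le_of_hasDerivAt {f f' : ℝ → ℝ} {R C : ℝ} (hf : ∀ u, HasDerivAt f (f' u) u)
    (hC : ∀ u, |u| ≤ R → |f' u| ≤ C) {u v : ℝ} (hu : |u| ≤ R) (hv : |v| ≤ R) :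
    |f u - f v| ≤ C * |u - v| :=
  Convex.norm_image_sub_le_of_norm_hasDerivWithin_le (s := Icc (-R) R)
    (fun x _ => (hf x).hasDerivWithinAt) (fun x hx => hC x (abs_le.2 hx)) (convex_Icc _ _)
    (abs_le.1 hv) (abs_le.1 hu)

/-- The jet of order two of a scalar function. -/
abbrev Jet : Type := ℝ × (E3 →L[ℝ] ℝ) × (E3 →L[ℝ] E3 →L[ℝ] ℝ)

/-- The action of the nonlinearity `σ |u|^{p-1} u` on jets of order two. -/
def jetPow (p σ : ℝ) (J : Jet) : Jet :=
  (σ * (|J.1| ^ (p - 1) * J.1), (σ * (p * |J.1| ^ (p - 1))) • J.2.1,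
    (σ * (p * |J.1| ^ (p - 1))) • J.2.2
      + (σ * (p * ((p - 1) * (|J.1| ^ (p - 3) * J.1)))) • J.2.1.smulRight J.2.1)

variable {p σ : ℝ}

lemma hasDerivAt_jetPow_zero (hp : 5 < p) (u : ℝ) :
    HasDerivAt (fun u : ℝ => |u| ^ (p - 1) * u) (p * |u| ^ (p - 1)) u := by
  have := hasDerivAt_abs_rpow_mul (q := p - 1) (by linarith) u
  rwa [sub_add_cancel] at this

lemma hasDerivAt_jetPow_one (hp : 5 < p) (u : ℝ) :
    HasDerivAt (fun u : ℝ => p * |u| ^ (p - 1)) (p * ((p - 1) * (|u| ^ (p - 3) * u))) u := by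
  have := (hasDerivAt_abs_rpow u (p := p - 1) (by linarith)).const_mul p
  refine this.congr_deriv ?_
  rw [show p - 1 - 2 = p - 3 by ring]; ring

/-- The second-order part of the jet of `F(u)` contains `F''(u)`, so Lipschitz dependence on the jet
requires a bound for `F'''`. -/
lemma hasDerivAt_jetPow_two (hp : 5 < p) (u : ℝ) :
    HasDerivAt (fun u : ℝ => p * ((p - 1) * (|u| ^ (p - 3) * u)))
      (p * ((p - 1) * ((p - 2) * |u| ^ (p - 3)))) u := by
  have := ((hasDerivAt_abs_rpow_mul (q := p - 3) (by linarith) u).const_mul (p - 1)).const_mul p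
  refine this.congr_deriv ?_
  rw [show p - 3 + 1 = p - 2 by ring]

lemma continuous_jetPow (hp : 5 < p) (σ : ℝ) : Continuous (jetPow p σ) := by
  have h0 : Continuous fun u : ℝ => |u| ^ (p - 1) * u :=
    continuous_iff_continuousAt.2 fun u => (hasDerivAt_jetPow_zero hp u).continuousAt
  have h1 : Continuous fun u : ℝ => p * |u| ^ (p - 1) :=
    continuous_iff_continuousAt.2 fun u => (hasDerivAt_jetPow_one hp u).continuousAt
  have h2 : Continuous fun u : ℝ => p * ((p - 1) * (|u| ^ (p - 3) * u)) :=
    continuous_iff_continuousAt.2 fun u => (hasDerivAt_jetPow_two hp u).continuousAt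
  have h3 : Continuous fun J : Jet => J.2.1.smulRight J.2.1 :=
    (ContinuousLinearMap.smulRightL ℝ E3 (E3 →L[ℝ] ℝ)).continuous₂.comp
      ((by fun_prop : Continuous fun J : Jet => (J.2.1, J.2.1)))
  have g0 : Continuous fun J : Jet => σ * (|J.1| ^ (p - 1) * J.1) :=
    (h0.comp continuous_fst).const_mul σ
  have g1 : Continuous fun J : Jet => σ * (p * |J.1| ^ (p - 1)) :=
    (h1.comp continuous_fst).const_mul σ
  have g2 : Continuous fun J : Jet => σ * (p * ((p - 1) * (|J.1| ^ (p - 3) * J.1))) :=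
    (h2.comp continuous_fst).const_mul σ
  unfold jetPow
  exact g0.prodMk ((g1.smul (by fun_prop)).prodMk ((g1.smul (by fun_prop)).add (g2.smul h3)))

lemma abs_rpow_le {R q u : ℝ} (hq : 0 ≤ q) (hu : |u| ≤ R) : |u| ^ q ≤ R ^ q :=
  Real.rpow_le_rpow (abs_nonneg u) hu hq

set_option maxHeartbeats 1000000 in
/-- The lift of the power nonlinearity to jets is Lipschitz, with the scaling of degree `p`. -/
lemma norm_jetPow_sub_le (hp : 5 < p) (hσ : |σ| ≤ 1) {R : ℝ} (hR : 0 < R) {a b : Jet}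
    (ha : ‖a‖ ≤ R) (hb : ‖b‖ ≤ R) :
    ‖jetPow p σ a - jetPow p σ b‖ ≤ p ^ 3 * R ^ (p - 1) * ‖a - b‖ := by
  obtain ⟨u, v, w⟩ := a
  obtain ⟨u', v', w'⟩ := b
  simp only [Prod.norm_def, sup_le_iff] at ha hb
  obtain ⟨hu, hv, hw⟩ := ha
  obtain ⟨hu', hv', hw'⟩ := hb
  rw [Real.norm_eq_abs] at hu hu'
  set D := ‖((u, v, w) : Jet) - (u', v', w')‖ with hD
  have hDu : |u - u'| ≤ D := by
    rw [hD]; exact norm_fst_le (((u, v, w) : Jet) - (u', v', w'))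
  have hDs : ‖(v - v', w - w')‖ ≤ D := by
    rw [hD]; exact norm_snd_le (((u, v, w) : Jet) - (u', v', w'))
  have hDv : ‖v - v'‖ ≤ D := (norm_fst_le (v - v', w - w')).trans hDs
  have hDw : ‖w - w'‖ ≤ D := (norm_snd_le (v - v', w - w')).trans hDs
  have hD0 : 0 ≤ D := norm_nonneg _
  have r1 : R ^ (p - 2) * R = R ^ (p - 1) := by
    rw [← Real.rpow_add_one hR.ne']; congr 1; ring
  have r2 : R ^ (p - 3) * R = R ^ (p - 2) := by
    rw [← Real.rpow_add_one hR.ne']; congr 1; ring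
  have rp1 : 0 < R ^ (p - 1) := Real.rpow_pos_of_pos hR _
  have rp2 : 0 < R ^ (p - 2) := Real.rpow_pos_of_pos hR _
  have rp3 : 0 < R ^ (p - 3) := Real.rpow_pos_of_pos hR _
  have q1 : 0 ≤ p := by linarith
  have q2 : 0 ≤ p - 1 := by linarith
  have q3 : 0 ≤ p - 2 := by linarith
  have B1 : ∀ u, |u| ≤ R → |p * |u| ^ (p - 1)| ≤ p * R ^ (p - 1) := by
    intro u hu
    rw [abs_of_nonneg (by positivity)]
    exact mul_le_mul_of_nonneg_left (abs_rpow_le q2 hu) q1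
  have B2 : ∀ u, |u| ≤ R → |p * ((p - 1) * (|u| ^ (p - 3) * u))| ≤ p * (p - 1) * R ^ (p - 2) := by
    intro u hu
    rw [abs_mul, abs_mul, abs_mul, abs_of_nonneg q1, abs_of_nonneg q2,
      abs_of_nonneg (Real.rpow_nonneg (abs_nonneg u) _), ← r2, mul_assoc]
    have := abs_rpow_le (q := p - 3) (by linarith) hu
    gcongr
  have B3 : ∀ u, |u| ≤ R →
      |p * ((p - 1) * ((p - 2) * |u| ^ (p - 3)))| ≤ p * (p - 1) * (p - 2) * R ^ (p - 3) := by
    intro u hu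
    rw [abs_of_nonneg (by positivity)]
    have := abs_rpow_le (q := p - 3) (by linarith) hu
    calc p * ((p - 1) * ((p - 2) * |u| ^ (p - 3))) = p * (p - 1) * (p - 2) * |u| ^ (p - 3) := by ring
      _ ≤ _ := by gcongr
  have L0 := abs_sub_le_of_hasDerivAt (hasDerivAt_jetPow_zero hp) B1 hu hu'
  have L1 := abs_sub_le_of_hasDerivAt (hasDerivAt_jetPow_one hp) B2 hu hu'
  have L2 := abs_sub_le_of_hasDerivAt (hasDerivAt_jetPow_two hp) B3 hu hu'
  have C1 := B1 u hu
  have C2 := B2 u' hu'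
  set F1 := p * |u| ^ (p - 1)
  set F1' := p * |u'| ^ (p - 1)
  set F2 := p * ((p - 1) * (|u| ^ (p - 3) * u))
  set F2' := p * ((p - 1) * (|u'| ^ (p - 3) * u'))
  -- The term `F'(u) • f` occurs with `f` the first and the second derivative, hence the general
  -- space `X`. The constant is `p + p (p - 1) = p²`.
  have hsm : ∀ {X : Type} [NormedAddCommGroup X] [NormedSpace ℝ X] (f f' : X), ‖f'‖ ≤ R →
      ‖f - f'‖ ≤ D → ‖F1 • f - F1' • f'‖ ≤ p ^ 2 * R ^ (p - 1) * D := by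
    intro X _ _ f f' hf' hff
    have e : F1 • f - F1' • f' = F1 • (f - f') + (F1 - F1') • f' := by module
    rw [e]
    refine (norm_add_le _ _).trans ?_
    rw [norm_smul, norm_smul, Real.norm_eq_abs, Real.norm_eq_abs]
    have s1 : |F1| * ‖f - f'‖ ≤ p * R ^ (p - 1) * D := by gcongr
    have s2 : |F1 - F1'| * ‖f'‖ ≤ p * (p - 1) * R ^ (p - 2) * D * R := by
      refine mul_le_mul (L1.trans ?_) hf' (norm_nonneg _) (by positivity)
      gcongr
    have s3 : p * (p - 1) * R ^ (p - 2) * D * R = p * (p - 1) * R ^ (p - 1) * D := by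
      rw [← r1]; ring
    rw [s3] at s2
    nlinarith
  have hq : ‖F2 • v.smulRight v - F2' • v'.smulRight v'‖ ≤ p ^ 2 * (p - 1) * R ^ (p - 1) * D := by
    have e : F2 • v.smulRight v - F2' • v'.smulRight v' = (F2 - F2') • v.smulRight v
        + F2' • ((v - v').smulRight v + v'.smulRight (v - v')) := by
      ext a b
      simp
      ring
    rw [e]
    refine (norm_add_le _ _).trans ?_
    rw [norm_smul, norm_smul, Real.norm_eq_abs, Real.norm_eq_abs]
    have s1 : ‖v.smulRight v‖ ≤ R * R := by
      rw [ContinuousLinearMap.norm_smulRight_apply]; gcongr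
    have s2 : ‖(v - v').smulRight v + v'.smulRight (v - v')‖ ≤ 2 * R * D := by
      refine (norm_add_le _ _).trans ?_
      rw [ContinuousLinearMap.norm_smulRight_apply, ContinuousLinearMap.norm_smulRight_apply]
      have t1 : ‖v - v'‖ * ‖v‖ ≤ D * R := by gcongr
      have t2 : ‖v'‖ * ‖v - v'‖ ≤ R * D := by gcongr
      linarith
    have s3 : |F2 - F2'| * ‖v.smulRight v‖ ≤ p * (p - 1) * (p - 2) * R ^ (p - 3) * D * (R * R) := by
      refine mul_le_mul (L2.trans ?_) s1 (norm_nonneg _) (by positivity)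
      gcongr
    have s4 : |F2'| * ‖(v - v').smulRight v + v'.smulRight (v - v')‖ ≤
        p * (p - 1) * R ^ (p - 2) * (2 * R * D) := by gcongr
    have s5 : p * (p - 1) * (p - 2) * R ^ (p - 3) * D * (R * R)
        = p * (p - 1) * (p - 2) * R ^ (p - 1) * D := by rw [← r1, ← r2]; ring
    have s6 : p * (p - 1) * R ^ (p - 2) * (2 * R * D) = 2 * p * (p - 1) * R ^ (p - 1) * D := by
      rw [← r1]; ring
    rw [s5] at s3
    rw [s6] at s4
    nlinarith
  have hRD : 0 ≤ R ^ (p - 1) * D := by positivity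
  have hp1 : p ≤ p ^ 3 := by nlinarith [sq_nonneg p]
  have hp2 : p ^ 2 ≤ p ^ 3 := by nlinarith [sq_nonneg p]
  have hσ' : ∀ y : ℝ, 0 ≤ y → |σ| * y ≤ y := fun y hy => mul_le_of_le_one_left hy hσ
  refine norm_prod_le_iff.2 ⟨?_, norm_prod_le_iff.2 ⟨?_, ?_⟩⟩
  · change ‖σ * (|u| ^ (p - 1) * u) - σ * (|u'| ^ (p - 1) * u')‖ ≤ _
    rw [← mul_sub, norm_mul, Real.norm_eq_abs, Real.norm_eq_abs]
    refine (hσ' _ (abs_nonneg _)).trans (L0.trans ?_)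
    gcongr
  · change ‖(σ * F1) • v - (σ * F1') • v'‖ ≤ _
    rw [mul_smul σ F1, mul_smul σ F1', ← smul_sub, norm_smul, Real.norm_eq_abs]
    refine (hσ' _ (norm_nonneg _)).trans ((hsm v v' hv' hDv).trans ?_)
    gcongr
  · change ‖(σ * F1) • w + (σ * F2) • v.smulRight v
        - ((σ * F1') • w' + (σ * F2') • v'.smulRight v')‖ ≤ _
    have e : (σ * F1) • w + (σ * F2) • v.smulRight v
        - ((σ * F1') • w' + (σ * F2') • v'.smulRight v') =
        σ • ((F1 • w - F1' • w') + (F2 • v.smulRight v - F2' • v'.smulRight v')) := by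
      simp only [mul_smul, smul_add, smul_sub]
      abel
    rw [e, norm_smul, Real.norm_eq_abs]
    refine (hσ' _ (norm_nonneg _)).trans ((norm_add_le _ _).trans ?_)
    -- The two contributions `p²` and `p² (p - 1)` add up to exactly `p³`.
    have := hsm w w' hw' hDw
    nlinarith

lemma jetPow_zero (hp : 5 < p) : jetPow p σ 0 = 0 := by
  simp [jetPow, Real.zero_rpow (by linarith : p - 1 ≠ 0)]

end Power

/-! ### The contraction on weighted jets. -/

section FixedPoint

variable {p σ : ℝ}

/-- The rescaled components of `J` are the successive derivatives of the scalar component. -/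
def IsJet (δ : ℝ) (J : E3 → Jet) : Prop :=
  ∀ x, HasFDerivAt (fun y => (J y).1) (δ⁻¹ • (J x).2.1) x ∧
    HasFDerivAt (fun y => (J y).2.1) (δ⁻¹ • (J x).2.2) x

lemma IsJet.add {δ : ℝ} {J K : E3 → Jet} (hJ : IsJet δ J) (hK : IsJet δ K) :
    IsJet δ fun x => J x + K x := fun x =>
  ⟨((hJ x).1.add (hK x).1).congr_fderiv (smul_add _ _ _).symm,
    ((hJ x).2.add (hK x).2).congr_fderiv (smul_add _ _ _).symm⟩

/-- Chain and product rule. No `δ` appears in `jetPow`, because each term of a derivative of `F(u)`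
has the same total number of derivatives on its factors `u`, so the rescaling commutes with the
nonlinearity. -/
lemma IsJet.jetPow (hp : 5 < p) {δ : ℝ} {J : E3 → Jet} (hJ : IsJet δ J) :
    IsJet δ fun x => jetPow p σ (J x) := by
  intro x
  obtain ⟨h1, h2⟩ := hJ x
  refine ⟨?_, ?_⟩
  · have := ((hasDerivAt_jetPow_zero hp (J x).1).const_mul σ).comp_hasFDerivAt x h1
    refine this.congr_fderiv ?_
    simp only [ShortPulse.jetPow, smul_smul, mul_comm]
  · have a := ((hasDerivAt_jetPow_one hp (J x).1).const_mul σ).comp_hasFDerivAt x h1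
    have := a.fun_smul h2
    refine this.congr_fderiv ?_
    ext v w
    simp [ShortPulse.jetPow]
    ring

/-- Uniform limits of functions with uniformly convergent derivatives may be differentiated
termwise. This makes the jets a closed subset, so the fixed point is a genuine jet of a `C²`
function in space. -/
lemma IsJet.of_tendsto {δ : ℝ} {J : ℕ → E3 → Jet} {K : E3 → Jet} (hJ : ∀ n, IsJet δ (J n))
    (h : TendstoUniformly J K atTop) : IsJet δ K := by
  intro x
  have h1 : TendstoUniformly (fun n y => (J n y).1) (fun y => (K y).1) atTop :=
    uniformContinuous_fst.comp_tendstoUniformly h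
  have h2 : TendstoUniformly (fun n y => (J n y).2.1) (fun y => (K y).2.1) atTop :=
    (uniformContinuous_fst.comp uniformContinuous_snd).comp_tendstoUniformly h
  have h3 : TendstoUniformly (fun n y => (J n y).2.2) (fun y => (K y).2.2) atTop :=
    (uniformContinuous_snd.comp uniformContinuous_snd).comp_tendstoUniformly h
  exact ⟨hasFDerivAt_of_tendstoUniformly
      ((uniformContinuous_const_smul δ⁻¹).comp_tendstoUniformly h2)
      (fun n y => (hJ n y).1) (fun y => h1.tendsto_at y) x,
    hasFDerivAt_of_tendstoUniformly
      ((uniformContinuous_const_smul δ⁻¹).comp_tendstoUniformly h3)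
      (fun n y => (hJ n y).2) (fun y => h2.tendsto_at y) x⟩

lemma duhamel_const_smul {V : Type*} [NormedAddCommGroup V] [NormedSpace ℝ V] [CompleteSpace V]
    {G : ℝ → E3 → V} (hG : Continuous (Function.uncurry G)) (c t : ℝ) (x : E3) :
    duhamel (fun s y => c • G s y) t x = c • duhamel G t x :=
  (duhamel_clm (c • ContinuousLinearMap.id ℝ V) hG t x).symm

lemma IsJet.duhamel {δ : ℝ} {G : ℝ → E3 → Jet} (hG : Continuous (Function.uncurry G))
    (hJ : ∀ s, IsJet δ (G s)) (t : ℝ) : IsJet δ (duhamel G t) := by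
  intro x
  have c1 : Continuous (Function.uncurry fun s y => (G s y).1) := continuous_fst.comp hG
  have c2 : Continuous (Function.uncurry fun s y => (G s y).2.1) :=
    (continuous_fst.comp continuous_snd).comp hG
  have c3 : Continuous (Function.uncurry fun s y => (G s y).2.2) :=
    (continuous_snd.comp continuous_snd).comp hG
  have e1 : ∀ y, (ShortPulse.duhamel G t y).1 = ShortPulse.duhamel (fun s y => (G s y).1) t y :=
    fun y => duhamel_clm (ContinuousLinearMap.fst ℝ ℝ ((E3 →L[ℝ] ℝ) × (E3 →L[ℝ] E3 →L[ℝ] ℝ))) hG t y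
  have e2 : ∀ y, (ShortPulse.duhamel G t y).2.1 = ShortPulse.duhamel (fun s y => (G s y).2.1) t y :=
    fun y => duhamel_clm ((ContinuousLinearMap.fst ℝ (E3 →L[ℝ] ℝ) (E3 →L[ℝ] E3 →L[ℝ] ℝ)).comp
      (ContinuousLinearMap.snd ℝ ℝ ((E3 →L[ℝ] ℝ) × (E3 →L[ℝ] E3 →L[ℝ] ℝ)))) hG t y
  have e3 : ∀ y, (ShortPulse.duhamel G t y).2.2 = ShortPulse.duhamel (fun s y => (G s y).2.2) t y :=
    fun y => duhamel_clm ((ContinuousLinearMap.snd ℝ (E3 →L[ℝ] ℝ) (E3 →L[ℝ] E3 →L[ℝ] ℝ)).comp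
      (ContinuousLinearMap.snd ℝ ℝ ((E3 →L[ℝ] ℝ) × (E3 →L[ℝ] E3 →L[ℝ] ℝ)))) hG t y
  simp only [e1, e2, e3, ← duhamel_const_smul c2, ← duhamel_const_smul c3]
  exact ⟨hasFDerivAt_duhamel (fun s y => (hJ s y).1) c1
      (c2.const_smul δ⁻¹ :) t x,
    hasFDerivAt_duhamel (fun s y => (hJ s y).2) c2
      (c3.const_smul δ⁻¹ :) t x⟩

lemma wt_quarter_le_one (ε : ℝ) (x : E3) : wt (1 / 4) ε x ≤ 1 :=
  Real.rpow_le_one_of_one_le_of_nonpos (one_le_base ε x) (by norm_num)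

/-- The `p`-th power of the solution weight has exponent `p/4 ≥ 5/4`, and the base is at least `1`;
so the nonlinearity decays fast enough for the Duhamel estimate. -/
lemma wt_quarter_rpow_le (hp : 5 < p) (ε : ℝ) (x : E3) :
    wt (1 / 4) ε x ^ (p - 1) * wt (1 / 4) ε x ≤ wt (5 / 4) ε x := by
  have hb := one_le_base ε x
  have h0 : (0 : ℝ) < 1 + ε ^ 2 * ‖x‖ ^ 2 := by linarith
  rw [← Real.rpow_add_one (wt_pos _ ε x).ne', wt, wt, ← Real.rpow_mul h0.le]
  exact Real.rpow_le_rpow_of_exponent_le hb (by linarith)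

lemma norm_jetPow_sub_le_wt (hp : 5 < p) (hσ : |σ| ≤ 1) {R D ε : ℝ} (hR : 0 < R) (hD : 0 ≤ D)
    {x : E3} {a b : Jet} (ha : ‖a‖ ≤ R * wt (1 / 4) ε x) (hb : ‖b‖ ≤ R * wt (1 / 4) ε x)
    (hab : ‖a - b‖ ≤ D * wt (1 / 4) ε x) :
    ‖jetPow p σ a - jetPow p σ b‖ ≤ p ^ 3 * R ^ (p - 1) * D * wt (5 / 4) ε x := by
  have hW := wt_pos (1 / 4) ε x
  have hR' : 0 ≤ R ^ (p - 1) := Real.rpow_nonneg hR.le _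
  calc _ ≤ p ^ 3 * (R * wt (1 / 4) ε x) ^ (p - 1) * ‖a - b‖ :=
        norm_jetPow_sub_le hp hσ (by positivity) ha hb
    _ ≤ p ^ 3 * (R * wt (1 / 4) ε x) ^ (p - 1) * (D * wt (1 / 4) ε x) := by
        gcongr
    _ = p ^ 3 * R ^ (p - 1) * D * (wt (1 / 4) ε x ^ (p - 1) * wt (1 / 4) ε x) := by
        rw [Real.mul_rpow hR.le hW.le]; ring
    _ ≤ _ := by
        gcongr
        exact wt_quarter_rpow_le hp ε x

open BoundedContinuousFunction in
/-- The weighted jet field of a bounded function. -/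
def unweight (ε : ℝ) (f : (ℝ × E3) →ᵇ Jet) (t : ℝ) (x : E3) : Jet := wt (1 / 4) ε x • f (t, x)

open BoundedContinuousFunction in
lemma continuous_unweight (ε : ℝ) (f : (ℝ × E3) →ᵇ Jet) :
    Continuous (Function.uncurry (unweight ε f)) :=
  ((continuous_wt (1 / 4) ε).comp continuous_snd).smul (f.continuous)

open BoundedContinuousFunction in
lemma norm_unweight_le {ε R : ℝ} {f : (ℝ × E3) →ᵇ Jet} (hf : ‖f‖ ≤ R) (t : ℝ) (x : E3) :
    ‖unweight ε f t x‖ ≤ R * wt (1 / 4) ε x := by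
  have hW := wt_pos (1 / 4) ε x
  rw [unweight, norm_smul, Real.norm_of_nonneg hW.le, mul_comm]
  gcongr
  exact (f.norm_coe_le_norm _).trans hf

open BoundedContinuousFunction in
lemma norm_unweight_sub_le {ε : ℝ} (f g : (ℝ × E3) →ᵇ Jet) (t : ℝ) (x : E3) :
    ‖unweight ε f t x - unweight ε g t x‖ ≤ dist f g * wt (1 / 4) ε x := by
  have hW := wt_pos (1 / 4) ε x
  rw [unweight, unweight, ← smul_sub, norm_smul, Real.norm_of_nonneg hW.le, mul_comm,
    ← dist_eq_norm]
  gcongr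
  exact dist_coe_le_dist _

lemma duhamel_sub {V : Type*} [NormedAddCommGroup V] [NormedSpace ℝ V] [CompleteSpace V]
    {G K : ℝ → E3 → V} (hG : Continuous (Function.uncurry G))
    (hK : Continuous (Function.uncurry K)) (t : ℝ) (x : E3) :
    duhamel (fun s y => G s y - K s y) t x = duhamel G t x - duhamel K t x := by
  have h := duhamel_clm (ContinuousLinearMap.fst ℝ V V)
    (G := fun s y => (G s y, K s y)) (hG.prodMk hK) t x
  have h' := duhamel_clm (ContinuousLinearMap.snd ℝ V V)
    (G := fun s y => (G s y, K s y)) (hG.prodMk hK) t x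
  have h'' := duhamel_clm (ContinuousLinearMap.fst ℝ V V - ContinuousLinearMap.snd ℝ V V)
    (G := fun s y => (G s y, K s y)) (hG.prodMk hK) t x
  simp only [_root_.sub_apply, ContinuousLinearMap.coe_fst',
    ContinuousLinearMap.coe_snd'] at h h' h''
  rw [← h'']
  exact congrArg₂ (· - ·) h h'

open BoundedContinuousFunction in
/-- Contraction in the space of weighted jets: the integral equation
`J = Jl + duhamel (jetPow J)` is solvable for small data. -/
lemma exists_jet_solution (hp : 5 < p) (hσ : |σ| ≤ 1) {ε A δ : ℝ} (hε : 0 < ε) (hA : 0 < A)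
    (hsmall : 4 / ε ^ 2 * (p ^ 3 * (2 * A) ^ (p - 1)) ≤ 1 / 2) {Jl : ℝ → E3 → Jet}
    (hc : Continuous (Function.uncurry Jl)) (hJ : ∀ t, IsJet δ (Jl t))
    (hb : ∀ t x, 0 ≤ t → ‖Jl t x‖ ≤ A * wt (1 / 4) ε x) :
    ∃ J : ℝ → E3 → Jet, Continuous (Function.uncurry J) ∧ (∀ t, IsJet δ (J t)) ∧
      ∀ t x, 0 ≤ t → J t x = Jl t x + duhamel (fun s y => jetPow p σ (J s y)) t x := by
  set R := 2 * A with hR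
  have hR0 : 0 < R := by positivity
  -- The ball has twice the radius `A` of the free part; the Duhamel term gets the other half.
  set s : Set ((ℝ × E3) →ᵇ Jet) := {f | ‖f‖ ≤ R ∧ ∀ t, IsJet δ (unweight ε f t)} with hs
  have hclosed : IsClosed s := by
    refine IsSeqClosed.isClosed fun f g hf hg => ⟨?_, fun t => ?_⟩
    · exact le_of_tendsto hg.norm (Eventually.of_forall fun n => (hf n).1)
    · refine IsJet.of_tendsto (fun n => (hf n).2 t) ?_
      rw [Metric.tendstoUniformly_iff]
      intro η hη
      filter_upwards [(Metric.tendsto_nhds.1 hg) η hη] with n hn x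
      rw [dist_eq_norm]
      calc _ ≤ dist g (f n) * wt (1 / 4) ε x := norm_unweight_sub_le _ _ _ _
        _ ≤ dist g (f n) * 1 := by gcongr; exact wt_quarter_le_one ε x
        _ < η := by rwa [mul_one, dist_comm]
  have hN : ∀ f : (ℝ × E3) →ᵇ Jet,
      Continuous (Function.uncurry fun t y => jetPow p σ (unweight ε f t y)) :=
    fun f => (continuous_jetPow hp σ).comp (continuous_unweight ε f)
  have hcs : p ^ 3 * R ^ (p - 1) * 4 / ε ^ 2 ≤ 1 / 2 := by
    refine le_trans (le_of_eq ?_) hsmall; ring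
  have hP : 0 ≤ p ^ 3 * R ^ (p - 1) := by positivity
  have hdiff : ∀ f ∈ s, ∀ g ∈ s, ∀ t x, 0 ≤ t →
      ‖duhamel (fun s y => jetPow p σ (unweight ε f s y)) t x
        - duhamel (fun s y => jetPow p σ (unweight ε g s y)) t x‖
        ≤ 1 / 2 * dist f g * wt (1 / 4) ε x := by
    intro f hf g hg t x ht
    rw [← duhamel_sub (hN f) (hN g)]
    refine (norm_duhamel_le hε (A := p ^ 3 * R ^ (p - 1) * dist f g) (by positivity)
      (fun t y => norm_jetPow_sub_le_wt hp hσ hR0 dist_nonneg (norm_unweight_le hf.1 t y)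
        (norm_unweight_le hg.1 t y) (norm_unweight_sub_le f g t y)) ht x).trans ?_
    have hW := wt_pos (1 / 4) ε x
    gcongr
    calc p ^ 3 * R ^ (p - 1) * dist f g * 4 / ε ^ 2
        = p ^ 3 * R ^ (p - 1) * 4 / ε ^ 2 * dist f g := by ring
      _ ≤ _ := by gcongr
  have h0 : (0 : (ℝ × E3) →ᵇ Jet) ∈ s := by
    refine ⟨by simpa using hR0.le, fun t x => ?_⟩
    simp only [unweight, BoundedContinuousFunction.coe_zero, Pi.zero_apply, smul_zero, Prod.fst_zero,
      Prod.snd_zero]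
    exact ⟨hasFDerivAt_const _ _, hasFDerivAt_const _ _⟩
  have hzero : ∀ t x, duhamel (fun s y => jetPow p σ (unweight ε 0 s y)) t x = 0 := by
    intro t x
    have : (fun (s : ℝ) (y : E3) => jetPow p σ (unweight ε 0 s y)) = fun s y => 0 := by
      ext1 s; ext1 y; simp [unweight, jetPow_zero hp]
    rw [this]
    simp [duhamel, kir, sphMean]
  -- The function space lives on all times, but the estimates hold only for `t ≥ 0`; the image is
  -- frozen at its initial value for negative times by evaluating at `max t 0`.
  have hex : ∀ f : s, ∃ g : s, ∀ t x, unweight ε g t x =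
      Jl (max t 0) x + duhamel (fun s y => jetPow p σ (unweight ε f s y)) (max t 0) x := by
    intro f
    set H : ℝ → E3 → Jet := fun t x =>
      Jl (max t 0) x + duhamel (fun s y => jetPow p σ (unweight ε f s y)) (max t 0) x with hH
    have hHc : Continuous (Function.uncurry H) := by
      have hm : Continuous fun z : ℝ × E3 => (max z.1 0, z.2) := by fun_prop
      exact (hc.comp hm).add ((continuous_duhamel (hN f)).comp hm)
    have hHb : ∀ t x, ‖H t x‖ ≤ R * wt (1 / 4) ε x := by
      intro t x
      have h1 := hb (max t 0) x (le_max_right _ _)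
      -- Comparison with the zero field, on which the Duhamel term vanishes, turns the contraction
      -- estimate into the bound needed for invariance of the ball.
      have h2 := hdiff f f.2 0 h0 (max t 0) x (le_max_right _ _)
      rw [hzero, sub_zero, dist_zero_right] at h2
      have hW := wt_pos (1 / 4) ε x
      have h3 : 1 / 2 * ‖(f : (ℝ × E3) →ᵇ Jet)‖ * wt (1 / 4) ε x ≤ 1 / 2 * R * wt (1 / 4) ε x := by
        gcongr; exact f.2.1
      refine (norm_add_le _ _).trans ((add_le_add h1 (h2.trans h3)).trans (le_of_eq ?_))
      rw [hR]; ring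
    have hWc : Continuous fun z : ℝ × E3 => (wt (1 / 4) ε z.2)⁻¹ • H z.1 z.2 :=
      (((continuous_wt (1 / 4) ε).comp continuous_snd).inv₀ fun z => (wt_pos _ ε z.2).ne').smul hHc
    have hWb : ∀ z : ℝ × E3, ‖(wt (1 / 4) ε z.2)⁻¹ • H z.1 z.2‖ ≤ R := by
      intro z
      have hW := wt_pos (1 / 4) ε z.2
      rw [norm_smul, norm_inv, Real.norm_of_nonneg hW.le, inv_mul_le_iff₀ hW, mul_comm]
      exact hHb _ _
    have hu : ∀ t x, unweight ε (BoundedContinuousFunction.ofNormedAddCommGroup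
        (fun z : ℝ × E3 => (wt (1 / 4) ε z.2)⁻¹ • H z.1 z.2) hWc R hWb) t x = H t x := fun t x =>
      smul_inv_smul₀ (wt_pos _ ε x).ne' _
    refine ⟨⟨BoundedContinuousFunction.ofNormedAddCommGroup _ hWc R hWb, ?_, fun t => ?_⟩, hu⟩
    · exact BoundedContinuousFunction.norm_ofNormedAddCommGroup_le _ hR0.le hWb
    · rw [show unweight ε _ t = H t from funext (hu t)]
      exact (hJ _).add (IsJet.duhamel (hN f) (fun s => (f.2.2 s).jetPow hp) _)
  choose T hT using hex
  have hcw : ContractingWith (1 / 2) T := by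
    refine ⟨by norm_num, LipschitzWith.of_dist_le_mul fun f g => ?_⟩
    rw [Subtype.dist_eq, Subtype.dist_eq, BoundedContinuousFunction.dist_le (by positivity)]
    rintro ⟨t, x⟩
    have hW := wt_pos (1 / 4) ε x
    have h := hdiff f f.2 g g.2 (max t 0) x (le_max_right _ _)
    rw [dist_eq_norm]
    have e := hT f t x
    have e' := hT g t x
    have e2 : unweight ε (T f) t x - unweight ε (T g) t x =
        duhamel (fun s y => jetPow p σ (unweight ε f s y)) (max t 0) x
        - duhamel (fun s y => jetPow p σ (unweight ε g s y)) (max t 0) x := by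
      rw [e, e']; abel
    rw [← e2, unweight, unweight, ← smul_sub, norm_smul, Real.norm_of_nonneg hW.le, mul_comm] at h
    have h2 := le_of_mul_le_mul_right h hW
    simpa using h2
  have : CompleteSpace s := hclosed.completeSpace_coe
  have : Nonempty s := ⟨⟨0, h0⟩⟩
  set f := ContractingWith.fixedPoint T hcw
  have hf : T f = f := hcw.fixedPoint_isFixedPt
  refine ⟨unweight ε f, continuous_unweight ε f, f.2.2, fun t x ht => ?_⟩
  have := hT f t x
  rwa [hf, max_eq_left ht] at this

end FixedPoint

/-! ### Global solutions from small free evolutions. -/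

section Global

variable {p σ : ℝ}

lemma contDiffAt_time_slice {φ : ℝ → E3 → ℝ} {t : ℝ} {x : E3}
    (h : ContDiffAt ℝ 2 (fun z : ℝ × E3 => φ z.1 z.2) (t, x)) : ContDiffAt ℝ 2 (fun s => φ s x) t :=
  ContDiffAt.comp (g := fun z : ℝ × E3 => φ z.1 z.2) (f := fun s : ℝ => (s, x)) t h (by fun_prop)

lemma contDiffAt_space_slice {φ : ℝ → E3 → ℝ} {t : ℝ} {x : E3}
    (h : ContDiffAt ℝ 2 (fun z : ℝ × E3 => φ z.1 z.2) (t, x)) : ContDiffAt ℝ 2 (φ t) x :=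
  ContDiffAt.comp (g := fun z : ℝ × E3 => φ z.1 z.2) (f := fun y : E3 => (t, y)) x h (by fun_prop)

lemma deriv_deriv_eq (f : ℝ → ℝ) : deriv (deriv f) = iteratedDeriv 2 f := by
  rw [iteratedDeriv_succ, iteratedDeriv_one]

lemma negBox_add {φ ψ : ℝ → E3 → ℝ} {t : ℝ} {x : E3}
    (hφ : ContDiffAt ℝ 2 (fun z : ℝ × E3 => φ z.1 z.2) (t, x))
    (hψ : ContDiffAt ℝ 2 (fun z : ℝ × E3 => ψ z.1 z.2) (t, x)) :
    negBox (fun s y => φ s y + ψ s y) t x = negBox φ t x + negBox ψ t x := by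
  have h1 : iteratedDeriv 2 (fun s => φ s x + ψ s x) t = _ :=
    iteratedDeriv_add (contDiffAt_time_slice hφ) (contDiffAt_time_slice hψ)
  have h2 : Laplacian.laplacian (fun y => φ t y + ψ t y) x = _ :=
    (contDiffAt_space_slice hφ).laplacian_add (contDiffAt_space_slice hψ)
  simp only [negBox, deriv_deriv_eq, h1, h2]
  ring

lemma negBox_sub {φ ψ : ℝ → E3 → ℝ} {t : ℝ} {x : E3}
    (hφ : ContDiffAt ℝ 2 (fun z : ℝ × E3 => φ z.1 z.2) (t, x))
    (hψ : ContDiffAt ℝ 2 (fun z : ℝ × E3 => ψ z.1 z.2) (t, x)) :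
    negBox (fun s y => φ s y - ψ s y) t x = negBox φ t x - negBox ψ t x := by
  have h1 : iteratedDeriv 2 (fun s => φ s x - ψ s x) t = _ :=
    iteratedDeriv_sub (contDiffAt_time_slice hφ) (contDiffAt_time_slice hψ)
  have h2 : Laplacian.laplacian (fun y => φ t y - ψ t y) x = _ :=
    (contDiffAt_space_slice hφ).laplacian_sub (contDiffAt_space_slice hψ)
  simp only [negBox, deriv_deriv_eq, h1, h2]
  ring

/-- The loss `ε⁻²` of the Duhamel estimate against the gain `(ε^{1/2})^{p-1}` leaves `ε^{(p-5)/2}`,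
a positive power because `p > 5`. -/
lemma exists_small_eps (hp : 5 < p) {C : ℝ} (hC : 0 < C) : ∃ ε₀ : ℝ, 0 < ε₀ ∧ ∀ ε, 0 < ε → ε < ε₀ →
    4 / ε ^ 2 * (p ^ 3 * (2 * (C * ε ^ (1 / 2 : ℝ))) ^ (p - 1)) ≤ 1 / 2 := by
  have ht : Tendsto (fun ε : ℝ => 4 * p ^ 3 * (2 * C) ^ (p - 1) * ε ^ ((p - 5) / 2)) (𝓝[>] 0) (𝓝 0) := by
    have h1 : Tendsto (fun ε : ℝ => ε ^ ((p - 5) / 2)) (𝓝 0) (𝓝 0) := by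
      have := (Real.continuous_rpow_const (q := (p - 5) / 2) (by linarith)).tendsto 0
      rwa [Real.zero_rpow (by linarith)] at this
    simpa using (h1.const_mul (4 * p ^ 3 * (2 * C) ^ (p - 1))).mono_left nhdsWithin_le_nhds
  have := ht.eventually (Iio_mem_nhds (show (0 : ℝ) < 1 / 2 by norm_num))
  rw [eventually_nhdsWithin_iff, Metric.eventually_nhds_iff] at this
  obtain ⟨ε₀, h0, h⟩ := this
  refine ⟨ε₀, h0, fun ε hε hlt => ?_⟩
  have := h (y := ε) (by rwa [dist_zero_right, Real.norm_of_nonneg hε.le]) hε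
  refine le_trans (le_of_eq ?_) (le_of_lt this)
  rw [← mul_assoc 2 C, Real.mul_rpow (by positivity) (by positivity), ← Real.rpow_mul hε.le]
  have e : ε ^ (1 / 2 * (p - 1)) = ε ^ ((p - 5) / 2) * ε ^ 2 := by
    rw [← Real.rpow_natCast, ← Real.rpow_add hε]
    congr 1; push_cast; ring
  rw [e]; field_simp

/-- Global solvability for data whose free evolution is small in the weighted supremum norm. -/
lemma exists_global_solution (hp : 5 < p) (hσ : |σ| ≤ 1) {C₀ : ℝ} (hC₀ : 0 < C₀) :
    ∃ ε₀ : ℝ, 0 < ε₀ ∧ ∀ ε, 0 < ε → ε < ε₀ →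
    ∀ {u : E3 → ℝ} {u' : E3 → E3 →L[ℝ] ℝ} {u'' : E3 → E3 →L[ℝ] E3 →L[ℝ] ℝ}
      {u''' : E3 → E3 →L[ℝ] E3 →L[ℝ] E3 →L[ℝ] ℝ}
      {v : E3 → ℝ} {v' : E3 → E3 →L[ℝ] ℝ} {v'' : E3 → E3 →L[ℝ] E3 →L[ℝ] ℝ},
      (∀ y, HasFDerivAt u (u' y) y) → (∀ y, HasFDerivAt u' (u'' y) y) →
      (∀ y, HasFDerivAt u'' (u''' y) y) → Continuous u''' → (∀ y, HasFDerivAt v (v' y) y) →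
      (∀ y, HasFDerivAt v' (v'' y) y) → Continuous v'' →
      (∀ t x, 0 ≤ t → |freeWave u u' v t x| ≤ C₀ * ε ^ (1 / 2 : ℝ) * wt (1 / 4) ε x) →
      (∃ C, ∀ t x, 0 ≤ t → ‖freeWave u' u'' v' t x‖ ≤ C * wt (1 / 4) ε x) →
      (∃ C, ∀ t x, 0 ≤ t → ‖freeWave u'' u''' v'' t x‖ ≤ C * wt (1 / 4) ε x) →
      ∃ Ψ : ℝ → E3 → ℝ, ContDiff ℝ 2 (fun z : ℝ × E3 => Ψ z.1 z.2) ∧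
        (∀ t x, 0 ≤ t → negBox Ψ t x = σ * (|Ψ t x| ^ (p - 1) * Ψ t x)) ∧
        (∀ x, Ψ 0 x = u x) ∧ ∀ x, HasDerivAt (fun t => Ψ t x) (v x) 0 := by
  obtain ⟨ε₀, h0, hsm⟩ := exists_small_eps hp hC₀
  refine ⟨ε₀, h0, ?_⟩
  intro ε hε hlt u u' u'' u''' v v' v'' hu hu2 hu3 hu''' hv hv2 hv'' hb0 ⟨C1, hb1⟩ ⟨C2, hb2⟩
  have cu'' := continuous_of_hasFDerivAt hu3
  have cu' := continuous_of_hasFDerivAt hu2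
  have cu := continuous_of_hasFDerivAt hu
  have cv' := continuous_of_hasFDerivAt hv2
  have cv := continuous_of_hasFDerivAt hv
  set A := C₀ * ε ^ (1 / 2 : ℝ) with hA
  have hA0 : 0 < A := by positivity
  -- The derivatives of the free wave are merely bounded, with constants that need not be small.
  -- Scaling them by `δ` puts the whole jet into the ball of radius `A` without affecting the
  -- threshold `ε₀`.
  obtain ⟨δ, hδ, hδ1, hδ2⟩ : ∃ δ : ℝ, 0 < δ ∧ δ * |C1| ≤ A ∧ δ ^ 2 * |C2| ≤ A := by
    refine ⟨min 1 (A / (1 + |C1| + |C2|)), by positivity, ?_, ?_⟩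
    · calc _ ≤ A / (1 + |C1| + |C2|) * |C1| := by gcongr; exact min_le_right _ _
        _ ≤ A := by
          rw [div_mul_eq_mul_div, div_le_iff₀ (by positivity)]
          gcongr
          linarith [abs_nonneg C2]
    · set d := min 1 (A / (1 + |C1| + |C2|))
      have hd : d ^ 2 ≤ d := by
        have : 0 ≤ d := by positivity
        have : d ≤ 1 := min_le_left _ _
        nlinarith
      calc _ ≤ A / (1 + |C1| + |C2|) * |C2| := by gcongr; exact hd.trans (min_le_right _ _)
        _ ≤ A := by
          rw [div_mul_eq_mul_div, div_le_iff₀ (by positivity)]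
          gcongr
          linarith [abs_nonneg C1]
  set Jl : ℝ → E3 → Jet := fun t x =>
    (freeWave u u' v t x, δ • freeWave u' u'' v' t x, δ ^ 2 • freeWave u'' u''' v'' t x) with hJl
  have hc : Continuous (Function.uncurry Jl) :=
    (continuous_freeWave cu cu' cv).prodMk
      (((continuous_freeWave cu' cu'' cv').const_smul δ).prodMk
        ((continuous_freeWave cu'' hu''' hv'').const_smul (δ ^ 2)))
  have hjet : ∀ t, IsJet δ (Jl t) := by
    intro t x
    refine ⟨(hasFDerivAt_freeWave hu hu2 cu'' hv cv' t x).congr_fderiv ?_,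
      ((hasFDerivAt_freeWave hu2 hu3 hu''' hv2 hv'' t x).fun_const_smul δ).congr_fderiv ?_⟩
    · rw [hJl]; exact (inv_smul_smul₀ hδ.ne' _).symm
    · rw [hJl]; simp only [smul_smul]; congr 1; field_simp
  have hbd : ∀ t x, 0 ≤ t → ‖Jl t x‖ ≤ A * wt (1 / 4) ε x := by
    intro t x ht
    have hW := wt_pos (1 / 4) ε x
    refine norm_prod_le_iff.2 ⟨hb0 t x ht, norm_prod_le_iff.2 ⟨?_, ?_⟩⟩
    · change ‖δ • freeWave u' u'' v' t x‖ ≤ _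
      rw [norm_smul, Real.norm_of_nonneg hδ.le]
      calc _ ≤ δ * (|C1| * wt (1 / 4) ε x) := by
            gcongr; exact (hb1 t x ht).trans (by gcongr; exact le_abs_self _)
        _ = δ * |C1| * wt (1 / 4) ε x := by ring
        _ ≤ _ := by gcongr
    · change ‖δ ^ 2 • freeWave u'' u''' v'' t x‖ ≤ _
      rw [norm_smul, Real.norm_of_nonneg (by positivity)]
      calc _ ≤ δ ^ 2 * (|C2| * wt (1 / 4) ε x) := by
            gcongr; exact (hb2 t x ht).trans (by gcongr; exact le_abs_self _)
        _ = δ ^ 2 * |C2| * wt (1 / 4) ε x := by ring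
        _ ≤ _ := by gcongr
  obtain ⟨J, hJc, hJj, hJe⟩ := exists_jet_solution hp hσ hε hA0 (hsm ε hε hlt) hc hjet hbd
  have hNc : Continuous (Function.uncurry fun s y => jetPow p σ (J s y)) :=
    (continuous_jetPow hp σ).comp hJc
  set G : ℝ → E3 → ℝ := fun s y => (jetPow p σ (J s y)).1 with hG
  set G' : ℝ → E3 → E3 →L[ℝ] ℝ := fun s y => δ⁻¹ • (jetPow p σ (J s y)).2.1 with hG'
  set G'' : ℝ → E3 → E3 →L[ℝ] E3 →L[ℝ] ℝ :=
    fun s y => δ⁻¹ • δ⁻¹ • (jetPow p σ (J s y)).2.2 with hG''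
  have cG : Continuous (Function.uncurry G) := continuous_fst.comp hNc
  have cG' : Continuous (Function.uncurry G') :=
    ((continuous_fst.comp continuous_snd).comp hNc).const_smul δ⁻¹
  have cG'' : Continuous (Function.uncurry G'') :=
    (((continuous_snd.comp continuous_snd).comp hNc).const_smul δ⁻¹).const_smul δ⁻¹
  have dG : ∀ s y, HasFDerivAt (G s) (G' s y) y := fun s y => ((hJj s).jetPow hp y).1
  have dG' : ∀ s y, HasFDerivAt (G' s) (G'' s y) y := fun s y =>
    ((hJj s).jetPow hp y).2.fun_const_smul δ⁻¹
  have C2f := contDiff_two_freeWave hu hu2 hu3 hu''' hv hv2 hv''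
  have C2d := contDiff_duhamel dG dG' cG cG' cG''
  -- The left side is `C²` in space and time on the whole of `ℝ × E3`, which the fixed point need
  -- not be. They agree for `t ≥ 0`, which suffices for the equation.
  have hval : ∀ t x, 0 ≤ t → freeWave u u' v t x + duhamel G t x = (J t x).1 := by
    intro t x ht
    have h := congrArg Prod.fst (hJe t x ht)
    have e := duhamel_clm (ContinuousLinearMap.fst ℝ ℝ ((E3 →L[ℝ] ℝ) × (E3 →L[ℝ] E3 →L[ℝ] ℝ)))
      hNc t x
    rw [h]
    exact congrArg (freeWave u u' v t x + ·) e.symm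
  refine ⟨fun t x => freeWave u u' v t x + duhamel G t x, C2f.add C2d, fun t x ht => ?_,
    fun x => ?_, fun x => ?_⟩
  · beta_reduce
    rw [negBox_add C2f.contDiffAt C2d.contDiffAt, negBox_freeWave hu hu2 hu3 hu''' hv hv2 hv'',
      negBox_duhamel dG dG' cG cG' cG'', hval t x ht, zero_add]
    rfl
  · beta_reduce
    rw [freeWave_zero]; simp [duhamel]
  · refine ((hasDerivAt_freeWave hu hu2 cu'' hv cv' 0 x).add
      (hasDerivAt_duhamel dG cG cG' 0 x)).congr_deriv ?_
    rw [freeWave_zero]; simp [duhamelD]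

end Global

/-! ### Calculus of multi-indices and iterated partial derivatives. -/

section MultiIndices

/-- The unit multi-index in direction `a`. -/
abbrev unitIndex (a : Fin 3) : MultiIndex := Pi.single a 1

lemma order_add (I J : MultiIndex) : order (I + J) = order I + order J := by
  simp [order, Finset.sum_add_distrib]

lemma order_unitIndex (a : Fin 3) : order (unitIndex a) = 1 := by simp [order]

lemma order_add_unitIndex (I : MultiIndex) (a : Fin 3) : order (I + unitIndex a) = order I + 1 := by
  rw [order_add, order_unitIndex]

lemma order_zero : order 0 = 0 := by simp [order]

lemma mem_multiIndicesOfOrder {m : ℕ} {I : MultiIndex} :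
    I ∈ multiIndicesOfOrder m ↔ order I = m := by
  simp [multiIndicesOfOrder, order]

lemma mem_multiIndicesUpTo {n : ℕ} {I : MultiIndex} : I ∈ multiIndicesUpTo n ↔ order I ≤ n := by
  simp [multiIndicesUpTo, mem_multiIndicesOfOrder]

lemma contDiff_partialDeriv {n : ℕ} {f : E3 → ℝ} (hf : ContDiff ℝ (n + 1 : ℕ) f) (a : Fin 3) :
    ContDiff ℝ n (partialDeriv a f) :=
  (hf.fderiv_right (m := n) (by norm_cast)).clm_apply contDiff_const

lemma contDiff_partialDeriv_iterate {n m : ℕ} {f : E3 → ℝ} (hf : ContDiff ℝ (n + m : ℕ) f)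
    (a : Fin 3) : ContDiff ℝ n ((partialDeriv a)^[m] f) := by
  induction m generalizing n with
  | zero => simpa using hf
  | succ m ih =>
    rw [Function.iterate_succ_apply']
    refine contDiff_partialDeriv (ih (n := n + 1) ?_) a
    convert hf using 2
    omega

lemma partialDeriv_comm {f : E3 → ℝ} (hf : ContDiff ℝ (2 : ℕ) f) (a b : Fin 3) :
    partialDeriv a (partialDeriv b f) = partialDeriv b (partialDeriv a f) := by
  have hd : Differentiable ℝ (fderiv ℝ f) :=
    (hf.fderiv_right (m := 1) (by norm_num)).differentiable (by norm_num)
  have key : ∀ c d : Fin 3, ∀ x, partialDeriv c (partialDeriv d f) x =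
      fderiv ℝ (fderiv ℝ f) x (EuclideanSpace.single c 1) (EuclideanSpace.single d 1) := by
    intro c d x
    unfold partialDeriv
    rw [fderiv_clm_apply (hd x) (differentiableAt_const _)]
    simp
  ext x
  rw [key, key]
  exact (hf.contDiffAt (x := x)).isSymmSndFDerivAt (by simp) _ _

lemma partialDeriv_iterate_comm {m : ℕ} {f : E3 → ℝ} (hf : ContDiff ℝ (m + 1 : ℕ) f)
    (a b : Fin 3) : partialDeriv b ((partialDeriv a)^[m] f) = (partialDeriv a)^[m] (partialDeriv b f) := by
  induction m with
  | zero => rfl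
  | succ m ih =>
    rw [Function.iterate_succ_apply', Function.iterate_succ_apply', ← ih (hf.of_le (by norm_cast; omega))]
    refine partialDeriv_comm (contDiff_partialDeriv_iterate ?_ a) b a
    convert hf using 2
    omega

lemma order_eq (I : MultiIndex) : order I = I 0 + I 1 + I 2 := by
  simp [order, Fin.sum_univ_three]

lemma contDiff_multiDeriv {n : ℕ} {I : MultiIndex} {f : E3 → ℝ}
    (hf : ContDiff ℝ (n + order I : ℕ) f) : ContDiff ℝ n (multiDeriv I f) := by
  rw [order_eq] at hf
  refine contDiff_partialDeriv_iterate (contDiff_partialDeriv_iterate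
    (contDiff_partialDeriv_iterate ?_ 2) 1) 0
  convert hf using 2
  omega

lemma partialDeriv_multiDeriv_comm {I : MultiIndex} {f : E3 → ℝ}
    (hf : ContDiff ℝ (order I + 1 : ℕ) f) (a : Fin 3) :
    partialDeriv a (multiDeriv I f) = multiDeriv I (partialDeriv a f) := by
  rw [order_eq] at hf
  have h2 : ContDiff ℝ ((I 0 + I 1 + 1 : ℕ)) ((partialDeriv 2)^[I 2] f) :=
    contDiff_partialDeriv_iterate (by convert hf using 2; omega) 2
  have h1 : ContDiff ℝ ((I 0 + 1 : ℕ)) ((partialDeriv 1)^[I 1] ((partialDeriv 2)^[I 2] f)) :=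
    contDiff_partialDeriv_iterate (by convert h2 using 2; omega) 1
  unfold multiDeriv
  rw [partialDeriv_iterate_comm h1, partialDeriv_iterate_comm (h2.of_le (by norm_cast; omega)),
    partialDeriv_iterate_comm (hf.of_le (by norm_cast; omega))]

/-- `multiDeriv` differentiates in a fixed order of directions, so an extra derivative taken first
has to be commuted to its slot; the assumed smoothness pays for these exchanges. -/
lemma multiDeriv_partialDeriv {I : MultiIndex} {f : E3 → ℝ}
    (hf : ContDiff ℝ (order I + 1 : ℕ) f) (a : Fin 3) :
    multiDeriv I (partialDeriv a f) = multiDeriv (I + unitIndex a) f := by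
  rw [order_eq] at hf
  have h2 : ContDiff ℝ ((I 0 + I 1 + 1 : ℕ)) ((partialDeriv 2)^[I 2] f) :=
    contDiff_partialDeriv_iterate (by convert hf using 2; omega) 2
  unfold multiDeriv
  fin_cases a
  · simp only [Fin.zero_eta, Pi.add_apply, Pi.single_eq_same, Function.iterate_succ_apply]
    have e2 : (unitIndex 0) 2 = 0 := rfl
    have e1 : (unitIndex 0) 1 = 0 := rfl
    rw [e2, e1, add_zero, add_zero, partialDeriv_iterate_comm (h2.of_le (by norm_cast; omega)),
      partialDeriv_iterate_comm (hf.of_le (by norm_cast; omega))]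
  · simp only [Fin.mk_one, Pi.add_apply, Pi.single_eq_same, Function.iterate_succ_apply]
    have e2 : (unitIndex 1) 2 = 0 := rfl
    have e1 : (unitIndex 1) 0 = 0 := rfl
    rw [e2, e1, add_zero, add_zero, partialDeriv_iterate_comm (hf.of_le (by norm_cast; omega))]
  · simp only [Fin.reduceFinMk, Pi.add_apply, Pi.single_eq_same, Function.iterate_succ_apply]
    have e2 : (unitIndex 2) 0 = 0 := rfl
    have e1 : (unitIndex 2) 1 = 0 := rfl
    rw [e2, e1, add_zero, add_zero]

lemma hasPartials_of_contDiff {f : E3 → ℝ} (hf : ContDiff ℝ 1 f) :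
    HasPartials f fun a => partialDeriv a f := by
  refine ⟨fun y => ?_, fun a => (contDiff_partialDeriv (n := 0) (by simpa using hf) a).continuous⟩
  refine (hf.differentiable (by norm_num) y).hasFDerivAt.congr_fderiv ?_
  ext v
  rw [lc_apply]
  conv_lhs => rw [eq_sum_basisVec v]
  simp [partialDeriv, basisVec, mul_comm]

lemma hasPartials_multiDeriv {I : MultiIndex} {f : E3 → ℝ}
    (hf : ContDiff ℝ (order I + 1 : ℕ) f) :
    HasPartials (multiDeriv I f) fun a => multiDeriv (I + unitIndex a) f := by
  have h : ContDiff ℝ 1 (multiDeriv I f) := by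
    have := contDiff_multiDeriv (n := 1) (I := I) (f := f) (by convert hf using 2; omega)
    simpa using this
  have := hasPartials_of_contDiff h
  simp only [partialDeriv_multiDeriv_comm hf, multiDeriv_partialDeriv hf] at this
  exact this

end MultiIndices

/-! ### Mollification and convergence in mean square. -/

section Mollification

/-- The bump function of radius `1 / (n + 1)`. -/
def bump (n : ℕ) : ContDiffBump (0 : E3) where
  rIn := 1 / (2 * (n + 1 : ℝ))
  rOut := 1 / (n + 1 : ℝ)
  rIn_pos := by positivity
  rIn_lt_rOut := by
    apply one_div_lt_one_div_of_lt (by positivity)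
    linarith [(n.cast_nonneg : (0 : ℝ) ≤ n)]

lemma tendsto_bump_rOut : Tendsto (fun n => (bump n).rOut) atTop (𝓝 0) :=
  tendsto_one_div_add_atTop_nhds_zero_nat

/-- The mollified function. -/
def mol (n : ℕ) (f : E3 → ℝ) : E3 → ℝ :=
  convolution ((bump n).normed volume) f (ContinuousLinearMap.lsmul ℝ ℝ) volume

lemma mol_apply (n : ℕ) (f : E3 → ℝ) (x : E3) :
    mol n f x = ∫ y, (bump n).normed volume (x - y) * f y := by
  rw [mol, convolution_eq_swap]; rfl

lemma integrable_bump_mul {f : E3 → ℝ} (hf : LocallyIntegrable f) (n : ℕ) (x : E3) :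
    Integrable fun y => (bump n).normed volume (x - y) * f y := by
  have h := (bump n).hasCompactSupport_normed (μ := volume).convolutionExists_left
    (ContinuousLinearMap.lsmul ℝ ℝ) (bump n).continuous_normed hf x
  have := h.integrable_swap
  simpa using this

lemma continuous_mol {f : E3 → ℝ} (hf : LocallyIntegrable f) (n : ℕ) : Continuous (mol n f) :=
  (bump n).hasCompactSupport_normed.continuous_convolution_left _ (bump n).continuous_normed hf

lemma mol_sub {f g : E3 → ℝ} (hf : LocallyIntegrable f) (hg : LocallyIntegrable g) (n : ℕ) (x : E3) :
    mol n (fun y => f y - g y) x = mol n f x - mol n g x := by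
  simp only [mol_apply, mul_sub]
  exact integral_sub (integrable_bump_mul hf n x) (integrable_bump_mul hg n x)

lemma integral_bump_sub (n : ℕ) (x : E3) : ∫ y, (bump n).normed volume (x - y) = 1 := by
  rw [integral_sub_left_eq_self (fun y => (bump n).normed volume y) volume x]
  exact (bump n).integral_normed

lemma integrable_bump_sub (n : ℕ) (x : E3) :
    Integrable fun y => (bump n).normed volume (x - y) :=
  ((bump n).integrable_normed (μ := volume)).comp_sub_left x

/-- Jensen's inequality: the variance of `f` with respect to the probability density of the
mollifier is nonnegative. -/
lemma mol_sq_le {f : E3 → ℝ} (hf : LocallyIntegrable f) (hf2 : Integrable fun y => f y ^ 2)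
    (n : ℕ) (x : E3) : mol n f x ^ 2 ≤ mol n (fun y => f y ^ 2) x := by
  set ρ := fun y => (bump n).normed volume (x - y) with hρ
  set m := mol n f x with hm
  have i1 : Integrable fun y => ρ y * f y := integrable_bump_mul hf n x
  have i2 : Integrable fun y => ρ y * f y ^ 2 := integrable_bump_mul hf2.locallyIntegrable n x
  have i0 : Integrable ρ := integrable_bump_sub n x
  have h : 0 ≤ ∫ y, ρ y * (f y - m) ^ 2 :=
    integral_nonneg fun y => mul_nonneg ((bump n).nonneg_normed _) (sq_nonneg _)
  have e : ∫ y, ρ y * (f y - m) ^ 2 = mol n (fun y => f y ^ 2) x - m ^ 2 := by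
    have e1 : ∀ y, ρ y * (f y - m) ^ 2 = ρ y * f y ^ 2 - 2 * m * (ρ y * f y) + m ^ 2 * ρ y := by
      intro y; ring
    simp only [e1]
    have i3 : Integrable fun y => ρ y * f y ^ 2 - 2 * m * (ρ y * f y) :=
      i2.sub (i1.const_mul (2 * m))
    rw [integral_add i3 (i0.const_mul _),
      integral_sub i2 (i1.const_mul _), integral_const_mul, integral_const_mul,
      integral_bump_sub n x, hρ, ← mol_apply n f x, ← mol_apply n (fun y => f y ^ 2) x, ← hm]
    ring
  rw [e] at h
  linarith

lemma integrable_mol {f : E3 → ℝ} (hf : Integrable f) (n : ℕ) : Integrable (mol n f) :=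
  Integrable.integrable_convolution _ (bump n).integrable_normed hf

lemma integral_mol {f : E3 → ℝ} (hf : Integrable f) (n : ℕ) : ∫ x, mol n f x = ∫ x, f x := by
  have := integral_convolution (ContinuousLinearMap.lsmul ℝ ℝ)
    ((bump n).integrable_normed (μ := volume)) hf
  rw [(bump n).integral_normed] at this
  simpa [mol] using this

lemma integrable_mol_sq {f : E3 → ℝ} (hf : LocallyIntegrable f) (hf2 : Integrable fun y => f y ^ 2)
    (n : ℕ) : Integrable fun x => mol n f x ^ 2 := by
  have := continuous_mol hf n
  refine (integrable_mol hf2 n).mono' (by fun_prop : Continuous fun x => mol n f x ^ 2).aestronglyMeasurable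
    (Eventually.of_forall fun x => ?_)
  rw [Real.norm_of_nonneg (sq_nonneg _)]
  exact mol_sq_le hf hf2 n x

lemma integral_mol_sq_le {f : E3 → ℝ} (hf : LocallyIntegrable f)
    (hf2 : Integrable fun y => f y ^ 2) (n : ℕ) : ∫ x, mol n f x ^ 2 ≤ ∫ x, f x ^ 2 :=
  (integral_mono (integrable_mol_sq hf hf2 n) (integrable_mol hf2 n) (mol_sq_le hf hf2 n)).trans_eq
    (integral_mol hf2 n)

lemma integrable_sq_sub {f g : E3 → ℝ} (hf : AEStronglyMeasurable f) (hg : AEStronglyMeasurable g)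
    (hf2 : Integrable fun y => f y ^ 2) (hg2 : Integrable fun y => g y ^ 2) :
    Integrable fun y => (f y - g y) ^ 2 := by
  refine ((hf2.const_mul 2).add (hg2.const_mul 2)).mono' ((hf.sub hg).pow 2)
    (Eventually.of_forall fun y => ?_)
  rw [Real.norm_of_nonneg (sq_nonneg _)]
  simp only [Pi.add_apply]
  nlinarith [sq_nonneg (f y + g y)]

/-- Mollification of a continuous compactly supported function converges in mean square. -/
lemma tendsto_integral_mol_sub_sq_of_continuous {c : E3 → ℝ} (hc : Continuous c)
    (hcs : HasCompactSupport c) : Tendsto (fun n => ∫ x, (mol n c x - c x) ^ 2) atTop (𝓝 0) := by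
  obtain ⟨R, hR⟩ := hcs.isCompact.isBounded.subset_closedBall (0 : E3)
  set S := Metric.closedBall (0 : E3) (R + 1) with hS
  have huc := hcs.uniformContinuous_of_continuous hc
  rw [Metric.uniformContinuous_iff] at huc
  have hsupp : ∀ n x, x ∉ S → mol n c x - c x = 0 := by
    intro n x hx
    have hz : ∀ y, dist y x ≤ 1 → c y = 0 := by
      intro y hy
      by_contra h
      have := hR (subset_tsupport c h)
      apply hx
      rw [hS, Metric.mem_closedBall] at *
      calc dist x 0 ≤ dist x y + dist y 0 := dist_triangle _ _ _
        _ ≤ R + 1 := by rw [dist_comm x y]; linarith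
    rw [hz x (by simp), sub_zero, mol_apply]
    refine integral_eq_zero_of_ae (Eventually.of_forall fun y => ?_)
    by_cases hy : dist y x ≤ 1
    · simp [hz y hy]
    · have : (bump n).normed volume (x - y) = 0 := by
        rw [← Function.notMem_support, (bump n).support_normed_eq, Metric.mem_ball, dist_zero_right,
          ← dist_eq_norm, dist_comm, not_lt]
        push Not at hy
        refine le_trans ?_ hy.le
        change 1 / (n + 1 : ℝ) ≤ 1
        rw [div_le_one (by positivity)]
        linarith [(n.cast_nonneg : (0 : ℝ) ≤ n)]
      simp [this]
  rw [Metric.tendsto_atTop]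
  intro η hη
  set v := volume.real S with hv
  have hv0 : 0 ≤ v := measureReal_nonneg
  -- With this uniform error the integral over `S` is at most `v η / (2 (v + 1)) < η`; the `+ 1`
  -- avoids a separate case for `v = 0`.
  obtain ⟨d, hd, hd2⟩ := huc (Real.sqrt (η / (2 * (v + 1)))) (by positivity)
  obtain ⟨N, hN⟩ := (Metric.tendsto_atTop.1 tendsto_bump_rOut) d hd
  refine ⟨N, fun n hn => ?_⟩
  rw [dist_zero_right, Real.norm_of_nonneg (integral_nonneg fun x => sq_nonneg _)]
  have hb : ∀ x, |mol n c x - c x| ≤ Real.sqrt (η / (2 * (v + 1))) := by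
    intro x
    refine (bump n).dist_normed_convolution_le hc.aestronglyMeasurable fun y hy => (hd2 ?_).le
    have := hN n hn
    rw [dist_zero_right, Real.norm_of_nonneg (bump n).rOut_pos.le] at this
    exact (Metric.mem_ball.1 hy).trans this
  have hb2 : ∀ x, (mol n c x - c x) ^ 2 ≤ S.indicator (fun _ => η / (2 * (v + 1))) x := by
    intro x
    by_cases hx : x ∈ S
    · rw [indicator_of_mem hx, ← sq_abs]
      calc _ ≤ Real.sqrt (η / (2 * (v + 1))) ^ 2 := by gcongr; exact hb x
        _ = _ := Real.sq_sqrt (by positivity)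
    · rw [indicator_of_notMem hx, hsupp n x hx]; simp
  have hSm : MeasurableSet S := Metric.isClosed_closedBall.measurableSet
  have hSf : volume S ≠ ⊤ := (isCompact_closedBall _ _).measure_ne_top
  calc ∫ x, (mol n c x - c x) ^ 2 ≤ ∫ x, S.indicator (fun _ => η / (2 * (v + 1))) x := by
        refine integral_mono_of_nonneg (Eventually.of_forall fun x => sq_nonneg _) ?_
          (Eventually.of_forall hb2)
        exact (integrable_indicator_iff hSm).2 (integrableOn_const hSf)
    _ = v * (η / (2 * (v + 1))) := by
        rw [integral_indicator hSm, setIntegral_const, smul_eq_mul]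
    _ = (v / (v + 1)) * (η / 2) := by field_simp
    _ ≤ 1 * (η / 2) := by gcongr; rw [div_le_one (by positivity)]; linarith
    _ < η := by linarith

/-- Mollification converges in mean square. -/
lemma tendsto_integral_mol_sub_sq {f : E3 → ℝ} (hf : LocallyIntegrable f)
    (hf2 : Integrable fun y => f y ^ 2) :
    Tendsto (fun n => ∫ x, (mol n f x - f x) ^ 2) atTop (𝓝 0) := by
  rw [Metric.tendsto_atTop]
  intro η hη
  have hm : MemLp f (ENNReal.ofReal 2) := by
    rw [show ENNReal.ofReal 2 = 2 by simp]
    exact (memLp_two_iff_integrable_sq hf.aestronglyMeasurable).2 hf2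
  -- The error splits into three pieces, each at most `η / 12`, and squaring a sum of three costs a
  -- factor `3`, for a total of `3η/4`.
  obtain ⟨c, hcs, hcd, hc, -⟩ := hm.exists_hasCompactSupport_integral_rpow_sub_le (by norm_num)
    (show 0 < η / 12 by positivity)
  have hcd' : ∫ x, (f x - c x) ^ 2 ≤ η / 12 := by
    refine le_trans (le_of_eq ?_) hcd
    congr 1; ext x
    rw [show (2 : ℝ) = ((2 : ℕ) : ℝ) by norm_num, Real.rpow_natCast, Real.norm_eq_abs, sq_abs]
  obtain ⟨N, hN⟩ := (Metric.tendsto_atTop.1 (tendsto_integral_mol_sub_sq_of_continuous hc hcs))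
    (η / 12) (by positivity)
  have hcl : LocallyIntegrable c := hc.locallyIntegrable
  have hc2 : Integrable fun y => c y ^ 2 := by
    refine Continuous.integrable_of_hasCompactSupport (by fun_prop) ?_
    exact hcs.comp_left (g := fun y : ℝ => y ^ 2) (by simp)
  have hfc : Integrable fun y => (f y - c y) ^ 2 :=
    integrable_sq_sub hf.aestronglyMeasurable hc.aestronglyMeasurable hf2 hc2
  have hfcl : LocallyIntegrable fun y => f y - c y := hf.sub hcl
  refine ⟨N, fun n hn => ?_⟩
  have h3 := hN n hn
  rw [dist_zero_right, Real.norm_of_nonneg (integral_nonneg fun x => sq_nonneg _)] at h3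
  rw [dist_zero_right, Real.norm_of_nonneg (integral_nonneg fun x => sq_nonneg _)]
  have h1 := integral_mol_sq_le hfcl hfc n
  have i1 := integrable_mol_sq hfcl hfc n
  have i2 : Integrable fun x => (mol n c x - c x) ^ 2 :=
    integrable_sq_sub (continuous_mol hcl n).aestronglyMeasurable hc.aestronglyMeasurable
      (integrable_mol_sq hcl hc2 n) hc2
  have hle : ∀ x, (mol n f x - f x) ^ 2 ≤ 3 * mol n (fun y => f y - c y) x ^ 2
      + 3 * (mol n c x - c x) ^ 2 + 3 * (f x - c x) ^ 2 := by
    intro x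
    rw [mol_sub hf hcl]
    set a := mol n f x
    set b := mol n c x
    nlinarith [sq_nonneg ((a - b) - (b - c x)), sq_nonneg ((a - b) + (f x - c x)),
      sq_nonneg ((b - c x) + (f x - c x))]
  calc _ ≤ ∫ x, (3 * mol n (fun y => f y - c y) x ^ 2
      + 3 * (mol n c x - c x) ^ 2 + 3 * (f x - c x) ^ 2) :=
        integral_mono_of_nonneg (Eventually.of_forall fun x => sq_nonneg _)
          (((i1.const_mul 3).add (i2.const_mul 3)).add (hfc.const_mul 3)) (Eventually.of_forall hle)
    _ = 3 * (∫ x, mol n (fun y => f y - c y) x ^ 2) + 3 * (∫ x, (mol n c x - c x) ^ 2)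
        + 3 * ∫ x, (f x - c x) ^ 2 := by
        have i3 : Integrable fun x =>
            3 * mol n (fun y => f y - c y) x ^ 2 + 3 * (mol n c x - c x) ^ 2 :=
          (i1.const_mul 3).add (i2.const_mul 3)
        rw [integral_add i3 (hfc.const_mul 3),
          integral_add (i1.const_mul 3) (i2.const_mul 3), integral_const_mul, integral_const_mul,
          integral_const_mul]
    _ < η := by linarith

end Mollification

/-! ### Continuous representatives of Sobolev functions. -/

section SobolevEmbedding

/-- Test the weak derivative of order `I` against `∂_a η` and that of order `I + e_a` against `η`.
The left sides agree and the signs differ by one factor `-1`. -/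
lemma integral_weakDeriv_partialDeriv {I : MultiIndex} {a : Fin 3} {f g h η : E3 → ℝ}
    (hg : IsWeakDeriv I f g) (hh : IsWeakDeriv (I + unitIndex a) f h) (hη : ContDiff ℝ ∞ η)
    (hc : HasCompactSupport η) : ∫ y, g y * partialDeriv a η y = -∫ y, h y * η y := by
  have hη' : ContDiff ℝ ∞ (partialDeriv a η) :=
    (hη.fderiv_right (m := ∞) (by simp)).clm_apply contDiff_const
  have hc' : HasCompactSupport (partialDeriv a η) := hc.fderiv_apply ℝ _
  have h1 := hg.2.2 _ hη' hc'
  have h2 := hh.2.2 _ hη hc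
  rw [multiDeriv_partialDeriv (hη.of_le (by exact_mod_cast le_top)), h2, order_add_unitIndex,
    pow_succ] at h1
  have hs : ((-1 : ℝ) ^ order I) ≠ 0 := pow_ne_zero _ (by norm_num)
  apply mul_left_cancel₀ hs
  rw [← h1]; ring

lemma partialDeriv_bump_sub (n : ℕ) (a : Fin 3) (x y : E3) :
    partialDeriv a (fun y => (bump n).normed volume (x - y)) y
      = -partialDeriv a ((bump n).normed volume) (x - y) := by
  have hd : HasFDerivAt ((bump n).normed volume) (fderiv ℝ ((bump n).normed volume) (x - y))
      (x - y) :=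
    (((bump n).contDiff_normed (n := 1)).differentiable (by norm_num) _).hasFDerivAt
  have h := hd.comp y ((hasFDerivAt_id y).const_sub x)
  unfold partialDeriv
  erw [h.fderiv]
  simp

/-- The derivative falls on the smooth kernel, where `∂_x` is minus `∂_y`, and is then moved onto
the weak derivative by testing with the kernel. -/
lemma hasPartials_mol {I : MultiIndex} {f : E3 → ℝ} {D : MultiIndex → E3 → ℝ}
    (h0 : IsWeakDeriv I f (D I)) (h1 : ∀ a, IsWeakDeriv (I + unitIndex a) f (D (I + unitIndex a)))
    (n : ℕ) : HasPartials (mol n (D I)) fun a => mol n (D (I + unitIndex a)) := by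
  refine ⟨fun x => ?_, fun a => continuous_mol (h1 a).2.1 n⟩
  have hcs := (bump n).hasCompactSupport_normed (μ := volume)
  have hs : ContDiff ℝ ∞ ((bump n).normed volume) := (bump n).contDiff_normed
  have hd := hcs.hasFDerivAt_convolution_left (μ := volume) (ContinuousLinearMap.lsmul ℝ ℝ)
    (hs.of_le (by simp)) h0.2.1 x
  refine hd.congr_fderiv ?_
  have hcs' : HasCompactSupport (fderiv ℝ ((bump n).normed volume)) := hcs.fderiv ℝ
  have hcf' : Continuous (fderiv ℝ ((bump n).normed volume)) := hs.continuous_fderiv (by simp)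
  have hex := (hcs'.convolutionExists_left
    ((ContinuousLinearMap.lsmul ℝ ℝ : ℝ →L[ℝ] ℝ →L[ℝ] ℝ).precompL E3) hcf' h0.2.1 x).integrable_swap
  ext v
  rw [lc_apply]
  conv_lhs => rw [eq_sum_basisVec v]
  rw [map_sum]
  refine Finset.sum_congr rfl fun a _ => ?_
  rw [map_smul, smul_eq_mul, mul_comm]
  congr 1
  rw [convolution_eq_swap, ContinuousLinearMap.integral_apply (by simpa using hex)]
  have e : ∀ y, (((ContinuousLinearMap.lsmul ℝ ℝ : ℝ →L[ℝ] ℝ →L[ℝ] ℝ).precompL E3)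
      (fderiv ℝ ((bump n).normed volume) (x - y)) (D I y)) (basisVec a) =
      -(D I y * partialDeriv a (fun y => (bump n).normed volume (x - y)) y) := by
    intro y
    rw [partialDeriv_bump_sub]
    simp [partialDeriv, basisVec, mul_comm, ContinuousLinearMap.precompL_apply]
  simp only [e]
  rw [integral_neg, integral_weakDeriv_partialDeriv h0 (h1 a), neg_neg, mol_apply]
  · congr 1; ext y; ring
  · exact hs.comp (by fun_prop)
  · exact hcs.comp_homeomorph (Homeomorph.subLeft x)

lemma HasPartials.sub {g k : E3 → ℝ} {gd kd : Fin 3 → E3 → ℝ} (hg : HasPartials g gd)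
    (hk : HasPartials k kd) : HasPartials (fun y => g y - k y) fun a y => gd a y - kd a y := by
  refine ⟨fun y => ((hg.hasFDerivAt y).fun_sub (hk.hasFDerivAt y)).congr_fderiv ?_,
    fun a => (hg.continuous a).sub (hk.continuous a)⟩
  ext v
  simp [lc_apply, sub_mul, Finset.sum_sub_distrib]

/-- The supremum is controlled by two derivatives in mean square. -/
lemma exists_sq_le_integral : ∃ K : ℝ, 0 < K ∧ ∀ {g : E3 → ℝ} {gd : Fin 3 → E3 → ℝ}
    {gdd : Fin 3 → Fin 3 → E3 → ℝ}, HasPartials g gd → (∀ a, HasPartials (gd a) (gdd a)) →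
    (Integrable fun y => g y ^ 2) → (∀ a, Integrable fun y => gd a y ^ 2) →
    (∀ a b, Integrable fun y => gdd a b y ^ 2) → ∀ x, g x ^ 2 ≤
      K * ((∫ y, g y ^ 2) + (∑ a, ∫ y, gd a y ^ 2) + ∑ a, ∑ b, ∫ y, gdd a b y ^ 2) := by
  -- The weighted inequality at radius `0` with `ε = 0` and `l = 1`: all weights are `1`, and the
  -- first derivatives are counted `2 + 1 = 3` times, so `24 = 8 * 3`.
  refine ⟨sphArea.toReal⁻¹ * 24, mul_pos (inv_pos.2 sphArea_toReal_pos) (by norm_num), ?_⟩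
  intro g gd gdd h h2 hi hid hidd x
  have hw : ∀ b y, wt b 0 y = 1 := fun b y => by simp [wt]
  have := sphMean_qsq_le h h2 (le_refl 0) one_pos zero_le_one hi (by simpa [hw] using hid)
    (by simpa [hw] using hidd) x (le_refl 0)
  rw [sphMean_zero] at this
  simp only [wEnergy, hw, one_mul, inv_one, one_pow, mul_one, qw] at this
  rw [integral_finsetSum _ fun a _ => hid a] at this
  simp only [integral_finsetSum _ fun b _ => hidd _ b, Finset.sum_add_distrib] at this
  have p0 : 0 ≤ ∫ y, g y ^ 2 := integral_nonneg fun y => sq_nonneg _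
  have p2 : 0 ≤ ∑ a, ∑ b, ∫ y, gdd a b y ^ 2 :=
    Finset.sum_nonneg fun a _ => Finset.sum_nonneg fun b _ => integral_nonneg fun y => sq_nonneg _
  refine this.trans ?_
  rw [mul_assoc]
  refine mul_le_mul_of_nonneg_left ?_ (inv_pos.2 sphArea_toReal_pos).le
  linarith

lemma norm_lc_le (v : Fin 3 → ℝ) : ‖lc v‖ ≤ ∑ a, |v a| := by
  refine ContinuousLinearMap.opNorm_le_bound _ (Finset.sum_nonneg fun a _ => abs_nonneg _) fun x => ?_
  rw [lc_apply, Finset.sum_mul]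
  refine (norm_sum_le _ _).trans (Finset.sum_le_sum fun a _ => ?_)
  rw [norm_mul, Real.norm_eq_abs]
  gcongr
  exact PiLp.norm_apply_le x a

lemma lc_sub (v w : Fin 3 → ℝ) : lc v - lc w = lc fun a => v a - w a := by
  ext x; simp [lc_apply, sub_mul, Finset.sum_sub_distrib]

lemma tendstoUniformly_lc {g : ℕ → Fin 3 → E3 → ℝ} {k : Fin 3 → E3 → ℝ}
    (h : ∀ a, TendstoUniformly (fun n => g n a) (k a) atTop) :
    TendstoUniformly (fun n y => lc fun a => g n a y) (fun y => lc fun a => k a y) atTop := by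
  rw [Metric.tendstoUniformly_iff]
  intro η hη
  have h' : ∀ᶠ n in atTop, ∀ a x, dist (k a x) (g n a x) < η / 4 :=
    eventually_all.2 fun a => (Metric.tendstoUniformly_iff.1 (h a)) (η / 4) (by positivity)
  filter_upwards [h'] with n hn x
  rw [dist_eq_norm, lc_sub]
  refine (norm_lc_le _).trans_lt ?_
  have : ∑ a, |k a x - g n a x| ≤ ∑ a : Fin 3, η / 4 :=
    Finset.sum_le_sum fun a _ => (hn a x).le
  refine this.trans_lt ?_
  simp
  linarith

/-- A function with square integrable weak derivatives up to order `k + 2` has continuous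
representatives of its derivatives up to order `k`. -/
lemma exists_continuous_representatives {k : ℕ} {f : E3 → ℝ} {D : MultiIndex → E3 → ℝ}
    (hD : ∀ I, order I ≤ k + 2 → IsWeakDeriv I f (D I))
    (hD2 : ∀ I, order I ≤ k + 2 → Integrable fun y => D I y ^ 2) :
    ∃ g : MultiIndex → E3 → ℝ, (∀ I, order I ≤ k → Continuous (g I)) ∧
      (∀ I, order I ≤ k → g I =ᵐ[volume] D I) ∧
      ∀ I, order I + 1 ≤ k → HasPartials (g I) fun a => g (I + unitIndex a) := by
  obtain ⟨K, hK, hsup⟩ := exists_sq_le_integral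
  set e : ℕ → MultiIndex → ℝ := fun n I => ∫ x, (mol n (D I) x - D I x) ^ 2 with he
  have he0 : ∀ I, order I ≤ k + 2 → Tendsto (fun n => e n I) atTop (𝓝 0) := fun I hI =>
    tendsto_integral_mol_sub_sq (hD I hI).2.1 (hD2 I hI)
  have hintg : ∀ I, order I ≤ k + 2 → ∀ n m,
      Integrable (fun x => (mol n (D I) x - mol m (D I) x) ^ 2) ∧
      ∫ x, (mol n (D I) x - mol m (D I) x) ^ 2 ≤ 2 * e n I + 2 * e m I := by
    intro I hI n m
    have hl := (hD I hI).2.1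
    have c := fun n => (continuous_mol hl n).aestronglyMeasurable (μ := volume)
    have i := fun n => integrable_mol_sq hl (hD2 I hI) n
    have j := fun n => integrable_sq_sub (c n) hl.aestronglyMeasurable (i n) (hD2 I hI)
    refine ⟨integrable_sq_sub (c n) (c m) (i n) (i m), ?_⟩
    rw [he]
    dsimp only
    rw [← integral_const_mul, ← integral_const_mul, ← integral_add ((j n).const_mul 2)
      ((j m).const_mul 2)]
    refine integral_mono (integrable_sq_sub (c n) (c m) (i n) (i m))
      (((j n).const_mul 2).add ((j m).const_mul 2)) fun x => ?_
    dsimp only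
    nlinarith [sq_nonneg (mol n (D I) x + mol m (D I) x - 2 * D I x)]
  have hpart : ∀ I, order I + 1 ≤ k + 2 → ∀ n,
      HasPartials (mol n (D I)) fun a => mol n (D (I + unitIndex a)) := fun I hI n =>
    hasPartials_mol (hD I (by omega)) (fun a => hD _ (by rw [order_add_unitIndex]; exact hI)) n
  set s : ℕ → MultiIndex → ℝ := fun n I => e n I + (∑ a, e n (I + unitIndex a))
    + ∑ a, ∑ b, e n (I + unitIndex a + unitIndex b) with hs
  have hs0 : ∀ I, order I ≤ k → Tendsto (fun n => s n I) atTop (𝓝 0) := by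
    intro I hI
    have h1 : Tendsto (fun n => ∑ a, e n (I + unitIndex a)) atTop (𝓝 (∑ a : Fin 3, 0)) :=
      tendsto_finsetSum _ fun a _ => he0 _ (by rw [order_add_unitIndex]; omega)
    have h2 : Tendsto (fun n => ∑ a, ∑ b, e n (I + unitIndex a + unitIndex b)) atTop
        (𝓝 (∑ a : Fin 3, ∑ b : Fin 3, 0)) :=
      tendsto_finsetSum _ fun a _ => tendsto_finsetSum _ fun b _ =>
        he0 _ (by rw [order_add_unitIndex, order_add_unitIndex]; omega)
    simpa using ((he0 I (by omega)).add h1).add h2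
  have hbound : ∀ I, order I ≤ k → ∀ n m x,
      (mol n (D I) x - mol m (D I) x) ^ 2 ≤ K * (2 * s n I + 2 * s m I) := by
    intro I hI n m x
    have o1 : ∀ a, order (I + unitIndex a) ≤ k + 2 := fun a => by
      rw [order_add_unitIndex]; omega
    have o2 : ∀ a b, order (I + unitIndex a + unitIndex b) ≤ k + 2 := fun a b => by
      rw [order_add_unitIndex, order_add_unitIndex]; omega
    have := hsup ((hpart I (by omega) n).sub (hpart I (by omega) m))
      (fun a => (hpart (I + unitIndex a) (by rw [order_add_unitIndex]; omega) n).sub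
        (hpart (I + unitIndex a) (by rw [order_add_unitIndex]; omega) m))
      (hintg I (by omega) n m).1 (fun a => (hintg _ (o1 a) n m).1)
      (fun a b => (hintg _ (o2 a b) n m).1) x
    refine this.trans (mul_le_mul_of_nonneg_left ?_ hK.le)
    have t0 := (hintg I (by omega) n m).2
    have t1 : ∑ a, ∫ y, (mol n (D (I + unitIndex a)) y - mol m (D (I + unitIndex a)) y) ^ 2 ≤
        2 * (∑ a, e n (I + unitIndex a)) + 2 * ∑ a, e m (I + unitIndex a) := by
      rw [Finset.mul_sum, Finset.mul_sum, ← Finset.sum_add_distrib]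
      exact Finset.sum_le_sum fun a _ => (hintg _ (o1 a) n m).2
    have t2 : ∑ a, ∑ b, ∫ y, (mol n (D (I + unitIndex a + unitIndex b)) y
        - mol m (D (I + unitIndex a + unitIndex b)) y) ^ 2 ≤
        2 * (∑ a, ∑ b, e n (I + unitIndex a + unitIndex b))
        + 2 * ∑ a, ∑ b, e m (I + unitIndex a + unitIndex b) := by
      simp only [Finset.mul_sum, ← Finset.sum_add_distrib]
      exact Finset.sum_le_sum fun a _ => Finset.sum_le_sum fun b _ => (hintg _ (o2 a b) n m).2
    rw [hs]; dsimp only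
    linarith
  have hlim : ∀ I, order I ≤ k → ∃ g : E3 → ℝ, TendstoUniformly (fun n => mol n (D I)) g atTop := by
    intro I hI
    -- The mollified derivatives up to two orders higher are Cauchy in mean square, and the supremum
    -- bound upgrades this to uniform convergence.
    have hcs : UniformCauchySeqOn (fun n => mol n (D I)) atTop univ := by
      rw [Metric.uniformCauchySeqOn_iff]
      intro η hη
      obtain ⟨N, hN⟩ := (Metric.tendsto_atTop.1 (hs0 I hI)) (η ^ 2 / (8 * K)) (by positivity)
      refine ⟨N, fun m hm n hn x _ => ?_⟩
      rw [Real.dist_eq]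
      refine abs_lt_of_sq_lt_sq ?_ hη.le
      have b1 := hN m hm
      have b2 := hN n hn
      rw [dist_zero_right] at b1 b2
      have c1 := (le_abs_self _).trans_lt b1
      have c2 := (le_abs_self _).trans_lt b2
      calc _ ≤ K * (2 * s m I + 2 * s n I) := hbound I hI m n x
        _ < K * (2 * (η ^ 2 / (8 * K)) + 2 * (η ^ 2 / (8 * K))) := by gcongr
        _ = η ^ 2 / 2 := by field_simp; norm_num
        _ < η ^ 2 := by nlinarith
    have hpt : ∀ x, ∃ l, Tendsto (fun n => mol n (D I) x) atTop (𝓝 l) := fun x =>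
      cauchySeq_tendsto_of_complete (hcs.cauchySeq (mem_univ x))
    choose g hg using hpt
    exact ⟨g, tendstoUniformlyOn_univ.1 (hcs.tendstoUniformlyOn_of_tendsto fun x _ => hg x)⟩
  choose! g hg using hlim
  have hgc : ∀ I, order I ≤ k → Continuous (g I) := fun I hI =>
    (hg I hI).continuous (Eventually.of_forall fun n => continuous_mol (hD I (by omega)).2.1 n).frequently
  refine ⟨g, hgc, fun I hI => ?_, fun I hI => ⟨fun y => ?_, fun a => hgc _ ?_⟩⟩
  -- The uniform limit is identified with the weak derivative by Lebesgue differentiation; `K = 2`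
  -- is the fixed ratio of the outer to the inner radius of the bumps.
  · filter_upwards [ContDiffBump.ae_convolution_tendsto_right_of_locallyIntegrable (K := 2)
      tendsto_bump_rOut (Eventually.of_forall fun n => by
        change 1 / (n + 1 : ℝ) ≤ 2 * (1 / (2 * (n + 1 : ℝ)))
        apply le_of_eq; field_simp) (hD I (by omega)).2.1] with x hx
    exact tendsto_nhds_unique ((hg I hI).tendsto_at x) hx
  · exact hasFDerivAt_of_tendstoUniformly
      (tendstoUniformly_lc fun a => hg (I + unitIndex a) (by rw [order_add_unitIndex]; omega))
      (fun n y => (hpart I (by omega) n).hasFDerivAt y) (fun y => (hg I (by omega)).tendsto_at y) y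
  · rw [order_add_unitIndex]; omega

end SobolevEmbedding

/-! ### Families of derivatives of the data, and global solvability for them. -/

section Families

/-- Two families of continuous functions, the derivatives of the two Cauchy data, with the weighted
integrability needed for pointwise bounds of the free evolution. -/
structure DataFamily (ε : ℝ) (g₀ g₁ : MultiIndex → E3 → ℝ) : Prop where
  partials₀ : ∀ I, order I ≤ 3 → HasPartials (g₀ I) fun a => g₀ (I + unitIndex a)
  partials₁ : ∀ I, order I ≤ 2 → HasPartials (g₁ I) fun a => g₁ (I + unitIndex a)
  integrable₀ : ∀ I, 1 ≤ order I → order I ≤ 4 → Integrable fun y => wt (-1) ε y * g₀ I y ^ 2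
  integrable₁ : ∀ I, order I ≤ 3 → Integrable fun y => wt (-1) ε y * g₁ I y ^ 2

lemma HasPartials.add {g k : E3 → ℝ} {gd kd : Fin 3 → E3 → ℝ} (hg : HasPartials g gd)
    (hk : HasPartials k kd) : HasPartials (fun y => g y + k y) fun a y => gd a y + kd a y := by
  refine ⟨fun y => ((hg.hasFDerivAt y).fun_add (hk.hasFDerivAt y)).congr_fderiv ?_,
    fun a => (hg.continuous a).add (hk.continuous a)⟩
  ext v
  simp [lc_apply, add_mul, Finset.sum_add_distrib]

lemma HasPartials.eq_lc {g : E3 → ℝ} {gd : Fin 3 → E3 → ℝ} (hg : HasPartials g gd)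
    {g' : E3 → E3 →L[ℝ] ℝ} (h : ∀ y, HasFDerivAt g (g' y) y) : g' = fun y => lc fun a => gd a y :=
  funext fun y => (h y).unique (hg.hasFDerivAt y)

lemma HasPartials.fderiv_eq {g : E3 → ℝ} {gd : Fin 3 → E3 → ℝ} (hg : HasPartials g gd) :
    fderiv ℝ g = fun y => lc fun a => gd a y :=
  funext fun y => (hg.hasFDerivAt y).fderiv

lemma lc_basisVec (v : Fin 3 → ℝ) (a : Fin 3) : lc v (basisVec a) = v a := by
  simp [lc_apply, basisVec]

lemma HasPartials.contDiff_succ {g : E3 → ℝ} {gd : Fin 3 → E3 → ℝ} (hg : HasPartials g gd) {n : ℕ}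
    (h : ∀ a, ContDiff ℝ n (gd a)) : ContDiff ℝ (n + 1 : ℕ) g := by
  have := (contDiff_succ_iff_fderiv (𝕜 := ℝ) (n := (n : WithTop ℕ∞)) (f := g)).2
    ⟨fun y => (hg.hasFDerivAt y).differentiableAt, by simp, by
      rw [hg.fderiv_eq]
      unfold lc
      exact ContDiff.sum fun a _ => (h a).smul contDiff_const⟩
  simpa using this

lemma contDiff_of_hasPartials {g : MultiIndex → E3 → ℝ} {k : ℕ}
    (h : ∀ I, order I ≤ k → HasPartials (g I) fun a => g (I + unitIndex a)) (n : ℕ) {I : MultiIndex}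
    (hI : order I + n ≤ k + 1) (hc : ∀ I, order I ≤ k + 1 → Continuous (g I)) :
    ContDiff ℝ n (g I) := by
  induction n generalizing I with
  | zero => simpa using hc I (by omega)
  | succ n ih =>
    exact (h I (by omega)).contDiff_succ fun a => ih (by rw [order_add_unitIndex]; omega)

lemma exists_unitIndex_of_order {I : MultiIndex} {k : ℕ} (h : order I = k + 1) :
    ∃ J a, I = J + unitIndex a ∧ order J = k := by
  obtain ⟨a, ha⟩ : ∃ a, I a ≠ 0 := by
    by_contra! hn
    simp [order, hn] at h
  have e : I = (I - unitIndex a) + unitIndex a := by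
    ext b
    rcases eq_or_ne b a with rfl | hb
    · simp; omega
    · simp [hb]
  refine ⟨I - unitIndex a, a, e, ?_⟩
  rw [e, order_add_unitIndex] at h
  omega

lemma continuous_of_hasPartials {g : MultiIndex → E3 → ℝ} {k : ℕ}
    (h : ∀ I, order I ≤ k → HasPartials (g I) fun a => g (I + unitIndex a)) {I : MultiIndex}
    (hI : order I ≤ k + 1) : Continuous (g I) := by
  rcases Nat.eq_zero_or_pos (order I) with h0 | h0
  · exact (h I (by omega)).cont
  · obtain ⟨J, a, rfl, hJ⟩ := exists_unitIndex_of_order (k := order I - 1) (by omega : order I = _)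
    exact (h J (by omega)).continuous a

lemma DataFamily.add {ε : ℝ} {g₀ g₁ k₀ k₁ : MultiIndex → E3 → ℝ} (hg : DataFamily ε g₀ g₁)
    (hk : DataFamily ε k₀ k₁) :
    DataFamily ε (fun I y => g₀ I y + k₀ I y) fun I y => g₁ I y + k₁ I y := by
  have key : ∀ {f h : E3 → ℝ}, Continuous f → Continuous h →
      (Integrable fun y => wt (-1) ε y * f y ^ 2) → (Integrable fun y => wt (-1) ε y * h y ^ 2) →
      Integrable fun y => wt (-1) ε y * (f y + h y) ^ 2 := by
    intro f h cf ch hf hh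
    have := continuous_wt (-1) ε
    refine ((hf.const_mul 2).add (hh.const_mul 2)).mono'
      (by fun_prop : Continuous fun y => wt (-1) ε y * (f y + h y) ^ 2).aestronglyMeasurable
      (Eventually.of_forall fun y => ?_)
    have hw := (wt_pos (-1) ε y).le
    rw [Real.norm_of_nonneg (by positivity)]
    simp only [Pi.add_apply]
    nlinarith [mul_nonneg hw (sq_nonneg (f y - h y))]
  exact ⟨fun I hI => (hg.partials₀ I hI).add (hk.partials₀ I hI),
    fun I hI => (hg.partials₁ I hI).add (hk.partials₁ I hI),
    fun I h1 h4 => key (continuous_of_hasPartials hg.partials₀ h4)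
      (continuous_of_hasPartials hk.partials₀ h4) (hg.integrable₀ I h1 h4) (hk.integrable₀ I h1 h4),
    fun I h3 => key (continuous_of_hasPartials hg.partials₁ h3)
      (continuous_of_hasPartials hk.partials₁ h3) (hg.integrable₁ I h3) (hk.integrable₁ I h3)⟩

lemma integrable_sq_of_wt {f : E3 → ℝ} (hc : Continuous f) {ε : ℝ}
    (h : Integrable fun y => wt (-1) ε y * f y ^ 2) : Integrable fun y => f y ^ 2 := by
  refine h.mono' (by fun_prop : Continuous fun y => f y ^ 2).aestronglyMeasurable
    (Eventually.of_forall fun y => ?_)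
  rw [Real.norm_of_nonneg (sq_nonneg _), wt_neg_one]
  exact le_mul_of_one_le_left (sq_nonneg _) (one_le_base ε y)

/-- A purely qualitative bound for the differentiated free wave; the constant is later absorbed by
the jet scale `δ`. The pointwise estimate needs two further derivatives of `g₀ I`, which is why
`order I ≤ 2` when four are available. -/
lemma DataFamily.exists_bound {ε : ℝ} (hε : 0 < ε) {g₀ g₁ : MultiIndex → E3 → ℝ}
    (h : DataFamily ε g₀ g₁) {I : MultiIndex} (h1 : 1 ≤ order I) (h2 : order I ≤ 2) :
    ∃ C, ∀ t x, 0 ≤ t → ∀ g' : E3 → E3 →L[ℝ] ℝ, (∀ y, HasFDerivAt (g₀ I) (g' y) y) →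
      |freeWave (g₀ I) g' (g₁ I) t x| ≤ C * wt (1 / 4) ε x := by
  have o := fun a => order_add_unitIndex I a
  have o2 := fun a b => order_add_unitIndex (I + unitIndex a) b
  have hp2 : ∀ a, HasPartials (g₀ (I + unitIndex a)) fun b => g₀ (I + unitIndex a + unitIndex b) :=
    fun a => h.partials₀ _ (by rw [o]; omega)
  obtain ⟨B, hB, hB'⟩ : ∃ B : ℝ, 0 < B ∧
      (sphArea.toReal⁻¹ * (8 * (2 * ε ^ 2 * wEnergy ε ε (g₀ I) (fun a => g₀ (I + unitIndex a))
      + ∑ a, wEnergy ε ε (g₀ (I + unitIndex a)) (fun b => g₀ (I + unitIndex a + unitIndex b)))) ≤ B) ∧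
      (∀ a, sphArea.toReal⁻¹ * (2 * wEnergy ε ε (g₀ (I + unitIndex a))
        (fun b => g₀ (I + unitIndex a + unitIndex b))) ≤ B) ∧
      (sphArea.toReal⁻¹ * (2 * wEnergy ε ε (g₁ I) fun a => g₁ (I + unitIndex a)) ≤ B) := by
    have := Filter.Eventually.and (eventually_gt_atTop (0 : ℝ)) (Filter.Eventually.and
      (eventually_ge_atTop (sphArea.toReal⁻¹ * (8 * (2 * ε ^ 2 * wEnergy ε ε (g₀ I)
        (fun a => g₀ (I + unitIndex a)) + ∑ a, wEnergy ε ε (g₀ (I + unitIndex a))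
          (fun b => g₀ (I + unitIndex a + unitIndex b))))))
      (Filter.Eventually.and (eventually_all.2 fun a =>
        eventually_ge_atTop (sphArea.toReal⁻¹ * (2 * wEnergy ε ε (g₀ (I + unitIndex a))
        (fun b => g₀ (I + unitIndex a + unitIndex b)))))
        (eventually_ge_atTop (sphArea.toReal⁻¹ * (2 * wEnergy ε ε (g₁ I)
          fun a => g₁ (I + unitIndex a))))))
    exact this.exists
  refine ⟨5 * Real.sqrt B, fun t x ht g' hg' => ?_⟩
  rw [(h.partials₀ I (by omega)).eq_lc hg']
  refine (abs_freeWave_le hε (h.partials₀ I (by omega)) hp2 (h.partials₁ I h2)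
    (integrable_sq_of_wt (h.partials₀ I (by omega)).cont (h.integrable₀ I h1 (by omega)))
    (fun a => h.integrable₀ _ (by rw [o]; omega) (by rw [o]; omega))
    (fun a b => h.integrable₀ _ (by rw [o2, o]; omega) (by rw [o2, o]; omega))
    (h.integrable₁ I (by omega)) (fun a => h.integrable₁ _ (by rw [o]; omega)) hB hB'.1 hB'.2.1
    hB'.2.2 ht x).trans (le_of_eq (by ring))

variable {V : Type*} [NormedAddCommGroup V] [NormedSpace ℝ V] [CompleteSpace V]

lemma norm_clm_le_sum (T : E3 →L[ℝ] V) : ‖T‖ ≤ ∑ a, ‖T (basisVec a)‖ := by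
  refine ContinuousLinearMap.opNorm_le_bound _ (Finset.sum_nonneg fun a _ => norm_nonneg _) fun x => ?_
  conv_lhs => rw [eq_sum_basisVec x]
  rw [map_sum, Finset.sum_mul]
  refine (norm_sum_le _ _).trans (Finset.sum_le_sum fun a _ => ?_)
  rw [map_smul, norm_smul, mul_comm]
  gcongr
  exact PiLp.norm_apply_le x a

/-- Evaluation on basis vectors commutes with the free evolution, so bounds for operator-valued
waves reduce to scalar ones. -/
lemma norm_freeWave_le_sum {u' v' : E3 → E3 →L[ℝ] V} {u'' : E3 → E3 →L[ℝ] E3 →L[ℝ] V}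
    (hu' : Continuous u') (hu'' : Continuous u'') (hv' : Continuous v') (t : ℝ) (x : E3) :
    ‖freeWave u' u'' v' t x‖ ≤ ∑ a, ‖freeWave (fun y => u' y (basisVec a))
      (fun y => (ContinuousLinearMap.apply ℝ V (basisVec a)).comp (u'' y))
      (fun y => v' y (basisVec a)) t x‖ := by
  refine (norm_clm_le_sum _).trans_eq (Finset.sum_congr rfl fun a _ => ?_)
  congr 1
  exact freeWave_clm (ContinuousLinearMap.apply ℝ V (basisVec a)) hu' hu'' hv' t x

lemma DataFamily.exists_bound_fderiv {ε : ℝ} (hε : 0 < ε) {g₀ g₁ : MultiIndex → E3 → ℝ}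
    (h : DataFamily ε g₀ g₁) {u' : E3 → E3 →L[ℝ] ℝ} {u'' : E3 → E3 →L[ℝ] E3 →L[ℝ] ℝ}
    {v' : E3 → E3 →L[ℝ] ℝ} (hu : ∀ y, HasFDerivAt (g₀ 0) (u' y) y)
    (hu' : ∀ y, HasFDerivAt u' (u'' y) y) (hu'' : Continuous u'')
    (hv : ∀ y, HasFDerivAt (g₁ 0) (v' y) y) :
    ∃ C, ∀ t x, 0 ≤ t → ‖freeWave u' u'' v' t x‖ ≤ C * wt (1 / 4) ε x := by
  have e0 := (h.partials₀ 0 (by rw [order_zero]; omega)).eq_lc hu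
  have e1 := (h.partials₁ 0 (by rw [order_zero]; omega)).eq_lc hv
  have hv' : Continuous v' := by
    rw [e1]
    exact continuous_lc (h.partials₁ 0 (by rw [order_zero]; omega)).continuous
  have hb := fun a : Fin 3 => h.exists_bound hε (I := 0 + unitIndex a)
    (by rw [order_add_unitIndex]; omega) (by rw [order_add_unitIndex, order_zero]; omega)
  choose C hC using hb
  refine ⟨∑ a, C a, fun t x ht => ?_⟩
  refine (norm_freeWave_le_sum (continuous_of_hasFDerivAt hu') hu'' hv' t x).trans ?_
  rw [Finset.sum_mul]
  refine Finset.sum_le_sum fun a _ => ?_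
  have f0 : (fun y => u' y (basisVec a)) = g₀ (0 + unitIndex a) := by
    ext y; rw [e0]; exact lc_basisVec _ a
  have f1 : (fun y => v' y (basisVec a)) = g₁ (0 + unitIndex a) := by
    ext y; rw [e1]; exact lc_basisVec _ a
  rw [f0, f1, Real.norm_eq_abs]
  refine hC a t x ht _ fun y => ?_
  rw [← f0]
  exact (ContinuousLinearMap.apply ℝ ℝ (basisVec a)).hasFDerivAt.comp y (hu' y)

lemma DataFamily.exists_bound_fderiv_fderiv {ε : ℝ} (hε : 0 < ε) {g₀ g₁ : MultiIndex → E3 → ℝ}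
    (h : DataFamily ε g₀ g₁) {u' : E3 → E3 →L[ℝ] ℝ} {u'' : E3 → E3 →L[ℝ] E3 →L[ℝ] ℝ}
    {u''' : E3 → E3 →L[ℝ] E3 →L[ℝ] E3 →L[ℝ] ℝ}
    {v' : E3 → E3 →L[ℝ] ℝ} {v'' : E3 → E3 →L[ℝ] E3 →L[ℝ] ℝ}
    (hu : ∀ y, HasFDerivAt (g₀ 0) (u' y) y)
    (hu' : ∀ y, HasFDerivAt u' (u'' y) y) (hu'' : ∀ y, HasFDerivAt u'' (u''' y) y)
    (hu''' : Continuous u''') (hv : ∀ y, HasFDerivAt (g₁ 0) (v' y) y)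
    (hv' : ∀ y, HasFDerivAt v' (v'' y) y) (hv'' : Continuous v'') :
    ∃ C, ∀ t x, 0 ≤ t → ‖freeWave u'' u''' v'' t x‖ ≤ C * wt (1 / 4) ε x := by
  have o2 : ∀ a b : Fin 3, order (0 + unitIndex b + unitIndex a) = 2 := fun a b => by
    rw [order_add_unitIndex, order_add_unitIndex, order_zero]
  have hb := fun a b : Fin 3 => h.exists_bound hε (I := 0 + unitIndex b + unitIndex a)
    (by rw [o2]; omega) (by rw [o2])
  choose C hC using hb
  refine ⟨∑ a, ∑ b, C a b, fun t x ht => ?_⟩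
  have cu'' := continuous_of_hasFDerivAt hu''
  refine (norm_freeWave_le_sum cu'' hu''' hv'' t x).trans ?_
  rw [Finset.sum_mul]
  refine Finset.sum_le_sum fun a _ => ?_
  refine (norm_freeWave_le_sum (by fun_prop) (by fun_prop) (by fun_prop) t x).trans ?_
  rw [Finset.sum_mul]
  refine Finset.sum_le_sum fun b _ => ?_
  have f : ∀ {g : MultiIndex → E3 → ℝ} {w' : E3 → E3 →L[ℝ] ℝ} {w'' : E3 → E3 →L[ℝ] E3 →L[ℝ] ℝ},
      HasPartials (g 0) (fun a => g (0 + unitIndex a)) →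
      HasPartials (g (0 + unitIndex b)) (fun a => g (0 + unitIndex b + unitIndex a)) →
      (∀ y, HasFDerivAt (g 0) (w' y) y) → (∀ y, HasFDerivAt w' (w'' y) y) →
      (fun y => w'' y (basisVec a) (basisVec b)) = g (0 + unitIndex b + unitIndex a) := by
    intro g w' w'' hp hp' hw hw'
    have f0 : (fun y => w' y (basisVec b)) = g (0 + unitIndex b) := by
      ext y; rw [hp.eq_lc hw]; exact lc_basisVec _ b
    have hd : ∀ y, HasFDerivAt (g (0 + unitIndex b))
        ((ContinuousLinearMap.apply ℝ ℝ (basisVec b)).comp (w'' y)) y := fun y => by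
      rw [← f0]
      exact (ContinuousLinearMap.apply ℝ ℝ (basisVec b)).hasFDerivAt.comp y (hw' y)
    have e := hp'.eq_lc hd
    ext y
    have := congrArg (fun T : E3 →L[ℝ] ℝ => T (basisVec a)) (congrFun e y)
    simpa [lc_basisVec] using this
  have o1 : order (0 + unitIndex b) = 1 := by rw [order_add_unitIndex, order_zero]
  have f0 := f (h.partials₀ 0 (by rw [order_zero]; omega)) (h.partials₀ _ (by rw [o1]; omega)) hu hu'
  have f1 := f (h.partials₁ 0 (by rw [order_zero]; omega)) (h.partials₁ _ (by rw [o1]; omega)) hv hv'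
  rw [f0, f1, Real.norm_eq_abs]
  refine hC a b t x ht _ fun y => ?_
  rw [← f0]
  have huu := hu''
  exact ((ContinuousLinearMap.apply ℝ ℝ (basisVec b)).comp
    (ContinuousLinearMap.apply ℝ (E3 →L[ℝ] ℝ) (basisVec a))).hasFDerivAt.comp y (huu y)

/-- Global solvability for families of data whose free evolution is small. -/
lemma exists_global_solution_of_family {p σ : ℝ} (hp : 5 < p) (hσ : |σ| ≤ 1) {C₀ : ℝ}
    (hC₀ : 0 < C₀) : ∃ ε₀ : ℝ, 0 < ε₀ ∧ ∀ ε, 0 < ε → ε < ε₀ →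
    ∀ {g₀ g₁ : MultiIndex → E3 → ℝ}, DataFamily ε g₀ g₁ →
      (∀ t x, 0 ≤ t → |freeWave (g₀ 0) (fderiv ℝ (g₀ 0)) (g₁ 0) t x|
        ≤ C₀ * ε ^ (1 / 2 : ℝ) * wt (1 / 4) ε x) →
      ∃ Ψ : ℝ → E3 → ℝ, ContDiff ℝ 2 (fun z : ℝ × E3 => Ψ z.1 z.2) ∧
        (∀ t x, 0 ≤ t → negBox Ψ t x = σ * (|Ψ t x| ^ (p - 1) * Ψ t x)) ∧
        (∀ x, Ψ 0 x = g₀ 0 x) ∧ ∀ x, HasDerivAt (fun t => Ψ t x) (g₁ 0 x) 0 := by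
  obtain ⟨ε₀, h0, H⟩ := exists_global_solution hp hσ hC₀
  refine ⟨ε₀, h0, fun ε hε hlt g₀ g₁ hg hb => ?_⟩
  have cu : ContDiff ℝ 4 (g₀ 0) := contDiff_of_hasPartials hg.partials₀ 4 (by rw [order_zero])
    fun I hI => continuous_of_hasPartials hg.partials₀ hI
  have cv : ContDiff ℝ 3 (g₁ 0) := contDiff_of_hasPartials hg.partials₁ 3 (by rw [order_zero])
    fun I hI => continuous_of_hasPartials hg.partials₁ hI
  have cu' : ContDiff ℝ 3 (fderiv ℝ (g₀ 0)) := cu.fderiv_right (by norm_num)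
  have cu'' : ContDiff ℝ 2 (fderiv ℝ (fderiv ℝ (g₀ 0))) := cu'.fderiv_right (by norm_num)
  have cu''' : ContDiff ℝ 1 (fderiv ℝ (fderiv ℝ (fderiv ℝ (g₀ 0)))) := cu''.fderiv_right (by norm_num)
  have cv' : ContDiff ℝ 2 (fderiv ℝ (g₁ 0)) := cv.fderiv_right (by norm_num)
  have cv'' : ContDiff ℝ 1 (fderiv ℝ (fderiv ℝ (g₁ 0))) := cv'.fderiv_right (by norm_num)
  have du := fun y => (cu.differentiable (by norm_num) y).hasFDerivAt
  have du' := fun y => (cu'.differentiable (by norm_num) y).hasFDerivAt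
  have du'' := fun y => (cu''.differentiable (by norm_num) y).hasFDerivAt
  have dv := fun y => (cv.differentiable (by norm_num) y).hasFDerivAt
  have dv' := fun y => (cv'.differentiable (by norm_num) y).hasFDerivAt
  exact H ε hε hlt du du' du'' cu'''.continuous dv dv' cv''.continuous hb
    (hg.exists_bound_fderiv hε du du' cu''.continuous dv)
    (hg.exists_bound_fderiv_fderiv hε du du' du'' cu'''.continuous dv dv' cv''.continuous)

end Families

/-! ### The free evolution of dispersed data. -/

section Dispersed

lemma integral_weighted_sq_le {m : ℕ} {f : E3 → ℝ} {B : ℝ} (hf : AEStronglyMeasurable f)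
    (hB : 0 ≤ B) (h : weightedL2 m f ≤ ENNReal.ofReal B) :
    (Integrable fun y => (1 + ‖y‖ ^ 2) ^ m * f y ^ 2) ∧ ∫ y, (1 + ‖y‖ ^ 2) ^ m * f y ^ 2 ≤ B ^ 2 := by
  set F : E3 → ℝ := fun x => Real.sqrt (1 + ‖x‖ ^ 2) ^ m * f x with hF
  have hFm : AEStronglyMeasurable F :=
    (by fun_prop : Continuous fun x : E3 => Real.sqrt (1 + ‖x‖ ^ 2) ^ m).aestronglyMeasurable.mul hf
  have hFL : MemLp F 2 := ⟨hFm, h.trans_lt ENNReal.ofReal_lt_top⟩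
  have hsq : ∀ y, F y ^ 2 = (1 + ‖y‖ ^ 2) ^ m * f y ^ 2 := by
    intro y
    rw [hF]
    dsimp only
    rw [mul_pow, ← pow_mul, mul_comm m 2, pow_mul, Real.sq_sqrt (by positivity)]
  have hi : Integrable fun y => F y ^ 2 := hFL.integrable_sq
  have e := hFL.eLpNorm_eq_integral_rpow_norm (by norm_num) (by norm_num)
  change eLpNorm F 2 volume ≤ _ at h
  rw [e, ENNReal.ofReal_le_ofReal_iff hB] at h
  simp only [ENNReal.toReal_ofNat, Real.rpow_two, Real.norm_eq_abs, sq_abs] at h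
  rw [← one_div, ← Real.sqrt_eq_rpow, Real.sqrt_le_left hB] at h
  simp only [hsq] at h hi
  exact ⟨hi, h⟩

/-- Write `1 + ε²|y|² = (1 - ε²) + ε² (1 + |y|²)`. For dispersed data the norm with weight `⟨x⟩`
sits one level `k` lower and is larger by `ε⁻¹`, which the factor `ε²` on its square compensates. -/
lemma integral_wt_sq_le {f : E3 → ℝ} {ε A B : ℝ} (hA : Integrable fun y => f y ^ 2)
    (hB : Integrable fun y => (1 + ‖y‖ ^ 2) * f y ^ 2) (hA' : ∫ y, f y ^ 2 ≤ A)
    (hB' : ∫ y, (1 + ‖y‖ ^ 2) * f y ^ 2 ≤ B) :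
    (Integrable fun y => wt (-1) ε y * f y ^ 2) ∧ ∫ y, wt (-1) ε y * f y ^ 2 ≤ A + ε ^ 2 * B := by
  have e : ∀ y, wt (-1) ε y * f y ^ 2 =
      (1 - ε ^ 2) * f y ^ 2 + ε ^ 2 * ((1 + ‖y‖ ^ 2) * f y ^ 2) := by
    intro y; rw [wt_neg_one]; ring
  simp only [e]
  refine ⟨(hA.const_mul _).add (hB.const_mul _), ?_⟩
  rw [integral_add (hA.const_mul _) (hB.const_mul _), integral_const_mul, integral_const_mul]
  have h0 : 0 ≤ ∫ y, f y ^ 2 := integral_nonneg fun y => sq_nonneg _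
  nlinarith [mul_nonneg (sq_nonneg ε) h0, mul_le_mul_of_nonneg_left hB' (sq_nonneg ε)]

lemma integrable_weighted_of_le {f : E3 → ℝ} (hf : AEStronglyMeasurable f) {m n : ℕ} (hmn : m ≤ n)
    (h : Integrable fun y => (1 + ‖y‖ ^ 2) ^ n * f y ^ 2) :
    Integrable fun y => (1 + ‖y‖ ^ 2) ^ m * f y ^ 2 := by
  refine h.mono' ((by fun_prop : Continuous fun y : E3 =>
    (1 + ‖y‖ ^ 2) ^ m).aestronglyMeasurable.mul (hf.pow 2)) (Eventually.of_forall fun y => ?_)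
  rw [Real.norm_of_nonneg (by positivity)]
  have : (1 : ℝ) ≤ 1 + ‖y‖ ^ 2 := by linarith [sq_nonneg ‖y‖]
  gcongr

lemma weightedL2_congr {m : ℕ} {f g : E3 → ℝ} (h : f =ᵐ[volume] g) :
    weightedL2 m f = weightedL2 m g :=
  eLpNorm_congr_ae (h.mono fun x hx => by simp only [hx])

lemma IsWeakDeriv.ae_eq {f g : E3 → ℝ} (h : IsWeakDeriv 0 f g) : g =ᵐ[volume] f := by
  refine ae_eq_of_integral_contDiff_smul_eq h.2.1 h.1 fun η hη hc => ?_
  have := h.2.2 η hη hc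
  simp only [order_zero, pow_zero, one_mul, multiDeriv, Pi.zero_apply, Function.iterate_zero,
    id_eq] at this
  simp only [smul_eq_mul, mul_comm (η _), this]

lemma wEnergy_le {ε A B : ℝ} (hε : 0 < ε) {g : E3 → ℝ} {gd : Fin 3 → E3 → ℝ}
    (hA : ∫ y, g y ^ 2 ≤ A)
    (hi : ∀ a, Integrable fun y => wt (-1) ε y * gd a y ^ 2)
    (hB : ∀ a, ∫ y, wt (-1) ε y * gd a y ^ 2 ≤ B) :
    wEnergy ε ε g gd ≤ ε * A + ε⁻¹ * (3 * B) := by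
  unfold wEnergy
  simp only [Finset.mul_sum]
  rw [integral_finsetSum _ fun a _ => hi a]
  have : ∑ a, ∫ y, wt (-1) ε y * gd a y ^ 2 ≤ ∑ a : Fin 3, B := Finset.sum_le_sum fun a _ => hB a
  simp only [Finset.sum_const, Finset.card_univ, Fintype.card_fin, nsmul_eq_mul] at this
  have hε' := inv_pos.2 hε
  gcongr
  exact_mod_cast this

/-- Dispersed data have continuous representatives, whose free evolution is of size `ε^{1/2}`. -/
lemma exists_dispersed_family : ∃ C : ℝ, 0 < C ∧ ∀ {ε : ℝ}, 0 < ε → ∀ {u₀ u₁ : E3 → ℝ},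
    IsDispersedData ε u₀ u₁ → ∃ g₀ g₁ : MultiIndex → E3 → ℝ, DataFamily ε g₀ g₁ ∧
      g₀ 0 =ᵐ[volume] u₀ ∧ g₁ 0 =ᵐ[volume] u₁ ∧
      ∀ t x, 0 ≤ t → |freeWave (g₀ 0) (fderiv ℝ (g₀ 0)) (g₁ 0) t x|
        ≤ C * ε ^ (1 / 2 : ℝ) * wt (1 / 4) ε x := by
  have hc := sphArea_toReal_pos
  refine ⟨5 * Real.sqrt (sphArea.toReal⁻¹ * 280), by positivity, ?_⟩
  rintro ε hε u₀ u₁ ⟨D₀, D₁, hD₀, hD₁, hb⟩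
  have A : ∀ k ≤ 2, ∀ I J, order J = k → order I ≤ 6 - k →
      weightedL2 (order I) (D₀ (I + J)) ≤ ENNReal.ofReal (ε ^ ((k : ℤ) - 1)) := by
    intro k hk I J hJ hI
    refine le_trans ?_ ((le_add_right le_rfl).trans (hb k hk))
    refine le_trans ?_ (Finset.single_le_sum (fun _ _ => zero_le) (mem_multiIndicesOfOrder.2 hJ))
    exact Finset.single_le_sum (f := fun I => weightedL2 (order I) (D₀ (I + J)))
      (fun _ _ => zero_le) (mem_multiIndicesUpTo.2 hI)
  have B : ∀ k ≤ 2, ∀ I J, order J = k - 1 → order I ≤ 5 - (k - 1) →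
      weightedL2 (order I + (1 - k)) (D₁ (I + J)) ≤ ENNReal.ofReal (ε ^ ((k : ℤ) - 1)) := by
    intro k hk I J hJ hI
    refine le_trans ?_ ((le_add_left le_rfl).trans (hb k hk))
    refine le_trans ?_ (Finset.single_le_sum (fun _ _ => zero_le) (mem_multiIndicesOfOrder.2 hJ))
    exact Finset.single_le_sum (f := fun I => weightedL2 (order I + (1 - k)) (D₁ (I + J)))
      (fun _ _ => zero_le) (mem_multiIndicesUpTo.2 hI)
  have W : ∀ {m : ℕ} {f : E3 → ℝ} {k : ℤ}, AEStronglyMeasurable f →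
      weightedL2 m f ≤ ENNReal.ofReal (ε ^ (k - 1)) →
      (Integrable fun y => (1 + ‖y‖ ^ 2) ^ m * f y ^ 2) ∧
        ∫ y, (1 + ‖y‖ ^ 2) ^ m * f y ^ 2 ≤ (ε ^ (k - 1)) ^ 2 := fun hf h =>
    integral_weighted_sq_le hf (by positivity) h
  have m₀ : ∀ I, order I ≤ 6 → AEStronglyMeasurable (D₀ I) := fun I hI =>
    (hD₀ I hI).2.1.aestronglyMeasurable
  have m₁ : ∀ I, order I ≤ 5 → AEStronglyMeasurable (D₁ I) := fun I hI =>
    (hD₁ I hI).2.1.aestronglyMeasurable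
  have i₀ : ∀ I, order I ≤ 6 → Integrable fun y => (1 + ‖y‖ ^ 2) ^ order I * D₀ I y ^ 2 := by
    intro I hI
    have := A 0 (by omega) I 0 order_zero hI
    rw [add_zero] at this
    exact (W (m₀ I hI) this).1
  have i₁ : ∀ I, order I ≤ 5 → Integrable fun y => (1 + ‖y‖ ^ 2) ^ (order I + 1) * D₁ I y ^ 2 := by
    intro I hI
    have := B 0 (by omega) I 0 order_zero hI
    rw [add_zero] at this
    exact (W (m₁ I hI) this).1
  -- The embedding costs two derivatives: six become four for `u₀`, and below five become three for
  -- `u₁`.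
  obtain ⟨g₀, cg₀, eg₀, pg₀⟩ := exists_continuous_representatives (k := 4) hD₀ fun I hI => by
    simpa using integrable_weighted_of_le (m₀ I hI) (zero_le : 0 ≤ order I) (i₀ I hI)
  obtain ⟨g₁, cg₁, eg₁, pg₁⟩ := exists_continuous_representatives (k := 3) hD₁ fun I hI => by
    simpa using integrable_weighted_of_le (m₁ I hI) (zero_le : 0 ≤ order I + 1) (i₁ I hI)
  have n₀ : ∀ I, order I ≤ 4 → AEStronglyMeasurable (g₀ I) := fun I hI =>
    (cg₀ I hI).aestronglyMeasurable
  have n₁ : ∀ I, order I ≤ 3 → AEStronglyMeasurable (g₁ I) := fun I hI =>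
    (cg₁ I hI).aestronglyMeasurable
  have j₀ : ∀ I, order I ≤ 4 → Integrable fun y => (1 + ‖y‖ ^ 2) ^ order I * g₀ I y ^ 2 :=
    fun I hI => (i₀ I (by omega)).congr ((eg₀ I hI).mono fun y hy => by simp only [hy])
  have j₁ : ∀ I, order I ≤ 3 → Integrable fun y => (1 + ‖y‖ ^ 2) ^ (order I + 1) * g₁ I y ^ 2 :=
    fun I hI => (i₁ I (by omega)).congr ((eg₁ I hI).mono fun y hy => by simp only [hy])
  -- Derivatives of `u₀` of positive order, and all derivatives of `u₁`, carry at least one power of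
  -- `⟨x⟩` at level `k = 0`. This gives the weighted integrability; `u₀` itself carries none.
  have hfam : DataFamily ε g₀ g₁ := by
    refine ⟨fun I hI => pg₀ I (by omega), fun I hI => pg₁ I (by omega), fun I h1 h4 => ?_,
      fun I h3 => ?_⟩
    · have a := integrable_weighted_of_le (n₀ I h4) (zero_le : 0 ≤ order I) (j₀ I h4)
      have b := integrable_weighted_of_le (n₀ I h4) h1 (j₀ I h4)
      simp only [pow_zero, one_mul, pow_one] at a b
      exact (integral_wt_sq_le a b le_rfl le_rfl).1
    · have a := integrable_weighted_of_le (n₁ I h3) (zero_le : 0 ≤ order I + 1) (j₁ I h3)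
      have b := integrable_weighted_of_le (n₁ I h3) (by omega : 1 ≤ order I + 1) (j₁ I h3)
      simp only [pow_zero, one_mul, pow_one] at a b
      exact (integral_wt_sq_le a b le_rfl le_rfl).1
  have A' : ∀ k ≤ 2, ∀ I J, order J = k → order I + k ≤ 4 →
      (Integrable fun y => (1 + ‖y‖ ^ 2) ^ order I * g₀ (I + J) y ^ 2) ∧
        ∫ y, (1 + ‖y‖ ^ 2) ^ order I * g₀ (I + J) y ^ 2 ≤ (ε ^ ((k : ℤ) - 1)) ^ 2 := by
    intro k hk I J hJ hI
    have o : order (I + J) ≤ 4 := by rw [order_add]; omega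
    exact W (n₀ _ o) ((weightedL2_congr (eg₀ _ o)).trans_le (A k hk I J hJ (by omega)))
  have B' : ∀ k ≤ 2, ∀ I J, order J = k - 1 → order I + (k - 1) ≤ 3 →
      (Integrable fun y => (1 + ‖y‖ ^ 2) ^ (order I + (1 - k)) * g₁ (I + J) y ^ 2) ∧
        ∫ y, (1 + ‖y‖ ^ 2) ^ (order I + (1 - k)) * g₁ (I + J) y ^ 2 ≤ (ε ^ ((k : ℤ) - 1)) ^ 2 := by
    intro k hk I J hJ hI
    have o : order (I + J) ≤ 3 := by rw [order_add]; omega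
    exact W (n₁ _ o) ((weightedL2_congr (eg₁ _ o)).trans_le (B k hk I J hJ (by omega)))
  have ou := order_unitIndex
  have hu0 := A' 0 (by omega) 0 0 order_zero (by rw [order_zero]; omega)
  have hu1 := fun a => A' 1 (by omega) 0 (unitIndex a) (ou a) (by rw [order_zero]; omega)
  have hu1' := fun a => A' 0 (by omega) (unitIndex a) 0 order_zero (by rw [ou]; omega)
  have hu2 := fun a b => A' 2 (by omega) 0 (unitIndex a + unitIndex b)
    (by rw [order_add, ou, ou]) (by rw [order_zero]; omega)
  have hu2' := fun a b => A' 1 (by omega) (unitIndex a) (unitIndex b) (ou b) (by rw [ou]; omega)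
  have hv0 := B' 1 (by omega) 0 0 order_zero (by rw [order_zero]; omega)
  have hv1 := fun a => B' 2 (by omega) 0 (unitIndex a) (ou a) (by rw [order_zero]; omega)
  have hv1' := fun a => B' 1 (by omega) (unitIndex a) 0 order_zero (by rw [ou]; omega)
  simp only [order_zero, ou, pow_zero, pow_one, one_mul, zero_add, add_zero, Nat.cast_zero,
    Nat.cast_one, sub_self, zpow_zero, one_pow, Nat.cast_ofNat, zero_sub, zpow_neg, zpow_one,
    tsub_self, show (2 : ℤ) - 1 = 1 by norm_num, show 1 - 2 = 0 by norm_num] at hu0 hu1 hu1' hu2 hu2' hv0 hv1 hv1'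
  have wu1 := fun a => integral_wt_sq_le (ε := ε) (hu1 a).1 (hu1' a).1 (hu1 a).2 (hu1' a).2
  have wu2 := fun a b => integral_wt_sq_le (ε := ε) (hu2 a b).1 (hu2' a b).1 (hu2 a b).2 (hu2' a b).2
  have wv1 := fun a => integral_wt_sq_le (ε := ε) (hv1 a).1 (hv1' a).1 (hv1 a).2 (hv1' a).2
  -- In all three energies `7 = 1 + 3 * 2`: one from the function, and for each of three directions
  -- one from the unweighted and one from the weighted part of the derivative norm.
  have E0 : wEnergy ε ε (g₀ 0) (fun a => g₀ (unitIndex a)) ≤ 7 * ε⁻¹ := by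
    refine (wEnergy_le hε hu0.2 (fun a => (wu1 a).1) fun a => (wu1 a).2).trans (le_of_eq ?_)
    field_simp; norm_num
  have E1 : ∀ a, wEnergy ε ε (g₀ (unitIndex a)) (fun b => g₀ (unitIndex a + unitIndex b)) ≤ 7 * ε := by
    intro a
    refine (wEnergy_le hε (hu1 a).2 (fun b => (wu2 a b).1) fun b => (wu2 a b).2).trans (le_of_eq ?_)
    field_simp; norm_num
  have E2 : wEnergy ε ε (g₁ 0) (fun a => g₁ (unitIndex a)) ≤ 7 * ε := by
    refine (wEnergy_le hε hv0.2 (fun a => (wv1 a).1) fun a => (wv1 a).2).trans (le_of_eq ?_)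
    field_simp; norm_num
  refine ⟨g₀, g₁, hfam, (eg₀ 0 (by rw [order_zero]; omega)).trans
    (hD₀ 0 (by rw [order_zero]; omega)).ae_eq, (eg₁ 0 (by rw [order_zero]; omega)).trans
    (hD₁ 0 (by rw [order_zero]; omega)).ae_eq, fun t x ht => ?_⟩
  have p0 : HasPartials (g₀ 0) fun a => g₀ (unitIndex a) := by
    have := pg₀ 0 (by rw [order_zero]; omega)
    simpa only [zero_add] using this
  have p1 : HasPartials (g₁ 0) fun a => g₁ (unitIndex a) := by
    have := pg₁ 0 (by rw [order_zero]; omega)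
    simpa only [zero_add] using this
  rw [p0.fderiv_eq]
  have iv0 : Integrable fun y => wt (-1) ε y * g₁ 0 y ^ 2 :=
    hfam.integrable₁ 0 (by rw [order_zero]; omega)
  have hci := inv_pos.2 hc
  -- The constant is `280 = 8 * (2 * 7 + 3 * 7)`. The bound is linear in `ε`, and its square root
  -- yields the amplitude `ε^{1/2}`.
  have key := abs_freeWave_le hε p0 (fun a => pg₀ (unitIndex a) (by rw [ou]; omega)) p1 hu0.1
    (fun a => (wu1 a).1) (fun a b => (wu2 a b).1) iv0 (fun a => (wv1 a).1)
    (B := sphArea.toReal⁻¹ * 280 * ε) (by positivity) ?_ ?_ ?_ ht x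
  · refine key.trans (le_of_eq ?_)
    rw [Real.sqrt_mul (by positivity), Real.sqrt_eq_rpow ε]
    ring
  · have : ∑ a, wEnergy ε ε (g₀ (unitIndex a)) (fun b => g₀ (unitIndex a + unitIndex b))
        ≤ ∑ a : Fin 3, 7 * ε := Finset.sum_le_sum fun a _ => E1 a
    simp only [Finset.sum_const, Finset.card_univ, Fintype.card_fin, nsmul_eq_mul] at this
    push_cast at this
    rw [mul_assoc (sphArea.toReal⁻¹)]
    refine mul_le_mul_of_nonneg_left ?_ hci.le
    have e : 2 * ε ^ 2 * wEnergy ε ε (g₀ 0) (fun a => g₀ (unitIndex a)) ≤ 2 * ε ^ 2 * (7 * ε⁻¹) := by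
      gcongr
    have e' : 2 * ε ^ 2 * (7 * ε⁻¹) = 14 * ε := by field_simp; norm_num
    linarith
  · intro a
    rw [mul_assoc (sphArea.toReal⁻¹)]
    refine mul_le_mul_of_nonneg_left ?_ hci.le
    linarith [E1 a]
  · rw [mul_assoc (sphArea.toReal⁻¹)]
    refine mul_le_mul_of_nonneg_left ?_ hci.le
    linarith [E2]

end Dispersed

/-! ### Plane waves and Archimedes' theorem on spherical zones. -/

section Caps

lemma kirD_neg {V : Type*} [NormedAddCommGroup V] [NormedSpace ℝ V] (g : E3 → V)
    (g' : E3 → E3 →L[ℝ] V) (t : ℝ) (x : E3) : kirD g g' (-t) x = kirD g g' t x := by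
  rw [kirD, kirD, sphMean_neg, ← integral_sph_neg (fun θ => g' (x + -t • θ) θ)]
  simp [integral_neg]

lemma kir_neg {V : Type*} [NormedAddCommGroup V] [NormedSpace ℝ V] (g : E3 → V) (t : ℝ) (x : E3) :
    kir g (-t) x = -kir g t x := by
  rw [kir, kir, sphMean_neg, neg_smul]

variable {G : ℝ → ℝ} {e : E3}

lemma hasFDerivAt_plane {F F' : ℝ → ℝ} (h : ∀ s, HasDerivAt F (F' s) s) (e y : E3) :
    HasFDerivAt (fun y => F (innerSL ℝ e y)) (F' (innerSL ℝ e y) • innerSL ℝ e) y :=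
  (h _).comp_hasFDerivAt y (innerSL ℝ e).hasFDerivAt

/-- The free wave with plane data moving in one direction. -/
lemma freeWave_plane {G' G'' : ℝ → ℝ} (hG : ∀ s, HasDerivAt G (G' s) s)
    (hG' : ∀ s, HasDerivAt G' (G'' s) s) (hG'' : Continuous G'') (he : ‖e‖ = 1) (t : ℝ) :
    freeWave (fun y => G (innerSL ℝ e y)) (fun y => G' (innerSL ℝ e y) • innerSL ℝ e)
      (fun y => G' (innerSL ℝ e y)) t 0 = G t := by
  set L : E3 →L[ℝ] ℝ := innerSL ℝ e with hL
  have hLe : L e = 1 := by rw [hL, innerSL_apply_apply, real_inner_self_eq_norm_sq, he]; norm_num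
  have cG' : Continuous G' := continuous_iff_continuousAt.2 fun s => (hG' s).continuousAt
  have cG : Continuous G := continuous_iff_continuousAt.2 fun s => (hG s).continuousAt
  have hu := hasFDerivAt_plane hG e
  have hv := hasFDerivAt_plane hG' e
  have hu2 : ∀ y, HasFDerivAt (fun y => G' (L y) • L) ((G'' (L y) • L).smulRight L) y := fun y =>
    (hv y).smul_const L
  have cu2 : Continuous fun y => (G'' (L y) • L).smulRight L := by
    have : Continuous fun y => G'' (L y) • L.smulRight L := by fun_prop
    refine this.congr fun y => ?_
    ext a b; simp [mul_assoc]
  have htr : ∀ y, traceBil ((G'' (L y) • L).smulRight L) = G'' (L y) := by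
    intro y
    have h1 : ∑ a, L (basisVec a) ^ 2 = 1 := by
      have : ∀ a, L (basisVec a) = e a := fun a => by
        rw [hL, innerSL_apply_apply]; simp [basisVec, EuclideanSpace.inner_single_right]
      simp only [this]
      rw [← EuclideanSpace.real_norm_sq_eq, he]; norm_num
    simp only [traceBil, ContinuousLinearMap.smulRight_apply, _root_.smul_apply, smul_eq_mul]
    simp only [mul_assoc, ← sq]
    rw [← Finset.mul_sum, h1, mul_one]
  set Q : ℝ → E3 → ℝ := freeWave (fun y => G (L y)) (fun y => G' (L y) • L) (fun y => G' (L y))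
    with hQ
  have cv' : Continuous fun y => G'' (L y) • L := by fun_prop
  set P : ℝ → E3 → ℝ := freeWave (fun y => G' (L y)) (fun y => G'' (L y) • L) (fun y => G'' (L y))
    with hP
  have dt : ∀ s x, HasDerivAt (fun s => Q s x) (P s x) s := by
    intro s x
    refine (hasDerivAt_freeWave hu hu2 cu2 hv cv' s x).congr_deriv ?_
    simp only [htr, hP]
    rfl
  have dx : ∀ s x, HasFDerivAt (Q s) (freeWave (fun y => G' (L y) • L)
      (fun y => (G'' (L y) • L).smulRight L) (fun y => G'' (L y) • L) s x) x := fun s x =>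
    hasFDerivAt_freeWave hu hu2 cu2 hv cv' s x
  -- The derivative in direction `e` has the same Cauchy data as the time derivative, because `L e =
  -- 1`; so the wave satisfies a transport equation.
  have hdx : ∀ s x, freeWave (fun y => G' (L y) • L) (fun y => (G'' (L y) • L).smulRight L)
      (fun y => G'' (L y) • L) s x e = P s x := by
    intro s x
    have := freeWave_clm (ContinuousLinearMap.apply ℝ ℝ e) (u := fun y => G' (L y) • L)
      (by fun_prop) cu2 cv' s x
    refine Eq.trans this ?_
    rw [hP]
    congr 1
    · ext y; simp [hLe]
    · ext y z; simp [hLe]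
    · ext y; simp [hLe]
  have hC2 : ContDiff ℝ 1 fun z : ℝ × E3 => Q z.1 z.2 := contDiff_one_freeWave hu hu2 cu2 hv cv'
  -- Along this characteristic the wave is constant, and the line joins `(t, 0)` to the initial
  -- point `(0, t • e)`.
  have hconst : ∀ s, HasDerivAt (fun s => Q s ((t - s) • e)) 0 s := by
    intro s
    have hd := (hC2.differentiable (by norm_num) (s, (t - s) • e)).hasFDerivAt
    have hc : HasDerivAt (fun s : ℝ => (s, (t - s) • e)) ((1 : ℝ), -e) s := by
      refine (hasDerivAt_id s).prodMk ?_
      simpa using ((hasDerivAt_id s).const_sub t).smul_const e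
    have h := hd.comp_hasDerivAt s hc
    refine h.congr_deriv ?_
    set T := fderiv ℝ (fun z : ℝ × E3 => Q z.1 z.2) (s, (t - s) • e) with hT
    have t1 : T (1, 0) = P s ((t - s) • e) := by
      have := hd.comp_hasDerivAt s ((hasDerivAt_id s).prodMk (hasDerivAt_const s ((t - s) • e)))
      exact this.unique (dt s _)
    have t2 : T (0, e) = P s ((t - s) • e) := by
      have hp : HasFDerivAt (fun y : E3 => (s, y)) (ContinuousLinearMap.inr ℝ ℝ E3) ((t - s) • e) :=
        (hasFDerivAt_const s _).prodMk (hasFDerivAt_id _)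
      have := (hd.comp ((t - s) • e) hp).unique (dx s _)
      rw [← hdx, ← this]
      simp
    have : ((1 : ℝ), -e) = (1, 0) - (0, e) := by simp
    rw [this, map_sub, t1, t2, sub_self]
  have hd : Differentiable ℝ fun s => Q s ((t - s) • e) := fun s => (hconst s).differentiableAt
  have := is_const_of_deriv_eq_zero hd (fun s => (hconst s).deriv) t 0
  simp only [sub_self, zero_smul, sub_zero] at this
  rw [this, hQ, freeWave_zero, map_smul, hLe, smul_eq_mul, mul_one]

/-- Archimedes: a linear coordinate is uniformly distributed on the sphere. Kirchhoff's two terms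
are even and odd in time, so the even part of the plane wave is the time derivative of `t M_t G`;
integrating over `[0, 1]` gives the mean. -/
lemma sphMean_plane {G' G'' : ℝ → ℝ} (hG : ∀ s, HasDerivAt G (G' s) s)
    (hG' : ∀ s, HasDerivAt G' (G'' s) s) (hG'' : Continuous G'') (he : ‖e‖ = 1) :
    sphMean (fun y => G (innerSL ℝ e y)) 1 0 = (∫ s in (-1 : ℝ)..1, G s) / 2 := by
  have cG' : Continuous G' := continuous_iff_continuousAt.2 fun s => (hG' s).continuousAt
  have cG : Continuous G := continuous_iff_continuousAt.2 fun s => (hG s).continuousAt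
  have hD : ∀ t, kirD (fun y => G (innerSL ℝ e y)) (fun y => G' (innerSL ℝ e y) • innerSL ℝ e) t 0
      = (G t + G (-t)) / 2 := by
    intro t
    have h1 := freeWave_plane hG hG' hG'' he t
    have h2 := freeWave_plane hG hG' hG'' he (-t)
    rw [freeWave, kirD_neg, kir_neg] at h2
    rw [freeWave] at h1
    linarith
  have hk : ∀ t, HasDerivAt (fun t => kir (fun y => G (innerSL ℝ e y)) t 0) ((G t + G (-t)) / 2) t :=
    fun t => by
      rw [← hD]
      exact hasDerivAt_kir (hasFDerivAt_plane hG e) (by fun_prop) t 0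
  have hintg : IntervalIntegrable (fun t => (G t + G (-t)) / 2) volume 0 1 :=
    (by fun_prop : Continuous fun t => (G t + G (-t)) / 2).intervalIntegrable _ _
  have h := intervalIntegral.integral_eq_sub_of_hasDerivAt (fun t _ => hk t) hintg
  rw [kir_zero, sub_zero, kir, one_smul] at h
  rw [← h, intervalIntegral.integral_div, intervalIntegral.integral_add
    (cG.intervalIntegrable _ _) ((by fun_prop : Continuous fun t => G (-t)).intervalIntegrable _ _),
    intervalIntegral.integral_comp_neg, neg_zero, add_comm,
    intervalIntegral.integral_add_adjacent_intervals (cG.intervalIntegrable _ _)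
      (cG.intervalIntegrable _ _)]

/-- The normalised measure of a spherical zone is controlled by its height. -/
lemma sph_zone_le (he : ‖e‖ = 1) {α l : ℝ} (hl : 0 < l) :
    sph.real {θ | |⟪e, θ⟫_ℝ - α| ≤ l} ≤ 2 * l := by
  -- A smooth majorant of the indicator, since the formula for the mean needs two derivatives. Its
  -- integral is at most the length `4l` of its support, and the mean is half of that.
  let b : ContDiffBump α := ⟨l, 2 * l, hl, by linarith⟩
  have hb : ContDiff ℝ 2 b := b.contDiff
  have hb1 : ContDiff ℝ 1 (deriv b) := by
    have := (contDiff_succ_iff_deriv (n := 1) (f := b)).1 hb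
    exact this.2.2
  have h1 : ∀ s, HasDerivAt b (deriv b s) s := fun s =>
    (hb.differentiable (by norm_num) s).hasDerivAt
  have h2 : ∀ s, HasDerivAt (deriv b) (deriv (deriv b) s) s := fun s =>
    (hb1.differentiable (by norm_num) s).hasDerivAt
  have h3 : Continuous (deriv (deriv b)) := hb1.continuous_deriv (by norm_num)
  have hm := sphMean_plane h1 h2 h3 he
  have hcb : Continuous b := b.continuous
  have hI : ∫ s in (-1 : ℝ)..1, b s ≤ 4 * l := by
    rw [intervalIntegral.integral_of_le (by norm_num)]
    calc _ ≤ ∫ s, b s := setIntegral_le_integral b.integrable (Eventually.of_forall fun s => b.nonneg)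
      _ ≤ volume.real (Metric.closedBall α (2 * l)) :=
        b.integral_le_measure_closedBall volume
      _ = 4 * l := by
        rw [Measure.real, Real.volume_closedBall, ENNReal.toReal_ofReal (by positivity)]; ring
  have hset : MeasurableSet {θ : E3 | |⟪e, θ⟫_ℝ - α| ≤ l} :=
    (isClosed_le (by fun_prop) continuous_const).measurableSet
  calc sph.real {θ | |⟪e, θ⟫_ℝ - α| ≤ l}
      = ∫ θ, indicator {θ : E3 | |⟪e, θ⟫_ℝ - α| ≤ l} (fun _ => (1 : ℝ)) θ ∂sph := by
        rw [integral_indicator hset, setIntegral_const, smul_eq_mul, mul_one]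
    _ ≤ ∫ θ, b (innerSL ℝ e θ) ∂sph := by
        refine integral_mono_of_nonneg (Eventually.of_forall fun θ =>
          indicator_nonneg (fun _ _ => zero_le_one) _) (integrable_sph (by fun_prop))
          (Eventually.of_forall fun θ => ?_)
        by_cases h : θ ∈ {θ : E3 | |⟪e, θ⟫_ℝ - α| ≤ l}
        · rw [indicator_of_mem h]
          refine (b.one_of_mem_closedBall ?_).ge
          rw [Metric.mem_closedBall, Real.dist_eq]
          exact h
        · rw [indicator_of_notMem h]; exact b.nonneg
    _ = sphMean (fun y => b (innerSL ℝ e y)) 1 0 := by simp [sphMean]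
    _ ≤ 2 * l := by rw [hm]; linarith

end Caps

/-! ### The pulse profile and its radial and tangential derivatives. -/

section Pulse

variable {ε : ℝ} {h : E3 → ℝ}

lemma norm_pulse_arg {x : E3} (hε : 0 < ε) (h0 : x ≠ 0) (h1 : ‖x‖ < 1) :
    ‖((1 - ‖x‖) / ε) • (‖x‖⁻¹ • x)‖ = (1 - ‖x‖) / ε := by
  have hx := norm_pos_iff.2 h0
  rw [norm_smul, norm_smul, norm_inv, norm_norm, inv_mul_cancel₀ hx.ne', mul_one,
    Real.norm_of_nonneg (div_nonneg (by linarith) hε.le)]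

lemma pulse_eq_zero_of_lt (hε : 0 < ε) (hs : ∀ x, h x ≠ 0 → 1 ≤ ‖x‖ ∧ ‖x‖ ≤ 2) {x : E3}
    (hx : ‖x‖ < 1 - 2 * ε) : pulse ε h x = 0 := by
  unfold pulse
  split_ifs with h1
  · by_contra hne
    have hb := hs _ hne
    rcases eq_or_ne x 0 with rfl | h0
    · simp at hb; linarith
    · rw [norm_pulse_arg hε h0 h1, div_le_iff₀ hε] at hb
      linarith
  · rfl

lemma pulse_eq_zero_of_gt (hε : 0 < ε) (hs : ∀ x, h x ≠ 0 → 1 ≤ ‖x‖ ∧ ‖x‖ ≤ 2) {x : E3}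
    (hx : 1 - ε < ‖x‖) : pulse ε h x = 0 := by
  unfold pulse
  split_ifs with h1
  · by_contra hne
    have hb := hs _ hne
    rcases eq_or_ne x 0 with rfl | h0
    · simp at hb; linarith
    · rw [norm_pulse_arg hε h0 h1, le_div_iff₀ hε] at hb
      linarith
  · rfl

lemma pulse_eventuallyEq_zero (hε : 0 < ε) (hs : ∀ x, h x ≠ 0 → 1 ≤ ‖x‖ ∧ ‖x‖ ≤ 2) {x : E3}
    (hx : ¬(1 - 2 * ε ≤ ‖x‖ ∧ ‖x‖ ≤ 1 - ε)) : pulse ε h =ᶠ[𝓝 x] fun _ => 0 := by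
  rw [not_and_or, not_le, not_le] at hx
  rcases hx with hx | hx
  · filter_upwards [(isOpen_lt continuous_norm continuous_const).mem_nhds hx] with y hy
    exact pulse_eq_zero_of_lt hε hs hy
  · filter_upwards [(isOpen_lt continuous_const continuous_norm).mem_nhds hx] with y hy
    exact pulse_eq_zero_of_gt hε hs hy

/-- The map `r ω ↦ ((1 - r) / ε) ω`. -/
def pulseMap (ε : ℝ) (x : E3) : E3 := ε⁻¹ • (‖x‖⁻¹ • x - x)

lemma pulse_eventuallyEq {x : E3} (h0 : x ≠ 0) (h1 : ‖x‖ < 1) :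
    pulse ε h =ᶠ[𝓝 x] fun y => h (pulseMap ε y) := by
  filter_upwards [(isOpen_lt continuous_norm continuous_const).mem_nhds h1,
    isOpen_ne.mem_nhds h0] with y hy1 hy0
  have hy := norm_pos_iff.2 hy0
  rw [pulse, if_pos (show ‖y‖ < 1 from hy1), pulseMap]
  congr 1
  rw [smul_smul, show ε⁻¹ • (‖y‖⁻¹ • y - y) = (ε⁻¹ * (‖y‖⁻¹ - 1)) • y by module]
  congr 1
  field_simp

lemma contDiffAt_pulseMap {x : E3} (h0 : x ≠ 0) {n : WithTop ℕ∞} : ContDiffAt ℝ n (pulseMap ε) x := by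
  have hn : ContDiffAt ℝ n (fun y : E3 => ‖y‖⁻¹) x :=
    (contDiffAt_norm ℝ h0).inv (norm_ne_zero_iff.2 h0)
  exact ((hn.smul contDiffAt_id).sub contDiffAt_id).const_smul _

/-- The pulse vanishes near every point outside the shell `1 - 2ε ≤ |x| ≤ 1 - ε`, and for `ε < 1/4`
the shell stays away from the origin and from `|x| = 1`, where the polar formula breaks down. -/
lemma contDiff_pulse (hε : 0 < ε) (hε1 : ε < 1 / 4) {n : WithTop ℕ∞} (hh : ContDiff ℝ n h)
    (hs : ∀ x, h x ≠ 0 → 1 ≤ ‖x‖ ∧ ‖x‖ ≤ 2) : ContDiff ℝ n (pulse ε h) := by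
  rw [contDiff_iff_contDiffAt]
  intro x
  by_cases hx : 1 - 2 * ε ≤ ‖x‖ ∧ ‖x‖ ≤ 1 - ε
  · have h0 : x ≠ 0 := by
      rintro rfl
      rw [norm_zero] at hx; linarith [hx.1]
    refine ContDiffAt.congr_of_eventuallyEq ?_ (pulse_eventuallyEq h0 (by linarith [hx.2]))
    exact hh.contDiffAt.comp x (contDiffAt_pulseMap h0)
  · exact contDiffAt_const.congr_of_eventuallyEq (pulse_eventuallyEq_zero hε hs hx)

lemma hasFDerivAt_norm_inv {x : E3} (h0 : x ≠ 0) :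
    HasFDerivAt (fun y : E3 => ‖y‖⁻¹) (-(‖x‖ ^ 3)⁻¹ • innerSL ℝ x) x := by
  have hx := norm_pos_iff.2 h0
  have h1 := (hasStrictFDerivAt_norm_sq x).hasFDerivAt.sqrt (by positivity)
  simp only [Real.sqrt_sq (norm_nonneg _)] at h1
  have h2 := (hasDerivAt_inv hx.ne').comp_hasFDerivAt x h1
  refine h2.congr_fderiv ?_
  ext y
  simp
  field_simp

lemma fderiv_pulse_apply {x : E3} (h0 : x ≠ 0) (h1 : ‖x‖ < 1) (hh : Differentiable ℝ h) (η : E3) :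
    fderiv ℝ (pulse ε h) x η = fderiv ℝ h (pulseMap ε x)
      (ε⁻¹ • (‖x‖⁻¹ • η - ((‖x‖ ^ 3)⁻¹ * ⟪x, η⟫_ℝ) • x - η)) := by
  have hi := ((hasFDerivAt_norm_inv h0).fun_smul (hasFDerivAt_id x)).fun_sub (hasFDerivAt_id x)
  have hm : HasFDerivAt (pulseMap ε) _ x := hi.fun_const_smul ε⁻¹
  have hp := (hh (pulseMap ε x)).hasFDerivAt.comp x hm
  rw [(pulse_eventuallyEq h0 h1).fderiv_eq]
  erw [hp.fderiv]
  simp only [ContinuousLinearMap.comp_apply]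
  congr 1
  simp [sub_eq_add_neg]

lemma fderiv_pulse_eq_zero (hε : 0 < ε) (hs : ∀ x, h x ≠ 0 → 1 ≤ ‖x‖ ∧ ‖x‖ ≤ 2) {x : E3}
    (hx : ¬(1 - 2 * ε ≤ ‖x‖ ∧ ‖x‖ ≤ 1 - ε)) : fderiv ℝ (pulse ε h) x = 0 := by
  rw [(pulse_eventuallyEq_zero hε hs hx).fderiv_eq]
  simp

/-- Tangential vectors are stretched by `(1/r - 1)/ε`; on the shell `1 - r ≤ 2ε` and `r > 1/2`, so
this factor is at most `4`. No inverse power of `ε` is lost. -/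
lemma abs_fderiv_pulse_tangential_le (hε : 0 < ε) (hε1 : ε < 1 / 4) (hh : Differentiable ℝ h)
    (hs : ∀ x, h x ≠ 0 → 1 ≤ ‖x‖ ∧ ‖x‖ ≤ 2) (hb : ∀ x, ‖fderiv ℝ h x‖ ≤ 1) {x η : E3}
    (hη : ⟪x, η⟫_ℝ = 0) : |fderiv ℝ (pulse ε h) x η| ≤ 4 * ‖η‖ := by
  by_cases hx : 1 - 2 * ε ≤ ‖x‖ ∧ ‖x‖ ≤ 1 - ε
  · have hr : 1 / 2 < ‖x‖ := by linarith [hx.1]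
    have h0 : x ≠ 0 := norm_pos_iff.1 (by linarith)
    rw [fderiv_pulse_apply h0 (by linarith [hx.2]) hh, hη, mul_zero, zero_smul, sub_zero]
    refine ((fderiv ℝ h (pulseMap ε x)).le_opNorm _).trans ?_
    rw [show ε⁻¹ • (‖x‖⁻¹ • η - η) = (ε⁻¹ * (‖x‖⁻¹ - 1)) • η by module, norm_smul]
    have hp : 0 ≤ ε⁻¹ * (‖x‖⁻¹ - 1) := by
      have : 1 ≤ ‖x‖⁻¹ := (one_le_inv₀ (by linarith)).2 (by linarith [hx.2])
      have := inv_pos.2 hε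
      exact mul_nonneg this.le (by linarith)
    have hq : ε⁻¹ * (‖x‖⁻¹ - 1) ≤ 4 := by
      rw [inv_mul_le_iff₀ hε, sub_le_iff_le_add, inv_le_iff_one_le_mul₀ (by linarith)]
      nlinarith [hx.1]
    rw [Real.norm_of_nonneg hp]
    calc _ ≤ 1 * (4 * ‖η‖) := by gcongr; exact hb _
      _ = _ := one_mul _
  · rw [fderiv_pulse_eq_zero hε hs hx]
    simp

/-- On the shell `pulseMap` sends the radial unit vector to `-ε⁻¹` times itself, so the full factor
`ε⁻¹` is lost in this direction. -/
lemma abs_fderiv_pulse_radial_le (hε : 0 < ε) (hε1 : ε < 1 / 4) (hh : Differentiable ℝ h)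
    (hs : ∀ x, h x ≠ 0 → 1 ≤ ‖x‖ ∧ ‖x‖ ≤ 2) (hb : ∀ x, ‖fderiv ℝ h x‖ ≤ 1) (x : E3) :
    |fderiv ℝ (pulse ε h) x (‖x‖⁻¹ • x)| ≤ ε⁻¹ := by
  by_cases hx : 1 - 2 * ε ≤ ‖x‖ ∧ ‖x‖ ≤ 1 - ε
  · have hr : 1 / 2 < ‖x‖ := by linarith [hx.1]
    have hr' : ‖x‖ ≠ 0 := by linarith
    have h0 : x ≠ 0 := norm_pos_iff.1 (by linarith)
    rw [fderiv_pulse_apply h0 (by linarith [hx.2]) hh]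
    refine ((fderiv ℝ h (pulseMap ε x)).le_opNorm _).trans ?_
    have e : ε⁻¹ • (‖x‖⁻¹ • (‖x‖⁻¹ • x) - ((‖x‖ ^ 3)⁻¹ * ⟪x, ‖x‖⁻¹ • x⟫_ℝ) • x - ‖x‖⁻¹ • x)
        = -(ε⁻¹ • (‖x‖⁻¹ • x)) := by
      rw [real_inner_smul_right, real_inner_self_eq_norm_sq, smul_smul ‖x‖⁻¹,
        show (‖x‖ ^ 3)⁻¹ * (‖x‖⁻¹ * ‖x‖ ^ 2) = ‖x‖⁻¹ * ‖x‖⁻¹ by field_simp, sub_self, zero_sub,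
        smul_neg]
    rw [e, norm_neg, norm_smul, norm_smul, norm_inv ε, norm_inv ‖x‖, norm_norm, inv_mul_cancel₀ hr', mul_one,
      Real.norm_of_nonneg hε.le]
    have := inv_pos.2 hε
    calc _ ≤ 1 * ε⁻¹ := by gcongr; exact hb _
      _ = _ := one_mul _
  · rw [fderiv_pulse_eq_zero hε hs hx]
    simp [hε.le]

end Pulse

/-! ### Kirchhoff's integrand for pulse data and the geometry of the shell. -/

section PulseData

variable {ε : ℝ} {h₀ h₁ : E3 → ℝ}

lemma multiDeriv_zero (f : E3 → ℝ) : multiDeriv 0 f = f := rfl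

lemma multiDeriv_unitIndex {f : E3 → ℝ} (hf : ContDiff ℝ 1 f) (a : Fin 3) :
    multiDeriv (unitIndex a) f = partialDeriv a f := by
  have := multiDeriv_partialDeriv (I := 0) (f := f) (by simpa [order_zero] using hf) a
  rw [zero_add] at this
  rw [← this, multiDeriv_zero]

namespace IsPulseProfile

lemma abs_le_one₀ (hp : IsPulseProfile ε h₀ h₁) (x : E3) : |h₀ x| ≤ 1 := by
  refine le_trans ?_ (hp.bound x)
  refine le_trans ?_ (le_add_of_nonneg_right (Finset.sum_nonneg fun _ _ => abs_nonneg _))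
  exact Finset.single_le_sum (f := fun I => |multiDeriv I h₀ x|) (fun _ _ => abs_nonneg _)
    (mem_multiIndicesUpTo.2 (by rw [order_zero]; omega) : (0 : MultiIndex) ∈ multiIndicesUpTo 6)

lemma norm_fderiv_le_one (hp : IsPulseProfile ε h₀ h₁) (x : E3) : ‖fderiv ℝ h₀ x‖ ≤ 1 := by
  refine le_trans ?_ (hp.bound x)
  refine le_trans ?_ (le_add_of_nonneg_right (Finset.sum_nonneg fun _ _ => abs_nonneg _))
  refine (norm_clm_le_sum _).trans ?_
  have hinj : Set.InjOn (fun a : Fin 3 => unitIndex a) (Finset.univ : Finset (Fin 3)) := by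
    intro a _ b _ hab
    by_contra hne
    have := congrFun hab a
    simp [hne] at this
  have e : ∑ a, ‖fderiv ℝ h₀ x (basisVec a)‖ =
      ∑ I ∈ Finset.univ.image (fun a : Fin 3 => unitIndex a), |multiDeriv I h₀ x| := by
    rw [Finset.sum_image hinj]
    refine Finset.sum_congr rfl fun a _ => ?_
    rw [multiDeriv_unitIndex (hp.contDiff₀.of_le (by norm_num))]
    rfl
  rw [e]
  refine Finset.sum_le_sum_of_subset_of_nonneg (fun I hI => ?_) fun _ _ _ => abs_nonneg _
  obtain ⟨a, -, rfl⟩ := Finset.mem_image.1 hI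
  exact mem_multiIndicesUpTo.2 (by rw [order_unitIndex]; omega)

end IsPulseProfile

lemma abs_pulse_le {h : E3 → ℝ} (hb : ∀ x, |h x| ≤ 1) (x : E3) : |pulse ε h x| ≤ 1 := by
  unfold pulse
  split_ifs
  · exact hb _
  · simp

lemma contDiff_pulseData₀ (hε : 0 < ε) (hε1 : ε < 1 / 4) (hp : IsPulseProfile ε h₀ h₁) :
    ContDiff ℝ 6 (pulseData₀ ε h₀) :=
  contDiff_const.mul (contDiff_pulse hε hε1 hp.contDiff₀ hp.support₀)

lemma contDiff_pulseData₁ (hε : 0 < ε) (hε1 : ε < 1 / 4) (hp : IsPulseProfile ε h₀ h₁) :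
    ContDiff ℝ 5 (pulseData₁ ε h₁) :=
  contDiff_const.mul (contDiff_pulse hε hε1 hp.contDiff₁ hp.support₁)

lemma fderiv_pulseData₀ (hε : 0 < ε) (hε1 : ε < 1 / 4) (hp : IsPulseProfile ε h₀ h₁) (x : E3) :
    fderiv ℝ (pulseData₀ ε h₀) x = ε ^ (1 / 2 : ℝ) • fderiv ℝ (pulse ε h₀) x :=
  fderiv_const_mul ((contDiff_pulse hε hε1 hp.contDiff₀ hp.support₀).differentiable (by norm_num) x) _

lemma norm_tangential_sq {θ e : E3} (hθ : ‖θ‖ = 1) (he : ‖e‖ = 1) :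
    ‖θ - ⟪e, θ⟫_ℝ • e‖ ^ 2 = 1 - ⟪e, θ⟫_ℝ ^ 2 := by
  rw [norm_sub_sq_real, real_inner_smul_right, norm_smul, hθ, he, real_inner_comm θ e,
    Real.norm_eq_abs, mul_one, sq_abs]
  ring

set_option maxHeartbeats 800000 in
/-- The integrand in Kirchhoff's formula for pulse data. -/
lemma abs_pulse_integrand_le (hε : 0 < ε) (hε1 : ε < 1 / 4) (hp : IsPulseProfile ε h₀ h₁)
    {x θ : E3} (hθ : ‖θ‖ = 1) {t : ℝ} (ht : 0 ≤ t) :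
    |pulseData₀ ε h₀ (x + t • θ) + t * fderiv ℝ (pulseData₀ ε h₀) (x + t • θ) θ
      + t * pulseData₁ ε h₁ (x + t • θ)| ≤
    indicator {θ : E3 | 1 - 2 * ε ≤ ‖x + t • θ‖ ∧ ‖x + t • θ‖ ≤ 1 - ε} (fun _ =>
      ε ^ (1 / 2 : ℝ) * (1 + t + 4 * ‖x‖) + ε ^ (-(1 / 2) : ℝ) * min (‖x‖ ^ 2) (2 * t)) θ := by
  set y := x + t • θ with hy
  set s := ε ^ (1 / 2 : ℝ) with hs
  have hs0 : 0 < s := Real.rpow_pos_of_pos hε _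
  have hsi : ε ^ (-(1 / 2) : ℝ) = s⁻¹ := Real.rpow_neg hε.le _
  have hss : s * ε⁻¹ = s⁻¹ := by
    have : s * s = ε := by rw [hs, ← Real.rpow_add hε]; norm_num
    rw [← this]; field_simp
  by_cases hS : 1 - 2 * ε ≤ ‖y‖ ∧ ‖y‖ ≤ 1 - ε
  swap
  · have hS' : θ ∉ {θ : E3 | 1 - 2 * ε ≤ ‖x + t • θ‖ ∧ ‖x + t • θ‖ ≤ 1 - ε} := hS
    rw [indicator_of_notMem hS', pulseData₀, pulseData₁,
      (pulse_eventuallyEq_zero hε hp.support₀ hS).self_of_nhds,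
      (pulse_eventuallyEq_zero hε hp.support₁ hS).self_of_nhds, fderiv_pulseData₀ hε hε1 hp,
      fderiv_pulse_eq_zero hε hp.support₀ hS]
    simp
  rw [indicator_of_mem (by exact hS), hsi]
  set r := ‖y‖ with hr
  have hr1 : 1 / 2 < r := by linarith [hS.1]
  have hr0 : r ≠ 0 := by linarith
  set e := r⁻¹ • y with he
  have hye : y = r • e := by rw [he, smul_inv_smul₀ hr0]
  have hen : ‖e‖ = 1 := by
    rw [he, norm_smul, norm_inv, Real.norm_of_nonneg (by linarith), inv_mul_cancel₀ hr0]
  set c := ⟪e, θ⟫_ℝ with hc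
  set η := θ - c • e with hη
  have hc1 : |c| ≤ 1 := by
    have := abs_real_inner_le_norm e θ
    rwa [hen, hθ, one_mul] at this
  have hηn : ‖η‖ ^ 2 = 1 - c ^ 2 := norm_tangential_sq hθ hen
  have horth : ⟪y, η⟫_ℝ = 0 := by
    rw [hye, hη, real_inner_smul_left, inner_sub_right, real_inner_smul_right,
      real_inner_self_eq_norm_sq, hen, ← hc]
    ring
  have hxsq : ‖x‖ ^ 2 = r ^ 2 - 2 * t * r * c + t ^ 2 := by
    have : x = y - t • θ := by rw [hy]; abel
    rw [this, norm_sub_sq_real, real_inner_smul_right, norm_smul, hθ, ← hr,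
      Real.norm_of_nonneg ht]
    conv_lhs => rw [hye]
    rw [real_inner_smul_left, ← hc]
    ring
  have hlt := (abs_le.1 hc1)
  have h1c : 0 ≤ t * (1 - c) := mul_nonneg ht (by linarith)
  -- The law of cosines reads `|x|² = (r - t)² + 2 r t (1 - c)`, and `2r > 1` on the shell.
  have b1 : t * (1 - c) ≤ min (‖x‖ ^ 2) (2 * t) := by
    refine le_min ?_ (by nlinarith)
    rw [hxsq]
    nlinarith [sq_nonneg (r - t)]
  -- Here `t|η|` is the distance from `x` to the line through the origin and `y`.
  have b2 : t * ‖η‖ ≤ ‖x‖ := by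
    refine abs_le_of_sq_le_sq' ?_ (norm_nonneg x) |>.2
    rw [mul_pow, hηn, hxsq]
    nlinarith [sq_nonneg (r - t * c)]
  set D := fderiv ℝ (pulseData₀ ε h₀) y with hD
  have hDe : D = s • fderiv ℝ (pulse ε h₀) y := fderiv_pulseData₀ hε hε1 hp y
  have hdh : Differentiable ℝ h₀ := hp.contDiff₀.differentiable (by norm_num)
  have d1 : |D e| ≤ s⁻¹ := by
    rw [hDe, _root_.smul_apply, smul_eq_mul, abs_mul, abs_of_pos hs0, ← hss]
    exact mul_le_mul_of_nonneg_left
      (abs_fderiv_pulse_radial_le hε hε1 hdh hp.support₀ hp.norm_fderiv_le_one y) hs0.le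
  have d2 : |D η| ≤ s * (4 * ‖η‖) := by
    rw [hDe, _root_.smul_apply, smul_eq_mul, abs_mul, abs_of_pos hs0]
    exact mul_le_mul_of_nonneg_left
      (abs_fderiv_pulse_tangential_le hε hε1 hdh hp.support₀ hp.norm_fderiv_le_one horth) hs0.le
  have d3 : |pulseData₁ ε h₁ y + D e| ≤ s := hp.outgoing y
  have d0 : |pulseData₀ ε h₀ y| ≤ s := by
    rw [pulseData₀, abs_mul, ← hs, abs_of_pos hs0]
    exact mul_le_of_le_one_right hs0.le (abs_pulse_le hp.abs_le_one₀ y)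
  have hDθ : D θ = c * D e + D η := by
    have h : θ = c • e + η := by rw [hη]; abel
    calc D θ = D (c • e + η) := by rw [← h]
      _ = D (c • e) + D η := map_add _ _ _
      _ = c * D e + D η := congrArg (· + D η) (D.map_smul c e)
  -- The direction `θ` of the sphere is compared with the radial direction `e` at `y`: replacing one
  -- by the other produces the small combination `w₁ + ∂_r w₀`, a radial error with factor `1 - c`,
  -- and a harmless tangential term.
  have hsplit : pulseData₀ ε h₀ y + t * D θ + t * pulseData₁ ε h₁ y
      = pulseData₀ ε h₀ y + t * (pulseData₁ ε h₁ y + D e) - t * (1 - c) * D e + t * D η := by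
    rw [hDθ]; ring
  rw [hsplit]
  have a1 : |t * (pulseData₁ ε h₁ y + D e)| ≤ t * s := by
    rw [abs_mul, abs_of_nonneg ht]; gcongr
  have a2 : |t * (1 - c) * D e| ≤ min (‖x‖ ^ 2) (2 * t) * s⁻¹ := by
    rw [abs_mul, abs_of_nonneg h1c]
    gcongr
  have a3 : |t * D η| ≤ 4 * s * ‖x‖ := by
    rw [abs_mul, abs_of_nonneg ht]
    calc t * |D η| ≤ t * (s * (4 * ‖η‖)) := by gcongr
      _ = 4 * s * (t * ‖η‖) := by ring
      _ ≤ _ := by gcongr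
  clear_value D s e c η r
  have := abs_add_le (pulseData₀ ε h₀ y + t * (pulseData₁ ε h₁ y + D e) - t * (1 - c) * D e) (t * D η)
  have := abs_sub (pulseData₀ ε h₀ y + t * (pulseData₁ ε h₁ y + D e)) (t * (1 - c) * D e)
  have := abs_add_le (pulseData₀ ε h₀ y) (t * (pulseData₁ ε h₁ y + D e))
  linarith

/-- The sphere of radius `t` about `x` meets the support of the pulse in a small set. -/
lemma sph_shell_le (hε : 0 < ε) (hε1 : ε < 1 / 4) (x : E3) {t : ℝ} (ht : 0 ≤ t) :
    sph.real {θ : E3 | 1 - 2 * ε ≤ ‖x + t • θ‖ ∧ ‖x + t • θ‖ ≤ 1 - ε} * (t * ‖x‖) ≤ ε := by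
  rcases ht.eq_or_lt with rfl | ht
  · simpa using hε.le
  rcases eq_or_ne x 0 with rfl | hx
  · simpa using hε.le
  have hx0 := norm_pos_iff.2 hx
  set e := ‖x‖⁻¹ • x with he
  have hen : ‖e‖ = 1 := by rw [he, norm_smul, norm_inv, norm_norm, inv_mul_cancel₀ hx0.ne']
  -- `|x + tθ|²` is affine in the coordinate of `θ` along `x`, so the shell cuts out a spherical
  -- zone; `α` is its centre, and its half-height is at most `ε / (2 t|x|)`.
  set α := (((1 - 2 * ε) ^ 2 + (1 - ε) ^ 2) / 2 - ‖x‖ ^ 2 - t ^ 2) / (2 * t * ‖x‖) with hα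
  have hl : 0 < ε / (2 * (t * ‖x‖)) := by positivity
  have hz := sph_zone_le hen (α := α) hl
  have hsub : sph.real {θ : E3 | 1 - 2 * ε ≤ ‖x + t • θ‖ ∧ ‖x + t • θ‖ ≤ 1 - ε} ≤
      sph.real {θ | |⟪e, θ⟫_ℝ - α| ≤ ε / (2 * (t * ‖x‖))} := by
    refine ENNReal.toReal_mono (measure_ne_top _ _) (measure_mono_ae ?_)
    filter_upwards [ae_sph_norm] with θ hθ hS
    have hS : 1 - 2 * ε ≤ ‖x + t • θ‖ ∧ ‖x + t • θ‖ ≤ 1 - ε := hS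
    change |⟪e, θ⟫_ℝ - α| ≤ _
    have hn : ‖x + t • θ‖ ^ 2 = ‖x‖ ^ 2 + 2 * t * ‖x‖ * ⟪e, θ⟫_ℝ + t ^ 2 := by
      rw [norm_add_sq_real, real_inner_smul_right, norm_smul, hθ, he, real_inner_smul_left,
        Real.norm_of_nonneg ht.le]
      field_simp
    have e1 : ⟪e, θ⟫_ℝ - α = (‖x + t • θ‖ ^ 2 - ((1 - 2 * ε) ^ 2 + (1 - ε) ^ 2) / 2)
        / (2 * t * ‖x‖) := by
      rw [hn, hα]; field_simp; ring
    rw [e1, abs_div, abs_of_pos (by positivity : 0 < 2 * t * ‖x‖),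
      show 2 * (t * ‖x‖) = 2 * t * ‖x‖ by ring]
    gcongr
    have l1 : (1 - 2 * ε) ^ 2 ≤ ‖x + t • θ‖ ^ 2 := by gcongr; linarith; exact hS.1
    have l2 : ‖x + t • θ‖ ^ 2 ≤ (1 - ε) ^ 2 := by gcongr; exact hS.2
    rw [abs_le]
    constructor <;> nlinarith
  calc _ ≤ 2 * (ε / (2 * (t * ‖x‖))) * (t * ‖x‖) := by
        gcongr; exact hsub.trans hz
    _ = ε := by field_simp

end PulseData

/-! ### The free evolution of pulse data. -/

section PulseBound

variable {ε : ℝ} {h₀ h₁ : E3 → ℝ}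

lemma le_wt_quarter {a : ℝ} {x : E3} (ha : 0 < a) (h : 1 + ε ^ 2 * ‖x‖ ^ 2 ≤ a ^ 4) :
    a⁻¹ ≤ wt (1 / 4) ε x := by
  have hb := one_le_base ε x
  calc a⁻¹ = (a ^ 4) ^ (-(1 / 4) : ℝ) := by
        rw [← Real.rpow_natCast, ← Real.rpow_mul ha.le, ← Real.rpow_neg_one]; norm_num
    _ ≤ _ := Real.rpow_le_rpow_of_nonpos (by linarith) h (by norm_num)

lemma freeWave_eq_integral {u v : E3 → ℝ} {u' : E3 → E3 →L[ℝ] ℝ} (hu : Continuous u)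
    (hu' : Continuous u') (hv : Continuous v) (t : ℝ) (x : E3) :
    freeWave u u' v t x = ∫ θ, (u (x + t • θ) + t * u' (x + t • θ) θ + t * v (x + t • θ)) ∂sph := by
  have i1 : Integrable (fun θ => u (x + t • θ)) sph := integrable_sph (by fun_prop)
  have i2 : Integrable (fun θ => t * u' (x + t • θ) θ) sph := integrable_sph (by fun_prop)
  have i3 : Integrable (fun θ => t * v (x + t • θ)) sph := integrable_sph (by fun_prop)
  have i4 : Integrable (fun θ => u (x + t • θ) + t * u' (x + t • θ) θ) sph := i1.add i2
  rw [integral_add i4 i3, integral_add i1 i2, integral_const_mul, integral_const_mul]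
  rfl

/-- Here `φ` is the fraction of the sphere inside the shell, `X = |x|`, `s = ε^{1/2}`, and `W` is
the weight. For `X ≤ 2` either `t` or `X` is at least `1/4`, and the minimum is estimated by `X²` or
`2t` accordingly. For `X > 2` one has `t ≥ X/2`, so `φ ≤ 2ε/X²`, and a factor `1/X ≤ W` is gained.
-/
lemma pulse_numeric {φ t X s W ε : ℝ} (hs : 0 < s) (hsε : s * s = ε) (hε1 : ε < 1 / 4) (h0 : 0 ≤ φ)
    (h1 : φ ≤ 1) (hX : 0 ≤ X) (ht : 0 ≤ t) (hφ : φ * (t * X) ≤ ε)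
    (hW1 : X ≤ 2 → 2⁻¹ ≤ W) (hW2 : 2 < X → X⁻¹ ≤ W) (a1 : t ≤ X + 1) (a2 : X ≤ t + 1)
    (a3 : 1 / 2 ≤ X + t) :
    φ * (s * (1 + t + 4 * X) + s⁻¹ * min (X ^ 2) (2 * t)) ≤ 40 * s * W := by
  have hsi : s⁻¹ * ε = s := by rw [← hsε]; field_simp
  have hsi0 := inv_pos.2 hs
  rcases le_or_gt X 2 with h | h
  · have hW' := hW1 h
    have b1 : φ * (s * (1 + t + 4 * X)) ≤ 12 * s := by
      have : s * (1 + t + 4 * X) ≤ s * 12 := by gcongr; linarith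
      calc φ * (s * (1 + t + 4 * X)) ≤ 1 * (s * 12) := by gcongr
        _ = 12 * s := by ring
    have b2 : φ * min (X ^ 2) (2 * t) ≤ 8 * ε := by
      rcases le_or_gt (1 / 4) t with ht' | ht'
      · calc φ * min (X ^ 2) (2 * t) ≤ φ * X ^ 2 := by gcongr; exact min_le_left _ _
          _ ≤ φ * X ^ 2 * (4 * t) := le_mul_of_one_le_right (by positivity) (by linarith)
          _ = 4 * X * (φ * (t * X)) := by ring
          _ ≤ 4 * 2 * ε := by gcongr
          _ = 8 * ε := by ring
      · have hX' : 1 / 4 ≤ X := by linarith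
        calc φ * min (X ^ 2) (2 * t) ≤ φ * (2 * t) := by gcongr; exact min_le_right _ _
          _ ≤ φ * (2 * t) * (4 * X) := le_mul_of_one_le_right (by positivity) (by linarith)
          _ = 8 * (φ * (t * X)) := by ring
          _ ≤ 8 * ε := by gcongr
    have b3 : φ * (s⁻¹ * min (X ^ 2) (2 * t)) ≤ 8 * s := by
      calc _ = s⁻¹ * (φ * min (X ^ 2) (2 * t)) := by ring
        _ ≤ s⁻¹ * (8 * ε) := by gcongr
        _ = 8 * (s⁻¹ * ε) := by ring
        _ = 8 * s := by rw [hsi]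
    have b4 : 40 * s * 2⁻¹ ≤ 40 * s * W := by gcongr
    rw [mul_add]
    linarith
  · have hW' := hW2 h
    have hXp : 0 < X := by linarith
    have c1 : φ * X ^ 2 ≤ 2 * ε := by
      have : φ * (X / 2 * X) ≤ φ * (t * X) := by gcongr; linarith
      nlinarith
    have b1 : φ * (s * (1 + t + 4 * X)) * X ≤ 4 * s := by
      calc φ * (s * (1 + t + 4 * X)) * X ≤ φ * (s * (7 * X)) * X := by gcongr; linarith
        _ = 7 * s * (φ * X ^ 2) := by ring
        _ ≤ 7 * s * (2 * (1 / 4)) :=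
          mul_le_mul_of_nonneg_left (by linarith) (by positivity)
        _ ≤ 4 * s := by linarith
    have b2 : φ * (s⁻¹ * min (X ^ 2) (2 * t)) * X ≤ 2 * s := by
      calc φ * (s⁻¹ * min (X ^ 2) (2 * t)) * X ≤ φ * (s⁻¹ * (2 * t)) * X := by
            gcongr; exact min_le_right _ _
        _ = 2 * s⁻¹ * (φ * (t * X)) := by ring
        _ ≤ 2 * s⁻¹ * ε := by gcongr
        _ = 2 * s := by rw [mul_assoc, hsi]
    calc _ = (φ * (s * (1 + t + 4 * X)) * X + φ * (s⁻¹ * min (X ^ 2) (2 * t)) * X) * X⁻¹ := by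
          field_simp
      _ ≤ (4 * s + 2 * s) * X⁻¹ := by gcongr
      _ ≤ 40 * s * X⁻¹ := by gcongr; linarith
      _ ≤ _ := by gcongr

/-- The free evolution of pulse data is of size `ε^{1/2}`. -/
lemma abs_freeWave_pulse_le (hε : 0 < ε) (hε1 : ε < 1 / 4) (hp : IsPulseProfile ε h₀ h₁) {t : ℝ}
    (ht : 0 ≤ t) (x : E3) :
    |freeWave (pulseData₀ ε h₀) (fderiv ℝ (pulseData₀ ε h₀)) (pulseData₁ ε h₁) t x|
      ≤ 40 * ε ^ (1 / 2 : ℝ) * wt (1 / 4) ε x := by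
  have c0 := contDiff_pulseData₀ hε hε1 hp
  have c1 := contDiff_pulseData₁ hε hε1 hp
  have cd : Continuous (fderiv ℝ (pulseData₀ ε h₀)) := c0.continuous_fderiv (by norm_num)
  rw [freeWave_eq_integral c0.continuous cd c1.continuous]
  set S := {θ : E3 | 1 - 2 * ε ≤ ‖x + t • θ‖ ∧ ‖x + t • θ‖ ≤ 1 - ε} with hS
  set b := ε ^ (1 / 2 : ℝ) * (1 + t + 4 * ‖x‖) + ε ^ (-(1 / 2) : ℝ) * min (‖x‖ ^ 2) (2 * t) with hb
  have hcn : Continuous fun θ : E3 => ‖x + t • θ‖ := by fun_prop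
  have hSm : MeasurableSet S :=
    ((isClosed_le continuous_const hcn).inter (isClosed_le hcn continuous_const)).measurableSet
  have hintg : Integrable (S.indicator fun _ => b) sph :=
    (integrable_const b).indicator hSm
  have hle : |∫ θ, (pulseData₀ ε h₀ (x + t • θ) + t * fderiv ℝ (pulseData₀ ε h₀) (x + t • θ) θ
      + t * pulseData₁ ε h₁ (x + t • θ)) ∂sph| ≤ sph.real S * b := by
    rw [← Real.norm_eq_abs]
    refine (norm_integral_le_of_norm_le hintg ?_).trans_eq ?_
    · filter_upwards [ae_sph_norm] with θ hθ
      exact abs_pulse_integrand_le hε hε1 hp hθ ht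
    · rw [integral_indicator hSm, setIntegral_const, smul_eq_mul]
  refine hle.trans ?_
  set s := ε ^ (1 / 2 : ℝ) with hs
  have hs0 : 0 < s := Real.rpow_pos_of_pos hε _
  have hsi : ε ^ (-(1 / 2) : ℝ) = s⁻¹ := Real.rpow_neg hε.le _
  have hss : s * s = ε := by rw [hs, ← Real.rpow_add hε]; norm_num
  have hW := wt_pos (1 / 4) ε x
  -- If the sphere about `x` misses the shell, the wave vanishes at `(t, x)`. Otherwise a common
  -- point makes `|x|` and `t` comparable by the triangle inequality, as the numerical estimate
  -- requires.
  by_cases hne : ∃ θ : E3, ‖θ‖ = 1 ∧ θ ∈ S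
  swap
  · have hz : sph.real S = 0 := by
      rw [measureReal_def, measure_eq_zero_iff_ae_notMem.2, ENNReal.toReal_zero]
      filter_upwards [ae_sph_norm] with θ hθ hmem using hne ⟨θ, hθ, hmem⟩
    rw [hz, zero_mul]; positivity
  obtain ⟨θ, hθ, hθS⟩ := hne
  have htθ : ‖t • θ‖ = t := by rw [norm_smul, hθ, mul_one, Real.norm_of_nonneg ht]
  have n1 := norm_add_le x (t • θ)
  have n2 := norm_sub_norm_le x (-(t • θ))
  have n3 := norm_sub_norm_le (t • θ) (-x)
  rw [norm_neg, sub_neg_eq_add, htθ] at n2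
  rw [norm_neg, sub_neg_eq_add, htθ, add_comm (t • θ)] at n3
  rw [htθ] at n1
  rw [hb, hsi]
  refine pulse_numeric hs0 hss hε1 measureReal_nonneg measureReal_le_one (norm_nonneg x) ht
    (sph_shell_le hε hε1 x ht) (fun hX => le_wt_quarter (by norm_num) ?_)
    (fun hX => le_wt_quarter (by linarith) ?_) ?_ ?_ ?_
  · have : ε ^ 2 * ‖x‖ ^ 2 ≤ 1 ^ 2 * 2 ^ 2 := by gcongr; linarith
    linarith
  · have : ε ^ 2 * ‖x‖ ^ 2 ≤ 1 ^ 2 * ‖x‖ ^ 2 := by gcongr; linarith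
    have h4 : 2 ^ 2 * ‖x‖ ^ 2 ≤ ‖x‖ ^ 2 * ‖x‖ ^ 2 := by gcongr
    nlinarith
  · linarith [hθS.2]
  · linarith [hθS.2]
  · linarith [hθS.1]

lemma hasCompactSupport_pulse {h : E3 → ℝ} (hε : 0 < ε)
    (hs : ∀ x, h x ≠ 0 → 1 ≤ ‖x‖ ∧ ‖x‖ ≤ 2) : HasCompactSupport (pulse ε h) := by
  refine HasCompactSupport.intro (isCompact_closedBall (0 : E3) 1) fun x hx => ?_
  refine pulse_eq_zero_of_gt hε hs ?_
  rw [Metric.mem_closedBall, dist_zero_right, not_le] at hx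
  linarith

lemma hasCompactSupport_multiDeriv {f : E3 → ℝ} (hf : HasCompactSupport f) (I : MultiIndex) :
    HasCompactSupport (multiDeriv I f) := by
  have key : ∀ (a : Fin 3) (n : ℕ) {g : E3 → ℝ}, HasCompactSupport g →
      HasCompactSupport ((partialDeriv a)^[n] g) := by
    intro a n
    induction n with
    | zero => intro g hg; exact hg
    | succ n ih =>
      intro g hg
      rw [Function.iterate_succ_apply']
      exact (ih hg).fderiv_apply ℝ _
  exact key 0 _ (key 1 _ (key 2 _ hf))

lemma dataFamily_of_hasCompactSupport {f g : E3 → ℝ} (hf : ContDiff ℝ (6 : ℕ) f)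
    (hg : ContDiff ℝ (5 : ℕ) g)
    (hfc : HasCompactSupport f) (hgc : HasCompactSupport g) :
    DataFamily ε (fun I => multiDeriv I f) fun I => multiDeriv I g := by
  have key : ∀ {k : E3 → ℝ}, Continuous k → HasCompactSupport k →
      Integrable fun y => wt (-1) ε y * k y ^ 2 := by
    intro k hk hkc
    have := continuous_wt (-1) ε
    refine Continuous.integrable_of_hasCompactSupport (by fun_prop) ?_
    exact HasCompactSupport.mul_left (hkc.comp_left (g := fun y : ℝ => y ^ 2) (by simp))
  refine ⟨fun I hI => hasPartials_multiDeriv (hf.of_le (by norm_cast; omega)),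
    fun I hI => hasPartials_multiDeriv (hg.of_le (by norm_cast; omega)),
    fun I _ hI => key ?_ (hasCompactSupport_multiDeriv hfc I),
    fun I hI => key ?_ (hasCompactSupport_multiDeriv hgc I)⟩
  · exact (contDiff_multiDeriv (n := 0) (hf.of_le (by norm_cast; omega))).continuous
  · exact (contDiff_multiDeriv (n := 0) (hg.of_le (by norm_cast; omega))).continuous

lemma dataFamily_pulse (hε : 0 < ε) (hε1 : ε < 1 / 4) (hp : IsPulseProfile ε h₀ h₁) :
    DataFamily ε (fun I => multiDeriv I (pulseData₀ ε h₀))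
      fun I => multiDeriv I (pulseData₁ ε h₁) :=
  dataFamily_of_hasCompactSupport (contDiff_pulseData₀ hε hε1 hp) (contDiff_pulseData₁ hε hε1 hp)
    (HasCompactSupport.mul_left (hasCompactSupport_pulse hε hp.support₀))
    (HasCompactSupport.mul_left (hasCompactSupport_pulse hε hp.support₁))

end PulseBound

/-! ### Superposition, initial time `1`, and differences of solutions. -/

section Cauchy

lemma freeWave_add {u v k l : E3 → ℝ} {u' k' : E3 → E3 →L[ℝ] ℝ} (hu : Continuous u)
    (hu' : Continuous u') (hv : Continuous v) (hk : Continuous k) (hk' : Continuous k')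
    (hl : Continuous l) (t : ℝ) (x : E3) :
    freeWave (fun y => u y + k y) (fun y => u' y + k' y) (fun y => v y + l y) t x
      = freeWave u u' v t x + freeWave k k' l t x := by
  rw [freeWave_eq_integral (by fun_prop) (by fun_prop) (by fun_prop),
    freeWave_eq_integral hu hu' hv, freeWave_eq_integral hk hk' hl,
    ← integral_add (integrable_sph (by fun_prop)) (integrable_sph (by fun_prop))]
  refine integral_congr_ae (Eventually.of_forall fun θ => ?_)
  simp only [_root_.add_apply]
  ring

lemma negBox_comp_sub_const (Ψ : ℝ → E3 → ℝ) (a t : ℝ) (x : E3) :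
    negBox (fun s => Ψ (s - a)) t x = negBox Ψ (t - a) x := by
  have h : (deriv fun s => Ψ (s - a) x) = fun s => deriv (fun s => Ψ s x) (s - a) :=
    funext fun s => deriv_comp_sub_const (fun s => Ψ s x) a s
  simp only [negBox, h]
  rw [deriv_comp_sub_const (deriv fun s => Ψ s x) a t]

/-- `exists_global_solution_of_family` with initial time `1`. -/
lemma exists_solution_on_future {p σ C₀ : ℝ} (hp : 5 < p) (hσ : |σ| ≤ 1) (hC₀ : 0 < C₀) :
    ∃ ε₀ : ℝ, 0 < ε₀ ∧ ∀ ε, 0 < ε → ε < ε₀ → ∀ {g₀ g₁ : MultiIndex → E3 → ℝ},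
      DataFamily ε g₀ g₁ →
      (∀ t x, 0 ≤ t → |freeWave (g₀ 0) (fderiv ℝ (g₀ 0)) (g₁ 0) t x|
        ≤ C₀ * ε ^ (1 / 2 : ℝ) * wt (1 / 4) ε x) →
      ∃ Ψ : ℝ → E3 → ℝ, ContDiff ℝ 2 (fun z : ℝ × E3 => Ψ z.1 z.2) ∧
        (∀ t x, 1 ≤ t → negBox Ψ t x = σ * (|Ψ t x| ^ (p - 1) * Ψ t x)) ∧
        ∀ x, HasInitialDataAt Ψ (g₀ 0) (g₁ 0) x := by
  obtain ⟨ε₀, hε₀, H⟩ := exists_global_solution_of_family hp hσ hC₀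
  refine ⟨ε₀, hε₀, fun ε hε hε' g₀ g₁ hg hb => ?_⟩
  obtain ⟨Ψ, h1, h2, h3, h4⟩ := H ε hε hε' hg hb
  refine ⟨fun t => Ψ (t - 1), ?_, fun t x ht => ?_, fun x => ⟨?_, ?_⟩⟩
  · exact h1.comp (g := fun z : ℝ × E3 => Ψ z.1 z.2) (f := fun z : ℝ × E3 => (z.1 - 1, z.2))
      (by fun_prop)
  · rw [negBox_comp_sub_const]
    exact h2 _ x (by linarith)
  · simp only [sub_self]
    exact h3 x
  · exact (HasDerivAt.comp_sub_const (f := fun t => Ψ t x) 1 1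
      (by simpa using h4 x)).hasDerivWithinAt

lemma uniqueDiffOn_future : UniqueDiffOn ℝ future := by
  have : future = Ici (1 : ℝ) ×ˢ (univ : Set E3) := by ext; simp [future]
  rw [this]
  exact (uniqueDiffOn_Ici 1).prod uniqueDiffOn_univ

/-- Continuous data attained almost everywhere by a `C²` function are attained everywhere. -/
lemma hasInitialDataAt_of_ae {ψ : ℝ → E3 → ℝ} {f g : E3 → ℝ}
    (hψ : ContDiffOn ℝ 2 (fun z : ℝ × E3 => ψ z.1 z.2) future) (hf : Continuous f)
    (hg : Continuous g) (h : ∀ᵐ x : E3, HasInitialDataAt ψ f g x) (x : E3) :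
    HasInitialDataAt ψ f g x := by
  have hmem : ∀ y : E3, ((1 : ℝ), y) ∈ future := fun y => le_refl (1 : ℝ)
  have hc : Continuous fun y : E3 => ((1 : ℝ), y) := by fun_prop
  have hcψ : Continuous (ψ 1) := hψ.continuousOn.comp_continuous hc hmem
  set v : E3 → ℝ := fun y => fderivWithin ℝ (fun z : ℝ × E3 => ψ z.1 z.2) future (1, y) (1, 0)
    with hv
  have hcv : Continuous v :=
    ((hψ.continuousOn_fderivWithin uniqueDiffOn_future (by norm_num)).comp_continuous hc
      hmem).clm_apply continuous_const
  have hd : ∀ y, HasDerivWithinAt (fun t => ψ t y) (v y) (Ici 1) 1 := fun y => by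
    have h1 := ((hψ.differentiableOn (by norm_num)) (1, y) (hmem y)).hasFDerivWithinAt
    have h2 : HasDerivWithinAt (fun t : ℝ => (t, y)) ((1 : ℝ), (0 : E3)) (Ici 1) 1 :=
      ((hasDerivAt_id (1 : ℝ)).prodMk (hasDerivAt_const 1 y)).hasDerivWithinAt
    exact h1.comp_hasDerivWithinAt (f := fun t : ℝ => (t, y)) 1 h2 fun t ht => ht
  -- Continuous functions that agree almost everywhere agree everywhere. The same is then done for
  -- the one-sided time derivative, continuous because `ψ` is `C²` up to the initial time.
  have e1 : ψ 1 = f := Measure.eq_of_ae_eq (h.mono fun y hy => hy.1) hcψ hf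
  have e2 : v = g := Measure.eq_of_ae_eq
    (h.mono fun y hy => UniqueDiffWithinAt.eq_deriv _ (uniqueDiffOn_Ici 1 1 self_mem_Ici)
      (hd y) hy.2) hcv hg
  exact ⟨congrFun e1 x, e2 ▸ hd x⟩

lemma interiorRegion_subset_future {ε : ℝ} (hε : 0 < ε) : interiorRegion ε ⊆ future :=
  fun z hz => by
    have := hz.1
    simp only [future, mem_ofPred_eq]
    linarith

lemma IsClassicalSolutionOn.mono {U V : Set (ℝ × E3)} {G : ℝ → E3 → ℝ → ℝ} {φ : ℝ → E3 → ℝ}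
    (h : IsClassicalSolutionOn V G φ) (hUV : U ⊆ V) : IsClassicalSolutionOn U G φ :=
  ⟨h.1.mono hUV, fun t x hz => h.2 t x (interior_mono hUV hz)⟩

/-- The difference of two solutions of the power equation solves the perturbation equation. -/
lemma isClassicalSolutionOn_sub {p σ : ℝ} {Ψ ψ : ℝ → E3 → ℝ} {U : Set (ℝ × E3)}
    (hΨ : IsClassicalSolutionOn U (fun _ _ v => σ * (|v| ^ (p - 1) * v)) Ψ)
    (hψ : IsClassicalSolutionOn U (fun _ _ v => σ * (|v| ^ (p - 1) * v)) ψ) :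
    IsClassicalSolutionOn U (perturbationSource p σ ψ) fun t x => Ψ t x - ψ t x := by
  refine ⟨hΨ.1.sub hψ.1, fun t x hz => ?_⟩
  have hn : U ∈ 𝓝 (t, x) := mem_interior_iff_mem_nhds.1 hz
  rw [negBox_sub (hΨ.1.contDiffAt hn) (hψ.1.contDiffAt hn), hΨ.2 t x hz, hψ.2 t x hz]
  simp only [perturbationSource, add_sub_cancel]
  ring

end Cauchy

end

end ShortPulse

/-! ### Assembly of the theorem. -/

open ShortPulse in
theorem proposition6p1 (p : ℝ) (hp : 5 < p) (σ : ℝ) (hσ : σ = 1 ∨ σ = -1) :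
    ∃ ε₀ : ℝ, 0 < ε₀ ∧ ∀ ε : ℝ, 0 < ε → ε < ε₀ →
      ∀ u₀ u₁ : E3 → ℝ, IsDispersedData ε u₀ u₁ →
      ∀ h₀ h₁ : E3 → ℝ, IsPulseProfile ε h₀ h₁ →
        (∃ ψ : ℝ → E3 → ℝ, IsDispersedSolution p σ u₀ u₁ ψ) ∧
        ∀ ψ : ℝ → E3 → ℝ, IsDispersedSolution p σ u₀ u₁ ψ →
          ∃ φ : ℝ → E3 → ℝ,
            (∀ x, HasInitialDataAt φ (pulseData₀ ε h₀) (pulseData₁ ε h₁) x) ∧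
            IsClassicalSolutionOn future (perturbationSource p σ ψ) φ ∧
            IsClassicalSolutionOn (interiorRegion ε) (perturbationSource p σ ψ) φ := by
  have hσ' : |σ| ≤ 1 := by rcases hσ with rfl | rfl <;> simp
  obtain ⟨C, hC, hfam⟩ := exists_dispersed_family
  -- One amplitude serves both existence problems: `C` for the dispersed part and `40` for the
  -- pulse.
  obtain ⟨ε₀, hε₀, hsol⟩ := exists_solution_on_future hp hσ' (by linarith : 0 < C + 40)
  refine ⟨min ε₀ (1 / 4), by positivity, fun ε hε hlt u₀ u₁ hu h₀ h₁ hh => ?_⟩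
  have hε' : ε < ε₀ := hlt.trans_le (min_le_left _ _)
  have hε1 : ε < 1 / 4 := hlt.trans_le (min_le_right _ _)
  obtain ⟨g₀, g₁, hg, hg₀, hg₁, hgb⟩ := hfam hε hu
  have pg := hg.partials₀ 0 (by rw [order_zero]; omega)
  have cg₀ : Continuous (g₀ 0) := pg.cont
  have cg₁ : Continuous (g₁ 0) := (hg.partials₁ 0 (by rw [order_zero]; omega)).cont
  have cg₀' : Continuous (fderiv ℝ (g₀ 0)) := by
    rw [pg.fderiv_eq]; exact continuous_lc pg.continuous
  have hr : ∀ x, 0 ≤ ε ^ (1 / 2 : ℝ) * wt (1 / 4) ε x := fun x =>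
    mul_nonneg (Real.rpow_nonneg hε.le _) (wt_pos _ _ _).le
  constructor
  · obtain ⟨ψ, h1, h2, h3⟩ := hsol ε hε hε' hg fun t x ht => by
      nlinarith [hgb t x ht, hr x]
    refine ⟨ψ, ⟨h1.contDiffOn, fun t x hz => h2 t x ?_⟩, ?_⟩
    · exact interior_subset (s := future) hz
    · filter_upwards [hg₀, hg₁] with x e0 e1
      exact ⟨(h3 x).1.trans e0, e1 ▸ (h3 x).2⟩
  · intro ψ hψ
    have cw₀ := contDiff_pulseData₀ hε hε1 hh
    have cw₁ := contDiff_pulseData₁ hε hε1 hh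
    obtain ⟨Ψ, h1, h2, h3⟩ := hsol ε hε hε' (hg.add (dataFamily_pulse hε hε1 hh)) fun t x ht => by
      have e : fderiv ℝ (fun y => g₀ 0 y + pulseData₀ ε h₀ y)
          = fun y => fderiv ℝ (g₀ 0) y + fderiv ℝ (pulseData₀ ε h₀) y := funext fun y =>
        fderiv_fun_add (pg.hasFDerivAt y).differentiableAt (cw₀.differentiable (by norm_num) y)
      simp only [multiDeriv_zero, e]
      rw [freeWave_add cg₀ cg₀' cg₁ cw₀.continuous (cw₀.continuous_fderiv (by norm_num))
        cw₁.continuous]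
      refine (abs_add_le _ _).trans ?_
      linarith [hgb t x ht, abs_freeWave_pulse_le hε hε1 hh ht x]
    simp only [multiDeriv_zero] at h3
    -- The given `ψ` attains its data only almost everywhere, but the continuous representatives are
    -- attained everywhere; so the difference has the pulse data at every point.
    have hψ0 : ∀ x, HasInitialDataAt ψ (g₀ 0) (g₁ 0) x :=
      hasInitialDataAt_of_ae hψ.1.1 cg₀ cg₁ <| by
        filter_upwards [hψ.2, hg₀, hg₁] with x hx e0 e1
        exact ⟨hx.1.trans e0.symm, e1 ▸ hx.2⟩
    have hφ := isClassicalSolutionOn_sub (p := p) (σ := σ)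
      ⟨h1.contDiffOn, fun t x hz => h2 t x (interior_subset (s := future) hz)⟩ hψ.1
    refine ⟨_, fun x => ⟨?_, ?_⟩, hφ, hφ.mono (interiorRegion_subset_future hε)⟩
    · rw [(h3 x).1, (hψ0 x).1]; ring
    · exact ((h3 x).2.sub (hψ0 x).2).congr_deriv (by ring)
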